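/- **Theorem (Splitting the distance up to rotations).** Let $\mathcal P_2(\mathbb R^d)$ be the set of Borel probability measures on $\mathbb R^d$ with finite second moment. For $\mu\in\mathcal P_2(\mathbb R^d)$ put $\mathrm M(\mu)=\int x\,d\mu(x)$ and $\mathrm C(\mu)=\int (x-\mathrm M(\mu))\otimes(x-\mathrm M(\mu))\,d\mu(x)$, and let $\mathcal P_{2,+}(\mathbb R^d)$ be the set of $\mu\in\mathcal P_2(\mathbb R^d)$ with $\mathrm C(\mu)$ positive definite. For a symmetric positive semidefinite matrix $C$ and $\xi\in\mathbb R^d$ let $|\xi|_C^2=\langle \xi,C^{-1}\xi\rangle$ if $\xi\in\operatorname{im}C$ and $|\xi|_C^2=\infty$ otherwise. Let $\mathrm{CE}(\mu_0,\mu_1)$ be the set of pairs $(\mu,V)$ where $(\mu_t)_{t\in[0,1]}$ is a weakly continuous curve in $\mathcal P_2(\mathbb R^d)$ from $\mu_0$ to $\mu_1$, and $(V_t)_{t\in[0,1]}$ is a Borel family of vector fields, with $V$ locally integrable on $(0,1)\times\mathbb R^d$ with respect to $\mu_t(dx)\,dt$, such that $\partial_t\mu_t+\nabla\cdot(\mu_tV_t)=0$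 in the sense of distributions on $(0,1)\times\mathbb R^d$. Define $\mathcal W(\mu_0,\mu_1)\in[0,\infty]$ by $$\mathcal W(\mu_0,\mu_1)^2=\inf\Big\{\int_0^1\!\!\int\tfrac12|V_t|^2_{\mathrm C(\mu_t)}\,d\mu_t\,dt:(\mu,V)\in\mathrm{CE}(\mu_0,\mu_1)\Big\},$$ and, for $\mu_0,\mu_1$ with mean $0$ and covariance $\mathrm{Id}$, $$\mathcal W_{0,\mathrm{Id}}(\mu_0,\mu_1)^2=\inf\Big\{\int_0^1\!\!\int\tfrac12|V_t|^2\,d\mu_t\,dt:(\mu,V)\in\mathrm{CE}(\mu_0,\mu_1),\ \mathrm M(\mu_t)=0,\ \mathrm C(\mu_t)=\mathrm{Id}\ \ \forall t\in[0,1]\Big\}.$$ For $\mu\in\mathcal P_{2,+}(\mathbb R^d)$ let $\bar\mu$ be the image of $\mu$ under $x\mapsto \mathrm C(\mu)^{-1/2}(x-\mathrm M(\mu))$. For $R\in\mathrm{SO}(d)$ let $\mathrm{MC}_R(\mu_0,\mu_1)$ be the set of absolutely continuous curves $(m,C)$ on $[0,1]$ with $m_t\in\mathbb R^d$, $C_t$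 symmetric positive semidefinite, $m_i=\mathrm M(\mu_i)$, $C_i=\mathrm C(\mu_i)$ for $i=0,1$, for which there is an absolutely continuous curve $(A_t)_{t\in[0,1]}$ of invertible matrices with $$\dot A_t=\tfrac12\dot C_tA_t^{-\mathsf T}\ \text{ for a.e. }t,\qquad A_0=C_0^{1/2},\qquad C_1^{-1/2}A_1=R,$$ and define $\mathcal D_R(\mu_0,\mu_1)\in[0,\infty]$ by $$\mathcal D_R(\mu_0,\mu_1)^2=\inf\Big\{\int_0^1\tfrac12\langle\dot m_t,C_t^{-1}\dot m_t\rangle+\tfrac18\operatorname{tr}\big(\dot C_tC_t^{-1}\dot C_tC_t^{-1}\big)\,dt:(m,C)\in\mathrm{MC}_R(\mu_0,\mu_1)\Big\}.$$ All square roots of positive definite matrices are the symmetric positive definite ones, and $\inf\emptyset=\infty$. Then every $\mu_0,\mu_1\in\mathcal P_{2,+}(\mathbb R^d)$ satisfy $\mathcal W(\mu_0,\mu_1)<\infty$ and $$\mathcal W(\mu_0,\mu_1)^2=\inf_{R\in\mathrm{SO}(d)}\Big\{\mathcal W_{0,\mathrm{Id}}(R_\#\bar\mu_0,\bar\mu_1)^2+\mathcal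 D_R(\mu_0,\mu_1)^2\Big\}.$$ -/

import Mathlib

open MeasureTheory Set Matrix
open scoped ENNReal MatrixOrder

noncomputable section

namespace CovOT

/-- Euclidean space of dimension `d`. -/
abbrev E (d : ℕ) : Type := EuclideanSpace ℝ (Fin d)

/-- The linear action of a square matrix on Euclidean space. -/
def act {d : ℕ} (A : Matrix (Fin d) (Fin d) ℝ) (x : E d) : E d :=
  Matrix.toEuclideanLin A x

/-- The mean of a measure. -/
def mean {d : ℕ} (μ : Measure (E d)) : E d := ∫ x, x ∂μ

/-- The covariance matrix `∫ (x - mean μ) ⊗ (x - mean μ) dμ`. -/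
def covMat {d : ℕ} (μ : Measure (E d)) : Matrix (Fin d) (Fin d) ℝ :=
  Matrix.of fun i j => ∫ x, (x i - mean μ i) * (x j - mean μ j) ∂μ

/-- Probability measures with finite second moment. -/
def P2 (d : ℕ) : Set (Measure (E d)) :=
  {μ | IsProbabilityMeasure μ ∧ MemLp (fun x : E d => x) 2 μ}

/-- Probability measures with finite second moment and positive definite covariance. -/
def P2plus (d : ℕ) : Set (Measure (E d)) :=
  {μ | μ ∈ P2 d ∧ (covMat μ).PosDef}

/-- The squared modulated norm `|ξ|²_C`: it equals `⟨ξ, C⁻¹ ξ⟩`, that is `⟨ξ, η⟩` for any `η` with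
`C η = ξ`, if `ξ` lies in the image of `C`, and `∞` (an infimum over the empty set) otherwise.
See `modNormSq_of_eq` for the independence of `η`. -/
def modNormSq {d : ℕ} (C : Matrix (Fin d) (Fin d) ℝ) (ξ : E d) : ℝ≥0∞ :=
  ⨅ (η : E d) (_ : act C η = ξ), ENNReal.ofReal (inner ℝ ξ η)

/-- `(μ, V)` solves `∂ₜ μₜ + ∇ · (μₜ Vₜ) = 0` on `[0,1]` and connects `μ₀` to `μ₁`. Only the times
`t ∈ [0,1]` matter. -/
structure IsCE {d : ℕ} (μ₀ μ₁ : Measure (E d)) (μ : ℝ → ProbabilityMeasure (E d))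
    (V : ℝ → E d → E d) : Prop where
  start : (μ 0 : Measure (E d)) = μ₀
  finish : (μ 1 : Measure (E d)) = μ₁
  /-- weak continuity of the curve of measures -/
  weakly_continuous : ContinuousOn μ (Icc 0 1)
  finite_moment : ∀ t ∈ Icc (0 : ℝ) 1, (μ t : Measure (E d)) ∈ P2 d
  borel : Measurable (Function.uncurry V)
  /-- the flux `μₜ Vₜ dt` is a distribution (a locally finite vector measure) on `(0,1) × ℝᵈ` -/
  locally_integrable : ∀ a b r : ℝ, 0 < a → b < 1 →
    ∫⁻ t in Icc a b, ∫⁻ x in Metric.closedBall (0 : E d) r, ‖V t x‖ₑ ∂(μ t : Measure (E d)) < ⊤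
  /-- the equation holds in the sense of distributions on `(0,1) × ℝᵈ` -/
  equation : ∀ φ : ℝ × E d → ℝ, ContDiff ℝ (⊤ : ℕ∞) φ → HasCompactSupport φ →
    tsupport φ ⊆ Ioo (0 : ℝ) 1 ×ˢ univ →
    ∫ t in Ioo (0 : ℝ) 1, ∫ x, (deriv (fun s => φ (s, x)) t
      + fderiv ℝ (fun y => φ (t, y)) x (V t x)) ∂(μ t : Measure (E d)) = 0

/-- Solutions of the continuity equation along which the mean is `0` and the covariance is `Id`. -/
def IsCEId {d : ℕ} (μ₀ μ₁ : Measure (E d)) (μ : ℝ → ProbabilityMeasure (E d))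
    (V : ℝ → E d → E d) : Prop :=
  IsCE μ₀ μ₁ μ V ∧ ∀ t ∈ Icc (0 : ℝ) 1,
    mean (μ t : Measure (E d)) = 0 ∧ covMat (μ t : Measure (E d)) = 1

/-- The covariance-modulated transport distance. -/
def W {d : ℕ} (μ₀ μ₁ : Measure (E d)) : ℝ≥0∞ :=
  (⨅ (μ : ℝ → ProbabilityMeasure (E d)) (V : ℝ → E d → E d) (_ : IsCE μ₀ μ₁ μ V),
    ∫⁻ t in Ioo (0 : ℝ) 1, ∫⁻ x, 1 / 2 * modNormSq (covMat (μ t : Measure (E d))) (V t x)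
      ∂(μ t : Measure (E d))) ^ (1 / 2 : ℝ)

/-- The covariance-constrained transport distance. -/
def WId {d : ℕ} (μ₀ μ₁ : Measure (E d)) : ℝ≥0∞ :=
  (⨅ (μ : ℝ → ProbabilityMeasure (E d)) (V : ℝ → E d → E d) (_ : IsCEId μ₀ μ₁ μ V),
    ∫⁻ t in Ioo (0 : ℝ) 1, ∫⁻ x, 1 / 2 * ‖V t x‖ₑ ^ 2 ∂(μ t : Measure (E d))) ^ (1 / 2 : ℝ)

/-- The normalization map `T_{m,A}(x) = A⁻¹ (x - m)`. -/
def normalizationMap {d : ℕ} (m : E d) (A : Matrix (Fin d) (Fin d) ℝ) (x : E d) : E d :=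
  act A⁻¹ (x - m)

/-- The normalization of `μ` by the symmetric positive semidefinite square root of its
covariance. -/
def normalized {d : ℕ} (μ : Measure (E d)) : Measure (E d) :=
  μ.map (normalizationMap (mean μ) (CFC.sqrt (covMat μ)))

/-- Absolute continuity on `[0,1]` of a matrix-valued curve (entrywise). -/
def MatAC {d : ℕ} (C : ℝ → Matrix (Fin d) (Fin d) ℝ) : Prop :=
  ∀ i j, AbsolutelyContinuousOnInterval (fun t => C t i j) 0 1

/-- The entrywise time derivative of a matrix-valued curve. -/
def matDeriv {d : ℕ} (C : ℝ → Matrix (Fin d) (Fin d) ℝ) (t : ℝ) : Matrix (Fin d) (Fin d) ℝ :=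
  Matrix.of fun i j => deriv (fun s => C s i j) t

/-- Absolutely continuous curves `(m, C)` on `[0,1]`, with `C` positive semidefinite, joining the
mean and covariance of `μ₀` to those of `μ₁`. -/
structure IsMC {d : ℕ} (μ₀ μ₁ : Measure (E d)) (m : ℝ → E d)
    (C : ℝ → Matrix (Fin d) (Fin d) ℝ) : Prop where
  ac_mean : AbsolutelyContinuousOnInterval m 0 1
  ac_cov : MatAC C
  posSemidef : ∀ t ∈ Icc (0 : ℝ) 1, (C t).PosSemidef
  mean_zero : m 0 = mean μ₀
  mean_one : m 1 = mean μ₁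
  cov_zero : C 0 = covMat μ₀
  cov_one : C 1 = covMat μ₁

/-- `A` is the absolutely continuous solution on `[0,1]` of `Ȧₜ = ½ Ċₜ Aₜ⁻ᵀ` for almost every `t`,
with `A₀ = C₀^{1/2}`. -/
structure IsLeftRoot {d : ℕ} (C A : ℝ → Matrix (Fin d) (Fin d) ℝ) : Prop where
  ac : MatAC A
  invertible : ∀ t ∈ Icc (0 : ℝ) 1, IsUnit (A t).det
  init : A 0 = CFC.sqrt (C 0)
  ode : ∀ᵐ t ∂(volume.restrict (Ioo (0 : ℝ) 1)),
    matDeriv A t = (1 / 2 : ℝ) • (matDeriv C t * ((A t)⁻¹)ᵀ)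

/-- The co-rotation `C^{-1/2} A` of a left square root `A` of `C`. -/
def coRotation {d : ℕ} (C A : Matrix (Fin d) (Fin d) ℝ) : Matrix (Fin d) (Fin d) ℝ :=
  (CFC.sqrt C)⁻¹ * A

/-- Moment curves whose curve of co-rotations ends in `R` at time `1`. -/
def IsMCR {d : ℕ} (R : Matrix (Fin d) (Fin d) ℝ) (μ₀ μ₁ : Measure (E d)) (m : ℝ → E d)
    (C : ℝ → Matrix (Fin d) (Fin d) ℝ) : Prop :=
  IsMC μ₀ μ₁ m C ∧ ∃ A, IsLeftRoot C A ∧ coRotation (C 1) (A 1) = R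

/-- The moment action `∫₀¹ ½ ⟨ṁ, C⁻¹ ṁ⟩ + ⅛ tr(Ċ C⁻¹ Ċ C⁻¹) dt`. -/
def momentAction {d : ℕ} (m : ℝ → E d) (C : ℝ → Matrix (Fin d) (Fin d) ℝ) : ℝ≥0∞ :=
  ∫⁻ t in Ioo (0 : ℝ) 1, ENNReal.ofReal
    (1 / 2 * inner ℝ (deriv m t) (act (C t)⁻¹ (deriv m t))
      + 1 / 8 * Matrix.trace (matDeriv C t * (C t)⁻¹ * matDeriv C t * (C t)⁻¹))

/-- The rotation-constrained moment distance. -/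
def D {d : ℕ} (R : Matrix (Fin d) (Fin d) ℝ) (μ₀ μ₁ : Measure (E d)) : ℝ≥0∞ :=
  (⨅ (m : ℝ → E d) (C : ℝ → Matrix (Fin d) (Fin d) ℝ) (_ : IsMCR R μ₀ μ₁ m C),
    momentAction m C) ^ (1 / 2 : ℝ)

lemma inner_act {d : ℕ} {C : Matrix (Fin d) (Fin d) ℝ} (hC : C.IsHermitian) (x y : E d) :
    inner ℝ (act C x) y = inner ℝ x (act C y) :=
  (Matrix.isSymmetric_toEuclideanLin_iff.mpr hC) x y

/-- The value of the modulated norm on the image of a symmetric matrix. -/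
lemma modNormSq_of_eq {d : ℕ} {C : Matrix (Fin d) (Fin d) ℝ} (hC : C.IsHermitian) {ξ η : E d}
    (h : act C η = ξ) : modNormSq C ξ = ENNReal.ofReal (inner ℝ ξ η) := by
  apply le_antisymm (iInf₂_le η h)
  refine le_iInf₂ fun η' h' => le_of_eq ?_
  congr 1
  calc inner ℝ ξ η = inner ℝ (act C η') η := by rw [h']
    _ = inner ℝ η' ξ := by rw [inner_act hC, h]
    _ = inner ℝ ξ η' := real_inner_comm _ _

end CovOT

end

/-!
A curve of measures with positive definite covariance is put into normal form by a moving frame.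
Let `m` and `C` be the mean and covariance along the curve and let `A` solve `A' = ½ C' A⁻ᵀ` with
`A₀ = C₀^{1/2}`. Then `A Aᵀ = C` for all times and `A⁻¹ A' = ½ A⁻¹ C' A⁻ᵀ` is symmetric. The
terminal value `R = C₁^{-1/2} A₁` is a rotation, and the inverses of the affine maps
`x ↦ Aₜ Rᵀ x + mₜ` transport the curve to one with mean `0` and covariance `Id`, joining the
rotated normalization of `μ₀` to the normalization of `μ₁`. In the frame, the original velocity is
an affine field `a + S x` with `S` symmetric plus the velocity `U` of the normalized curve. As the
latter preserves mean and covariance, `U` is orthogonal in `L²` to all such affine fields, so the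
action is the sum of the energy of the affine field, which is the moment action of `(m, C)`, and
of the kinetic energy of `U` (`action_push`, `lintegral_affine_add_sq`, `moment_integrand`).
Reading this in both directions gives the two inequalities: `exists_curve_of_split` builds a curve
from a normalized one and a moment curve with co-rotation `R`, and `exists_split_of_curve`
decomposes a given curve.

The analytic work consists of three points.

* Curves of finite action are regular. The modulated norm only controls the flux in direction `p`
  relative to the variance in direction `p` (`DirControl`). The resulting bound on increments of
  the second moment is closed by a Baire category argument (`exists_bound_of_increments`,
  `exists_moment_bound`), since the second moment is a priori only finite at each time. Then mean
  and covariance are absolutely continuous, and the covariance stays positive definite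
  (`IsFlow.covMat_posDef`).
* The continuity equation is preserved by affine maps whose coefficients are merely absolutely
  continuous in time (`AffineCurve.isFlow_push`). Test functions composed with these maps are only
  absolutely continuous in time, and `IsFlow.integral_sub_time` extends the equation to them.
* The frame exists because `A' = ½ C' C⁻¹ A` is a linear equation with integrable coefficient
  (`exists_linear_ode`, `exists_matrix_ode`).

Finiteness of the modulated distance follows by displacement interpolation along the independent
coupling, driven by the mean velocity of the segments through each point: there the covariance is
uniformly nondegenerate (`Interpolation.isCE`, `Interpolation.action_lt_top`).
-/

noncomputable section

namespace CovOT

open Filter Topology ProbabilityTheory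

section

open Filter Topology

/-! ### Absolutely continuous functions with a prescribed derivative -/

/-- `f` is absolutely continuous on `[0,1]` and `f'` is, almost everywhere, its derivative. -/
structure IsACWith (f f' : ℝ → ℝ) : Prop where
  ac : AbsolutelyContinuousOnInterval f 0 1
  hasDerivAt : ∀ᵐ t ∂(volume.restrict (Ioo (0 : ℝ) 1)), HasDerivAt f (f' t) t

lemma _root_.AbsolutelyContinuousOnInterval.congr_on {X : Type*} [PseudoMetricSpace X]
    {f g : ℝ → X} {a b : ℝ}
    (hf : AbsolutelyContinuousOnInterval f a b) (h : EqOn f g (uIcc a b)) :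
    AbsolutelyContinuousOnInterval g a b := by
  rw [absolutelyContinuousOnInterval_iff] at hf ⊢
  intro ε hε
  obtain ⟨δ, hδ, H⟩ := hf ε hε
  refine ⟨δ, hδ, fun I hI hlen => ?_⟩
  convert! H I hI hlen using 1
  refine Finset.sum_congr rfl fun i hi => ?_
  rw [h (hI.1 i hi).1, h (hI.1 i hi).2]

namespace IsACWith

variable {f f' g g' : ℝ → ℝ}

lemma of_deriv (hf : AbsolutelyContinuousOnInterval f 0 1) : IsACWith f (deriv f) := by
  refine ⟨hf, ?_⟩
  rw [ae_restrict_iff' measurableSet_Ioo]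
  filter_upwards [hf.ae_differentiableAt] with t ht h
  exact (ht (by rw [uIcc_of_le zero_le_one]; exact Ioo_subset_Icc_self h)).hasDerivAt

lemma deriv_ae_eq (hf : IsACWith f f') : ∀ᵐ t ∂(volume.restrict (Ioo (0 : ℝ) 1)),
    deriv f t = f' t := hf.hasDerivAt.mono fun _ h => h.deriv

lemma congr_deriv (hf : IsACWith f f')
    (h : ∀ᵐ t ∂(volume.restrict (Ioo (0 : ℝ) 1)), f' t = g' t) : IsACWith f g' :=
  ⟨hf.ac, by filter_upwards [hf.hasDerivAt, h] with t h1 h2; rwa [← h2]⟩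

lemma congr (hf : IsACWith f f') (h : EqOn f g (Icc 0 1)) : IsACWith g f' := by
  refine ⟨hf.ac.congr_on (by rwa [uIcc_of_le zero_le_one]), ?_⟩
  filter_upwards [hf.hasDerivAt, ae_restrict_mem measurableSet_Ioo] with t h1 ht
  refine h1.congr_of_eventuallyEq ?_
  filter_upwards [isOpen_Ioo.mem_nhds ht] with s hs
  exact (h (Ioo_subset_Icc_self hs)).symm

lemma intervalIntegrable (hf : IsACWith f f') {a b : ℝ} (ha : a ∈ Icc (0 : ℝ) 1)
    (hb : b ∈ Icc (0 : ℝ) 1) : IntervalIntegrable f' volume a b := by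
  have h : IntervalIntegrable f' volume 0 1 := by
    refine hf.ac.intervalIntegrable_deriv.congr_ae ?_
    rw [uIoc_of_le zero_le_one, ← restrict_Ioo_eq_restrict_Ioc]
    exact hf.deriv_ae_eq
  refine h.mono_set ?_
  rw [uIcc_of_le zero_le_one]
  exact uIcc_subset_Icc ha hb

lemma integrableOn (hf : IsACWith f f') : IntegrableOn f' (Ioo 0 1) := by
  have := (hf.intervalIntegrable (a := 0) (b := 1) (by simp) (by simp)).1
  rwa [integrableOn_Ioc_iff_integrableOn_Ioo] at this

lemma integral (hf : IsACWith f f') {a b : ℝ} (ha : a ∈ Icc (0 : ℝ) 1)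
    (hb : b ∈ Icc (0 : ℝ) 1) : ∫ t in a..b, f' t = f b - f a := by
  have hs : uIcc a b ⊆ uIcc 0 1 := by
    rw [uIcc_of_le (zero_le_one' ℝ)]; exact uIcc_subset_Icc ha hb
  rw [← (hf.ac.mono hs).integral_deriv_eq_sub]
  refine intervalIntegral.integral_congr_ae ?_
  have h1 := hf.deriv_ae_eq
  rw [restrict_Ioo_eq_restrict_Ioc, ae_restrict_iff' measurableSet_Ioc] at h1
  filter_upwards [h1] with t ht hmem
  refine (ht ?_).symm
  rcases le_total a b with h | h
  · rw [uIoc_of_le h] at hmem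
    exact ⟨ha.1.trans_lt hmem.1, hmem.2.trans hb.2⟩
  · rw [uIoc_of_ge h] at hmem
    exact ⟨hb.1.trans_lt hmem.1, hmem.2.trans ha.2⟩

lemma of_integral (hg : IntervalIntegrable f' volume 0 1)
    (h : ∀ t ∈ Icc (0 : ℝ) 1, f t = f 0 + ∫ s in (0 : ℝ)..t, f' s) : IsACWith f f' := by
  have h0 : IsACWith (fun t => f 0 + ∫ s in (0 : ℝ)..t, f' s) f' := by
    refine ⟨?_, ?_⟩
    · refine AbsolutelyContinuousOnInterval.fun_add ?_
        (hg.absolutelyContinuousOnInterval_intervalIntegral (by simp))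
      exact (LipschitzWith.const (f 0)).lipschitzOnWith.absolutelyContinuousOnInterval
    · rw [ae_restrict_iff' measurableSet_Ioo]
      filter_upwards [hg.ae_hasDerivAt_integral] with t ht hmem
      have := ht (by rw [uIcc_of_le zero_le_one]; exact Ioo_subset_Icc_self hmem) 0 (by simp)
      simpa using! this.const_add (f 0)
  exact h0.congr fun t ht => (h t ht).symm

lemma continuousOn (hf : IsACWith f f') : ContinuousOn f (Icc 0 1) := by
  simpa [uIcc_of_le (zero_le_one' ℝ)] using hf.ac.continuousOn

lemma const (c : ℝ) : IsACWith (fun _ => c) (fun _ => 0) :=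
  ⟨(LipschitzWith.const c).lipschitzOnWith.absolutelyContinuousOnInterval,
    ae_of_all _ fun t => hasDerivAt_const t c⟩

lemma add (hf : IsACWith f f') (hg : IsACWith g g') :
    IsACWith (fun t => f t + g t) (fun t => f' t + g' t) :=
  ⟨hf.ac.fun_add hg.ac, by
    filter_upwards [hf.hasDerivAt, hg.hasDerivAt] with t h1 h2 using h1.fun_add h2⟩

lemma neg (hf : IsACWith f f') : IsACWith (fun t => - f t) (fun t => - f' t) :=
  ⟨hf.ac.fun_neg, by filter_upwards [hf.hasDerivAt] with t h1 using h1.fun_neg⟩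

lemma sub (hf : IsACWith f f') (hg : IsACWith g g') :
    IsACWith (fun t => f t - g t) (fun t => f' t - g' t) :=
  ⟨hf.ac.fun_sub hg.ac, by
    filter_upwards [hf.hasDerivAt, hg.hasDerivAt] with t h1 h2 using h1.fun_sub h2⟩

lemma mul (hf : IsACWith f f') (hg : IsACWith g g') :
    IsACWith (fun t => f t * g t) (fun t => f' t * g t + f t * g' t) :=
  ⟨hf.ac.fun_mul hg.ac, by
    filter_upwards [hf.hasDerivAt, hg.hasDerivAt] with t h1 h2 using h1.fun_mul h2⟩

lemma const_mul (c : ℝ) (hf : IsACWith f f') :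
    IsACWith (fun t => c * f t) (fun t => c * f' t) := by
  simpa using (const c).mul hf

lemma mul_const (c : ℝ) (hf : IsACWith f f') :
    IsACWith (fun t => f t * c) (fun t => f' t * c) := by
  simpa using hf.mul (const c)

lemma sum {ι : Type*} (s : Finset ι) {F F' : ι → ℝ → ℝ} (h : ∀ i ∈ s, IsACWith (F i) (F' i)) :
    IsACWith (fun t => ∑ i ∈ s, F i t) (fun t => ∑ i ∈ s, F' i t) := by
  classical
  induction s using Finset.induction_on with
  | empty => simpa using const 0
  | insert i s hi ih =>
    simp only [Finset.sum_insert hi]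
    exact (h i (by simp)).add (ih fun j hj => h j (by simp [hj]))

lemma pow (hf : IsACWith f f') (n : ℕ) :
    IsACWith (fun t => f t ^ n) (fun t => n * f t ^ (n - 1) * f' t) := by
  induction n with
  | zero => simpa using const 1
  | succ n ih =>
    have := ih.mul hf
    refine (this.congr fun t _ => (pow_succ _ _).symm).congr_deriv (ae_of_all _ fun t => ?_)
    rcases n with _ | n
    · simp
    · simp; ring

lemma eqOn (hf : IsACWith f f') (hg : IsACWith g g') (h0 : f 0 = g 0)
    (h : ∀ᵐ t ∂(volume.restrict (Ioo (0 : ℝ) 1)), f' t = g' t) : EqOn f g (Icc 0 1) := by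
  intro t ht
  have h1 := hf.integral (a := 0) (by simp) ht
  have h2 := (hg.congr_deriv (h.mono fun _ h => h.symm)).integral (a := 0) (by simp) ht
  linarith

end IsACWith

/-! ### Two growth lemmas -/

lemma increment_le_of_le {N α : ℝ → ℝ} (hα : IntervalIntegrable α volume 0 1)
    (hα0 : ∀ t, 0 ≤ α t)
    (h : ∀ a b B : ℝ, 0 ≤ a → a ≤ b → b ≤ 1 → (∀ t ∈ Icc a b, N t ≤ B) →
      |N b - N a| ≤ B * ∫ t in a..b, α t) (s u B : ℝ) (hs : s ∈ Icc (0 : ℝ) 1)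
    (hu : u ∈ Icc (0 : ℝ) 1) (hB : ∀ t ∈ uIcc s u, N t ≤ B) :
    N s ≤ N u + B * |(∫ r in (0 : ℝ)..s, α r) - ∫ r in (0 : ℝ)..u, α r| := by
  have hint : ∀ t ∈ Icc (0 : ℝ) 1, IntervalIntegrable α volume 0 t := fun t ht =>
    hα.mono_set (by rw [uIcc_of_le ht.1, uIcc_of_le zero_le_one]; exact Icc_subset_Icc_right ht.2)
  rcases le_total s u with hle | hle
  · have h1 := h s u B hs.1 hle hu.2 (by rwa [uIcc_of_le hle] at hB)
    have h2 := intervalIntegral.integral_interval_sub_left (hint u hu) (hint s hs)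
    rw [abs_sub_comm, h2, abs_of_nonneg (intervalIntegral.integral_nonneg hle fun t _ => hα0 t)]
    linarith [(abs_le.mp h1).1]
  · have h1 := h u s B hu.1 hle hs.2 (by rwa [uIcc_of_ge hle] at hB)
    have h2 := intervalIntegral.integral_interval_sub_left (hint s hs) (hint u hu)
    rw [h2, abs_of_nonneg (intervalIntegral.integral_nonneg hle fun t _ => hα0 t)]
    linarith [(abs_le.mp h1).2]

/-- A nonnegative function on `[0,1]` whose increments are controlled by `∫ α` times its own
supremum is bounded. Finiteness at each point is the only a priori information: Baire's theorem
gives a uniform bound on a portion of the set where local boundedness fails. -/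
lemma exists_bound_of_increments {N α : ℝ → ℝ}
    (hcl : ∀ K : ℝ, IsClosed {t | t ∈ Icc (0 : ℝ) 1 ∧ N t ≤ K})
    (hα : IntervalIntegrable α volume 0 1) (hα0 : ∀ t, 0 ≤ α t)
    (hN0 : ∀ t, 0 ≤ N t)
    (h : ∀ a b B : ℝ, 0 ≤ a → a ≤ b → b ≤ 1 → (∀ t ∈ Icc a b, N t ≤ B) →
      |N b - N a| ≤ B * ∫ t in a..b, α t) :
    ∃ B, ∀ t ∈ Icc (0 : ℝ) 1, N t ≤ B := by
  set I : ℝ → ℝ := fun t => ∫ s in (0 : ℝ)..t, α s with hI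
  have key := increment_le_of_le hα hα0 h
  have Icont : ContinuousOn I (Icc 0 1) := by
    have := intervalIntegral.continuousOn_primitive_interval' hα (a := 0) (by simp)
    rwa [uIcc_of_le zero_le_one] at this
  -- the closed set of times near which `N` is unbounded
  set Z : Set ℝ := {t | t ∈ Icc (0 : ℝ) 1 ∧ ∀ ε > 0, ∀ B : ℝ, ∃ s ∈ Icc (0 : ℝ) 1,
    |s - t| < ε ∧ B < N s} with hZ
  have Zcl : IsClosed Z := by
    refine isClosed_of_closure_subset fun t ht => ?_
    rw [Metric.mem_closure_iff] at ht
    refine ⟨?_, fun ε hε B => ?_⟩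
    · have : t ∈ closure (Icc (0 : ℝ) 1) := by
        rw [Metric.mem_closure_iff]
        exact fun ε hε => let ⟨b, hb, hd⟩ := ht ε hε; ⟨b, hb.1, hd⟩
      rwa [isClosed_Icc.closure_eq] at this
    · obtain ⟨b, hb, hd⟩ := ht (ε / 2) (by positivity)
      obtain ⟨s, hs, hsb, hB⟩ := hb.2 (ε / 2) (by positivity) B
      refine ⟨s, hs, ?_, hB⟩
      rw [Real.dist_eq, abs_sub_comm] at hd
      calc |s - t| = |(s - b) + (b - t)| := by ring_nf
        _ ≤ |s - b| + |b - t| := abs_add_le _ _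
        _ < ε := by linarith
  have cpt : ∀ K : Set ℝ, IsCompact K → K ⊆ Icc 0 1 → (∀ t ∈ K, t ∉ Z) →
      ∃ B, ∀ t ∈ K, N t ≤ B := by
    intro K hK hK1 hKZ
    refine hK.induction_on (p := fun S => ∃ B, ∀ t ∈ S, N t ≤ B) ⟨0, by simp⟩ ?_ ?_ ?_
    · rintro s t hst ⟨B, hB⟩
      exact ⟨B, fun x hx => hB x (hst hx)⟩
    · rintro s t ⟨B, hB⟩ ⟨B', hB'⟩
      exact ⟨max B B', fun x hx => hx.elim (fun h => (hB x h).trans (le_max_left _ _))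
        fun h => (hB' x h).trans (le_max_right _ _)⟩
    · intro x hx
      have := hKZ x hx
      simp only [hZ, mem_ofPred_eq, not_and, not_forall, not_exists, not_lt] at this
      obtain ⟨ε, hε, B, hB⟩ := this (hK1 hx)
      refine ⟨Metric.ball x ε ∩ K, inter_mem (mem_nhdsWithin_of_mem_nhds (Metric.ball_mem_nhds x hε)) self_mem_nhdsWithin, B, ?_⟩
      rintro t ⟨ht, htK⟩
      exact hB t (hK1 htK) (by simpa [Real.dist_eq] using ht)
  by_cases hZe : Z = ∅
  · exact cpt _ isCompact_Icc subset_rfl (by simp [hZe])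
  exfalso
  have hZne : Z.Nonempty := nonempty_iff_ne_empty.mpr hZe
  have : Nonempty Z := hZne.to_subtype
  have : CompleteSpace Z := Zcl.completeSpace_coe
  -- Baire: on a portion of `Z` the function is bounded by some `n`
  obtain ⟨n, z, hz⟩ := nonempty_interior_of_iUnion_of_closed
    (f := fun n : ℕ => {z : Z | N z ≤ n}) (fun n => by
      convert (hcl n).preimage (continuous_subtype_val (p := (· ∈ Z))) using 1
      ext z
      exact ⟨fun h => ⟨z.2.1, h⟩, fun h => h.2⟩) (by
      refine eq_univ_of_forall fun z => mem_iUnion.mpr ?_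
      exact exists_nat_ge (N z))
  rw [mem_interior_iff_mem_nhds, Metric.mem_nhds_iff] at hz
  obtain ⟨δ₁, hδ₁, hball⟩ := hz
  have hn : ∀ z' ∈ Z, |z' - z| < δ₁ → N z' ≤ n := fun z' hz' hd =>
    hball (show (⟨z', hz'⟩ : Z) ∈ Metric.ball z δ₁ from by
      rw [Metric.mem_ball, Subtype.dist_eq, Real.dist_eq]; exact hd)
  obtain ⟨δ₂, hδ₂, hI8⟩ := Metric.continuousOn_iff.mp Icont z z.2.1 (1 / 8) (by norm_num)
  have hI4 : ∀ s ∈ Icc (0 : ℝ) 1, ∀ u ∈ Icc (0 : ℝ) 1, |s - z| < δ₂ → |u - z| < δ₂ →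
      |I s - I u| ≤ 1 / 4 := by
    intro s hs u hu hsd hud
    have h1 := hI8 s hs hsd
    have h2 := hI8 u hu hud
    rw [Real.dist_eq] at h1 h2
    rw [abs_lt] at h1 h2
    rw [abs_le]
    constructor <;> linarith [h1.1, h1.2, h2.1, h2.2]
  -- near `z` the integral of `α` is at most `1/4`, which lets the increments be absorbed: `N` is
  -- bounded near `z`, contradicting `z ∈ Z`
  have main : ∀ u ∈ Icc (0 : ℝ) 1, |u - z| < min δ₁ δ₂ → N u ≤ 2 * n := by
    intro u hu hud
    by_cases huZ : u ∈ Z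
    · have := hn u huZ (hud.trans_le (min_le_left _ _))
      have : (0 : ℝ) ≤ n := n.cast_nonneg
      linarith
    have hclose : ∀ w ∈ uIcc (z : ℝ) u, |w - z| < min δ₁ δ₂ := fun w hw =>
      (abs_sub_left_of_mem_uIcc hw).trans_lt hud
    have hsub : uIcc (z : ℝ) u ⊆ Icc 0 1 := uIcc_subset_Icc z.2.1 hu
    -- compare with the point of `Z` between `z` and `u` closest to `u`: there `N` is at most `n`
    obtain ⟨s, hs, hsmin⟩ := (isCompact_uIcc.inter_left Zcl).exists_isMinOn
      ⟨z, z.2, left_mem_uIcc (a := (z : ℝ)) (b := u)⟩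
      (f := fun s => |u - s|) (by fun_prop)
    have hs01 : s ∈ Icc (0 : ℝ) 1 := hs.1.1
    have hsu : uIcc s u ⊆ uIcc (z : ℝ) u := uIcc_subset_uIcc hs.2 right_mem_uIcc
    have hnotZ : ∀ w ∈ uIcc s u, w ≠ s → w ∉ Z := by
      intro w hw hws hwZ
      have h1 : |u - s| ≤ |u - w| := hsmin ⟨hwZ, hsu hw⟩
      rcases le_total s u with hle | hle
      · rw [uIcc_of_le hle] at hw
        rw [abs_of_nonneg (by linarith), abs_of_nonneg (by linarith [hw.2])] at h1
        exact hws (le_antisymm (by linarith) hw.1)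
      · rw [uIcc_of_ge hle] at hw
        rw [abs_of_nonpos (by linarith), abs_of_nonpos (by linarith [hw.1])] at h1
        exact hws (le_antisymm hw.2 (by linarith))
    have hsup : ∀ v ∈ uIcc s u, ∀ p ∈ uIcc v u, BddAbove (N '' uIcc v u) →
        ∀ w ∈ uIcc v u, N w ≤ 4 / 3 * N p := by
      intro v hv p hp hbdd w hw
      have hvu : uIcc v u ⊆ uIcc (z : ℝ) u := (uIcc_subset_uIcc hv right_mem_uIcc).trans hsu
      have hle : ∀ w ∈ uIcc v u, N w ≤ sSup (N '' uIcc v u) := fun w hw =>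
        le_csSup hbdd ⟨w, hw, rfl⟩
      have hS0 : 0 ≤ sSup (N '' uIcc v u) := (hN0 w).trans (hle w hw)
      have : sSup (N '' uIcc v u) ≤ N p + sSup (N '' uIcc v u) * (1 / 4) := by
        refine csSup_le ⟨_, w, hw, rfl⟩ ?_
        rintro _ ⟨w', hw', rfl⟩
        have h1 := key w' p _ (hsub (hvu hw')) (hsub (hvu hp))
          fun t ht => hle t (uIcc_subset_uIcc hw' hp ht)
        refine h1.trans ?_
        gcongr
        exact hI4 _ (hsub (hvu hw')) _ (hsub (hvu hp))
          ((hclose _ (hvu hw')).trans_le (min_le_right _ _))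
          ((hclose _ (hvu hp)).trans_le (min_le_right _ _))
      linarith [hle w hw]
    -- `N` is known to be bounded only away from `s`; the uniform estimate there extends to `s`
    have hstep : ∀ v ∈ uIcc s u, v ≠ s → N v ≤ 4 / 3 * N u := by
      intro v hv hvs
      refine hsup v hv u right_mem_uIcc ?_ v left_mem_uIcc
      obtain ⟨B, hB⟩ := cpt (uIcc v u) isCompact_uIcc
        ((uIcc_subset_uIcc hv right_mem_uIcc).trans (hsu.trans hsub)) fun t ht => by
          refine hnotZ t (uIcc_subset_uIcc hv right_mem_uIcc ht) ?_
          rintro rfl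
          rcases le_total t u with hle | hle
          · rw [uIcc_of_le hle] at hv
            rw [uIcc_of_le hv.2] at ht
            exact hvs (le_antisymm ht.1 hv.1)
          · rw [uIcc_of_ge hle] at hv
            rw [uIcc_of_ge hv.1] at ht
            exact hvs (le_antisymm hv.2 ht.2)
      exact ⟨B, by rintro _ ⟨t, ht, rfl⟩; exact hB t ht⟩
    have hfin : N u ≤ 4 / 3 * N s := by
      refine hsup s left_mem_uIcc s left_mem_uIcc ?_ u right_mem_uIcc
      refine ⟨max (N s) (4 / 3 * N u), ?_⟩
      rintro _ ⟨t, ht, rfl⟩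
      by_cases hts : t = s
      · rw [hts]; exact le_max_left _ _
      · exact (hstep t ht hts).trans (le_max_right _ _)
    have := hn s hs.1 ((hclose s hs.2).trans_le (min_le_left _ _))
    have : (0 : ℝ) ≤ n := n.cast_nonneg
    linarith
  obtain ⟨s, hs, hsd, hsB⟩ := z.2.2 (min δ₁ δ₂) (lt_min hδ₁ hδ₂) (2 * n)
  exact absurd (main s hs hsd) (not_le.mpr hsB)

/-- Under the same control of increments, a nonnegative function cannot reach zero. -/
lemma pos_of_increments {N α : ℝ → ℝ} (hα : IntervalIntegrable α volume 0 1)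
    (hα0 : ∀ t, 0 ≤ α t) (hN : ContinuousOn N (Icc 0 1)) (hN0 : ∀ t ∈ Icc (0 : ℝ) 1, 0 ≤ N t)
    (h : ∀ a b B : ℝ, 0 ≤ a → a ≤ b → b ≤ 1 → (∀ t ∈ Icc a b, N t ≤ B) →
      |N b - N a| ≤ B * ∫ t in a..b, α t) (h0 : 0 < N 0) :
    ∀ t ∈ Icc (0 : ℝ) 1, 0 < N t := by
  have key := increment_le_of_le hα hα0 h
  by_contra! hcon
  obtain ⟨t₁, ht₁, hNt₁⟩ := hcon
  have Icont : ContinuousOn (fun t => ∫ s in (0 : ℝ)..t, α s) (Icc 0 1) := by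
    have := intervalIntegral.continuousOn_primitive_interval' hα (a := 0) (by simp)
    rwa [uIcc_of_le zero_le_one] at this
  -- just before the first zero `z`, the maximum of `N` is at most a quarter of itself
  obtain ⟨z, ⟨hz, hNz⟩, hzmin⟩ := (isCompact_Icc.of_isClosed_subset
    (hN.preimage_isClosed_of_isClosed isClosed_Icc (isClosed_Iic (a := (0 : ℝ))))
    inter_subset_left).exists_isLeast ⟨t₁, ht₁, hNt₁⟩
  have hNz : N z ≤ 0 := hNz
  have hz0 : 0 < z := lt_of_le_of_ne hz.1 (by rintro rfl; linarith)
  obtain ⟨δ, hδ, hI⟩ := Metric.continuousOn_iff.mp Icont z hz (1 / 4) (by norm_num)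
  set s := max 0 (z - δ / 2) with hsdef
  have hsz : s < z := max_lt hz0 (by linarith)
  have hs0 : 0 ≤ s := le_max_left _ _
  have hsub : Icc s z ⊆ Icc 0 1 := Icc_subset_Icc hs0 hz.2
  obtain ⟨w, hw, hwmax⟩ := isCompact_Icc.exists_isMaxOn ⟨s, left_mem_Icc.mpr hsz.le⟩
    (hN.mono hsub)
  have h1 := key w z (N w) (hsub hw) hz fun t ht => hwmax (by
    rw [uIcc_of_le hw.2] at ht; exact ⟨hw.1.trans ht.1, ht.2⟩)
  have h2 := hI w (hsub hw) (by
    rw [Real.dist_eq, abs_of_nonpos (by linarith [hw.2])]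
    linarith [hw.1, le_max_right 0 (z - δ / 2)])
  rw [Real.dist_eq] at h2
  have h3 : N s ≤ N w := hwmax (left_mem_Icc.mpr hsz.le)
  have h4 : N s ≤ 0 := by
    have := mul_le_mul_of_nonneg_left h2.le (hN0 w (hsub hw))
    linarith
  exact absurd (hzmin ⟨hsub (left_mem_Icc.mpr hsz.le), h4⟩) (not_le.mpr hsz)

/-! ### The fundamental lemma of the calculus of variations -/

lemma exists_Icc_superset {K : Set ℝ} (hK : IsCompact K) (hK1 : K ⊆ Ioo 0 1) :
    ∃ a b : ℝ, 0 < a ∧ a ≤ 1 / 2 ∧ 1 / 2 ≤ b ∧ b < 1 ∧ K ⊆ Ioo a b := by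
  rcases K.eq_empty_or_nonempty with rfl | hne
  · exact ⟨1 / 2, 1 / 2, by norm_num, le_rfl, le_rfl, by norm_num, empty_subset _⟩
  obtain ⟨p, hp, hpmin⟩ := hK.exists_isLeast hne
  obtain ⟨q, hq, hqmax⟩ := hK.exists_isGreatest hne
  have h1 := hK1 hp
  have h2 := hK1 hq
  refine ⟨min (p / 2) (1 / 2), max ((q + 1) / 2) (1 / 2), lt_min (by linarith [h1.1]) (by norm_num),
    min_le_right _ _, le_max_right _ _, max_lt (by linarith [h2.2]) (by norm_num), fun t ht => ?_⟩
  exact ⟨(min_le_left _ _).trans_lt (by linarith [hpmin ht, h1.1]),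
    lt_of_lt_of_le (by linarith [hqmax ht, h2.2]) (le_max_left _ _)⟩

/-- The lemma of du Bois-Reymond: a continuous function on `(0,1)` with a locally integrable
distributional derivative is a primitive of it. -/
lemma sub_eq_integral_of_weak_deriv {F g : ℝ → ℝ} (hF : ContinuousOn F (Ioo 0 1))
    (hg : ∀ a b : ℝ, 0 < a → a ≤ b → b < 1 → IntervalIntegrable g volume a b)
    (h : ∀ ψ : ℝ → ℝ, ContDiff ℝ (⊤ : ℕ∞) ψ → HasCompactSupport ψ → tsupport ψ ⊆ Ioo 0 1 →
      ∫ t in Ioo (0 : ℝ) 1, (deriv ψ t * F t + ψ t * g t) = 0)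
    {a b : ℝ} (ha : 0 < a) (hab : a ≤ b) (hb : b < 1) : F b - F a = ∫ t in a..b, g t := by
  have hg' : ∀ a ∈ Ioo (0 : ℝ) 1, ∀ b ∈ Ioo (0 : ℝ) 1, IntervalIntegrable g volume a b := by
    intro a ha b hb
    rcases le_total a b with hle | hle
    · exact hg a b ha.1 hle hb.2
    · exact (hg b a hb.1 hle ha.2).symm
  have half : (1 / 2 : ℝ) ∈ Ioo (0 : ℝ) 1 := by norm_num
  set G : ℝ → ℝ := fun t => ∫ s in (1 / 2 : ℝ)..t, g s with hG
  have Gac : ∀ p q : ℝ, 0 < p → p ≤ 1 / 2 → 1 / 2 ≤ q → q < 1 →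
      AbsolutelyContinuousOnInterval G p q := fun p q hp hp2 hq2 hq =>
    (hg p q hp (hp2.trans hq2) hq).absolutelyContinuousOnInterval_intervalIntegral
      (by rw [uIcc_of_le (hp2.trans hq2)]; exact ⟨hp2, hq2⟩)
  set H : ℝ → ℝ := fun t => F t - G t with hH
  have Hcont' : ∀ p q : ℝ, 0 < p → p ≤ 1 / 2 → 1 / 2 ≤ q → q < 1 → ContinuousOn H (Icc p q) := by
    intro p q hp hp2 hq2 hq
    have h1 := (Gac p q hp hp2 hq2 hq).continuousOn
    rw [uIcc_of_le (hp2.trans hq2)] at h1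
    exact (hF.mono (fun t ht => ⟨hp.trans_le ht.1, ht.2.trans_lt hq⟩)).sub h1
  have Hcont : ContinuousOn H (Ioo 0 1) := by
    intro t ht
    obtain ⟨p, q, hp, hp2, hq2, hq, hpq⟩ := exists_Icc_superset isCompact_singleton
      (singleton_subset_iff.mpr ht)
    have htpq : t ∈ Ioo p q := hpq rfl
    exact ((Hcont' p q hp hp2 hq2 hq).continuousAt (Icc_mem_nhds htpq.1 htpq.2)).continuousWithinAt
  -- `H` is orthogonal to derivatives of test functions
  have orth : ∀ (ψ : ℝ → ℝ) (p q : ℝ), ContDiff ℝ (⊤ : ℕ∞) ψ → 0 < p → p ≤ 1 / 2 → 1 / 2 ≤ q →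
      q < 1 → tsupport ψ ⊆ Icc p q → ψ p = 0 → ψ q = 0 →
      ∫ t in p..q, deriv ψ t * H t = 0 := by
    intro ψ p q hψ hp hp2 hq2 hq hsupp hψp hψq
    have hpq := hp2.trans hq2
    have hsub : Icc p q ⊆ Ioo (0 : ℝ) 1 := fun t ht => ⟨hp.trans_le ht.1, ht.2.trans_lt hq⟩
    have h0 := h ψ hψ (isCompact_Icc.of_isClosed_subset (isClosed_tsupport _) hsupp)
      (hsupp.trans hsub)
    have hdc : Continuous (deriv ψ) := hψ.continuous_deriv (by simp)
    have hzero : ∀ t ∉ Icc p q, ψ t = 0 ∧ deriv ψ t = 0 := fun t ht =>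
      ⟨image_eq_zero_of_notMem_tsupport fun h => ht (hsupp h),
        image_eq_zero_of_notMem_tsupport fun h => ht (hsupp (tsupport_deriv_subset (𝕜 := ℝ) h))⟩
    have h1 : ∫ t in p..q, (deriv ψ t * F t + ψ t * g t) = 0 := by
      rw [← h0, intervalIntegral.integral_of_le hpq, ← integral_Icc_eq_integral_Ioc]
      refine (setIntegral_eq_of_subset_of_forall_sdiff_eq_zero measurableSet_Ioo hsub ?_).symm
      intro t ht
      simp [hzero t ht.2]
    have ψac : AbsolutelyContinuousOnInterval ψ p q :=
      (hψ.of_le (by norm_cast)).contDiffOn.absolutelyContinuousOnInterval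
    have h2 := ψac.integral_mul_deriv_eq_deriv_mul (Gac p q hp hp2 hq2 hq)
    rw [hψp, hψq] at h2
    have h3 : ∫ t in p..q, ψ t * deriv G t = ∫ t in p..q, ψ t * g t := by
      refine intervalIntegral.integral_congr_ae ?_
      filter_upwards [(hg p q hp hpq hq).ae_hasDerivAt_integral] with t ht hmem
      have := ht (uIoc_subset_uIcc hmem) (1 / 2) (by rw [uIcc_of_le hpq]; exact ⟨hp2, hq2⟩)
      rw [this.deriv]
    have iF : IntervalIntegrable (fun t => deriv ψ t * F t) volume p q := by
      refine ContinuousOn.intervalIntegrable ?_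
      rw [uIcc_of_le hpq]
      exact hdc.continuousOn.mul (hF.mono hsub)
    have iG : IntervalIntegrable (fun t => deriv ψ t * G t) volume p q :=
      (hdc.continuousOn.mul (Gac p q hp hp2 hq2 hq).continuousOn).intervalIntegrable
    have ig : IntervalIntegrable (fun t => ψ t * g t) volume p q :=
      (hg p q hp hpq hq).continuousOn_mul hψ.continuous.continuousOn
    rw [intervalIntegral.integral_add iF ig] at h1
    rw [h3] at h2
    simp only [hH, mul_sub]
    rw [intervalIntegral.integral_sub iF iG]
    linarith
  -- hence `H` is almost everywhere equal to its average against a fixed bump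
  let η₀b : ContDiffBump (1 / 2 : ℝ) := ⟨1 / 8, 1 / 4, by norm_num, by norm_num⟩
  set η₀ : ℝ → ℝ := η₀b.normed volume with hη₀
  have η₀supp : tsupport η₀ = Metric.closedBall (1 / 2) (1 / 4) := η₀b.tsupport_normed_eq
  have η₀smooth : ContDiff ℝ (⊤ : ℕ∞) η₀ := η₀b.contDiff_normed
  have η₀int : ∫ t, η₀ t = 1 := η₀b.integral_normed
  set c₀ : ℝ := ∫ t, η₀ t * H t with hc₀
  have Hae : ∀ᵐ t, t ∈ Ioo (0 : ℝ) 1 → H t - c₀ = 0 := by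
    refine isOpen_Ioo.ae_eq_zero_of_integral_contDiff_smul_eq_zero
      ((Hcont.sub continuousOn_const).locallyIntegrableOn measurableSet_Ioo) ?_
    intro η hη hηc hηs
    obtain ⟨p, q, hp, hp2, hq2, hq, hpq⟩ := exists_Icc_superset
      (hηc.isCompact.union η₀b.hasCompactSupport_normed.isCompact) (union_subset hηs (by
        change tsupport η₀ ⊆ _
        rw [η₀supp, Real.closedBall_eq_Icc]
        exact fun t ht => ⟨by linarith [ht.1], by linarith [ht.2]⟩))
    have hpq' := hp2.trans hq2
    have hη1 : tsupport η ⊆ Ioo p q := subset_union_left.trans hpq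
    have hη2 : tsupport η₀ ⊆ Ioo p q := subset_union_right.trans hpq
    set θ : ℝ → ℝ := fun t => η t - (∫ s, η s) * η₀ t with hθ
    have θsmooth : ContDiff ℝ (⊤ : ℕ∞) θ := hη.sub (contDiff_const.mul η₀smooth)
    have θzero : ∀ t ∉ Ioo p q, θ t = 0 := fun t ht => by
      simp only [hθ, image_eq_zero_of_notMem_tsupport fun h => ht (hη1 h),
        image_eq_zero_of_notMem_tsupport fun h => ht (hη2 h)]
      simp
    set ψ : ℝ → ℝ := fun t => ∫ s in (0 : ℝ)..t, θ s with hψ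
    have ψd : ∀ t, HasDerivAt ψ (θ t) t := fun t =>
      intervalIntegral.integral_hasDerivAt_right (θsmooth.continuous.intervalIntegrable _ _)
        (θsmooth.continuous.stronglyMeasurableAtFilter _ _) θsmooth.continuous.continuousAt
    have ψderiv : deriv ψ = θ := funext fun t => (ψd t).deriv
    have ψsmooth : ContDiff ℝ (⊤ : ℕ∞) ψ := by
      rw [contDiff_infty_iff_deriv, ψderiv]
      exact ⟨fun t => (ψd t).differentiableAt, θsmooth⟩
    have η_int : Integrable η := hη.continuous.integrable_of_hasCompactSupport hηc
    have η₀_int : Integrable η₀ :=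
      η₀smooth.continuous.integrable_of_hasCompactSupport η₀b.hasCompactSupport_normed
    have θint : ∫ t, θ t = 0 := by
      simp only [hθ]
      rw [integral_sub η_int (η₀_int.const_mul _), integral_const_mul, η₀int]
      ring
    have ψ_left : ∀ t ≤ p, ψ t = 0 := by
      intro t ht
      refine intervalIntegral.integral_zero_ae (ae_of_all _ fun s hs => θzero s fun hs' => ?_)
      have : s ≤ max 0 t := hs.2
      exact absurd (this.trans (max_le hp.le ht)) (not_le.mpr hs'.1)
    have ψ_right : ∀ t, q ≤ t → ψ t = 0 := by
      intro t ht
      simp only [hψ]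
      rw [intervalIntegral.integral_eq_integral_of_support_subset, θint]
      intro s hs
      have : s ∈ Ioo p q := by_contra fun h => hs (θzero s h)
      exact ⟨hp.trans this.1, this.2.le.trans ht⟩
    have ψsupp : tsupport ψ ⊆ Icc p q := by
      refine closure_minimal (fun t ht => ?_) isClosed_Icc
      refine ⟨le_of_not_ge fun h => ht (ψ_left t h), le_of_not_ge fun h => ht (ψ_right t h)⟩
    have h0 := orth ψ p q ψsmooth hp hp2 hq2 hq ψsupp (ψ_left p le_rfl) (ψ_right q le_rfl)
    rw [ψderiv] at h0
    have hHc := Hcont' p q hp hp2 hq2 hq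
    have full : ∀ κ : ℝ → ℝ, tsupport κ ⊆ Ioo p q → ∀ L : ℝ → ℝ,
        ∫ t, κ t * L t = ∫ t in p..q, κ t * L t := by
      intro κ hκ L
      rw [intervalIntegral.integral_eq_integral_of_support_subset]
      intro t ht
      have : t ∈ Ioo p q := hκ (subset_tsupport _ (left_ne_zero_of_mul ht))
      exact ⟨this.1, this.2.le⟩
    have ii : ∀ κ : ℝ → ℝ, Continuous κ → IntervalIntegrable (fun t => κ t * H t) volume p q := by
      intro κ hκ
      refine ContinuousOn.intervalIntegrable ?_
      rw [uIcc_of_le hpq']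
      exact hκ.continuousOn.mul hHc
    have e1 : ∫ t, η t • (H t - c₀) = (∫ t in p..q, η t * H t) - c₀ * ∫ t, η t := by
      simp only [smul_eq_mul]
      rw [full η hη1 (fun t => H t - c₀)]
      simp only [mul_sub]
      rw [intervalIntegral.integral_sub (ii η hη.continuous)
        (hη.continuous.mul_const c₀ |>.intervalIntegrable _ _),
        ← full η hη1 (fun _ => c₀), integral_mul_const]
      ring
    have e2 : ∫ t in p..q, θ t * H t = (∫ t in p..q, η t * H t) - (∫ t, η t) * c₀ := by
      simp only [hθ, sub_mul]
      rw [intervalIntegral.integral_sub (ii η hη.continuous) (by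
        have := ii _ (continuous_const.mul η₀smooth.continuous : Continuous fun t => (∫ s, η s) * η₀ t)
        exact this)]
      simp only [mul_assoc]
      rw [intervalIntegral.integral_const_mul, ← full η₀ hη2 H]
    rw [e1]
    rw [e2] at h0
    linarith
  have Heq : EqOn H (fun _ => c₀) (Ioo 0 1) := by
    refine Measure.eqOn_open_of_ae_eq (μ := volume) ?_ isOpen_Ioo Hcont continuousOn_const
    rw [Filter.EventuallyEq, ae_restrict_iff' measurableSet_Ioo]
    filter_upwards [Hae] with t ht hmem
    linarith [ht hmem]
  have ha' : a ∈ Ioo (0 : ℝ) 1 := ⟨ha, hab.trans_lt hb⟩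
  have hb' : b ∈ Ioo (0 : ℝ) 1 := ⟨ha.trans_le hab, hb⟩
  have e1 : F a - G a = c₀ := Heq ha'
  have e2 : F b - G b = c₀ := Heq hb'
  have e3 := intervalIntegral.integral_interval_sub_left (hg' _ half _ hb') (hg' _ half _ ha')
  simp only [hG] at e1 e2
  linarith

/-! ### Linear equations with integrable coefficients -/

/-- A linear equation `y' = B y` with integrable coefficient has a global (Carathéodory) solution:
some iterate of the Picard map is a contraction, with constant `(∫ ‖B‖)ⁿ / n!`. -/
lemma exists_linear_ode {X : Type*} [NormedAddCommGroup X] [NormedSpace ℝ X] [CompleteSpace X]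
    {B : ℝ → X →L[ℝ] X} (hB : IntervalIntegrable B volume 0 1) (x₀ : X) :
    ∃ y : ℝ → X, Continuous y ∧ ∀ t ∈ Icc (0 : ℝ) 1, y t = x₀ + ∫ s in (0 : ℝ)..t, B s (y s) := by
  have hsub : ∀ t ∈ Icc (0 : ℝ) 1, uIcc 0 t ⊆ uIcc 0 1 := fun t ht => by
    rw [uIcc_of_le ht.1, uIcc_of_le zero_le_one]; exact Icc_subset_Icc_right ht.2
  have hint : ∀ (y : C(Icc (0 : ℝ) 1, X)) (z : ℝ → X), z = IccExtend zero_le_one y →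
      IntervalIntegrable (fun s => B s (z s)) volume 0 1 := by
    rintro y z rfl
    have hc : Continuous (IccExtend (zero_le_one' ℝ) y) := y.continuous.Icc_extend'
    rw [intervalIntegrable_iff] at hB ⊢
    refine (hB.norm.mul_const ‖y‖).mono'
      (isBoundedBilinearMap_apply.continuous.comp_aestronglyMeasurable
        (hB.aestronglyMeasurable.prodMk hc.aestronglyMeasurable)) ?_
    refine ae_of_all _ fun s => ((B s).le_opNorm _).trans ?_
    gcongr
    exact y.norm_coe_le_norm _
  let T : C(Icc (0 : ℝ) 1, X) → C(Icc (0 : ℝ) 1, X) := fun y =>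
    ⟨fun t => x₀ + ∫ s in (0 : ℝ)..t, B s (IccExtend zero_le_one y s), by
      have := intervalIntegral.continuousOn_primitive_interval' (hint y _ rfl) (a := 0) (by simp)
      rw [uIcc_of_le zero_le_one] at this
      exact continuous_const.add this.domRestrict⟩
  have hβ : IsACWith (fun t => ∫ s in (0 : ℝ)..t, ‖B s‖) (fun t => ‖B t‖) :=
    IsACWith.of_integral hB.norm (fun t _ => by simp)
  set β : ℝ → ℝ := fun t => ∫ s in (0 : ℝ)..t, ‖B s‖ with hβdef
  have hβ0 : ∀ t ∈ Icc (0 : ℝ) 1, 0 ≤ β t := fun t ht =>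
    intervalIntegral.integral_nonneg ht.1 fun s _ => norm_nonneg _
  have iter : ∀ (n : ℕ) (y z : C(Icc (0 : ℝ) 1, X)) (t : Icc (0 : ℝ) 1),
      ‖(T^[n] y) t - (T^[n] z) t‖ ≤ β t ^ n / n.factorial * dist y z := by
    intro n y z
    induction n with
    | zero => intro t; simpa [dist_eq_norm] using (y - z).norm_coe_le_norm t
    | succ n ih =>
      intro t
      rw [Function.iterate_succ_apply', Function.iterate_succ_apply']
      set u := T^[n] y
      set v := T^[n] z
      have e : (T u) t - (T v) t = ∫ s in (0 : ℝ)..t,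
          B s (IccExtend zero_le_one u s - IccExtend zero_le_one v s) := by
        change (x₀ + _) - (x₀ + _) = _
        simp only [map_sub]
        rw [intervalIntegral.integral_sub ((hint u _ rfl).mono_set (hsub t t.2))
          ((hint v _ rfl).mono_set (hsub t t.2))]
        abel
      have hpow := (hβ.pow (n + 1)).const_mul (1 / (n + 1).factorial * dist y z)
      have e2 := hpow.integral (a := 0) (b := t) (by simp) t.2
      rw [e]
      refine (intervalIntegral.norm_integral_le_of_norm_le t.2.1 (ae_of_all _ fun s hs => ?_)
        (hpow.intervalIntegrable (by simp) t.2)).trans ?_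
      · have hs1 : s ∈ Icc (0 : ℝ) 1 := ⟨hs.1.le, hs.2.trans t.2.2⟩
        refine ((B s).le_opNorm _).trans ?_
        rw [IccExtend_of_mem _ _ hs1, IccExtend_of_mem _ _ hs1]
        refine (mul_le_mul_of_nonneg_left (ih ⟨s, hs1⟩) (norm_nonneg _)).trans (le_of_eq ?_)
        rw [Nat.factorial_succ]
        push_cast
        have : (n.factorial : ℝ) ≠ 0 := by positivity
        have : (n : ℝ) + 1 ≠ 0 := by positivity
        field_simp
      · rw [e2]
        have : β 0 = 0 := intervalIntegral.integral_same
        rw [this]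
        apply le_of_eq
        simp
        ring
  obtain ⟨n, hn⟩ := ((FloorSemiring.tendsto_pow_div_factorial_atTop (β 1)).eventually
    (gt_mem_nhds (zero_lt_one' ℝ))).exists
  have hK0 : 0 ≤ β 1 ^ n / n.factorial := by
    have := hβ0 1 (by simp)
    positivity
  have hcontr : ContractingWith ⟨β 1 ^ n / n.factorial, hK0⟩ T^[n] := by
    refine ⟨by exact_mod_cast hn, LipschitzWith.of_dist_le_mul fun y z => ?_⟩
    rw [ContinuousMap.dist_le (by positivity)]
    intro t
    rw [dist_eq_norm]
    refine (iter n y z t).trans ?_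
    have : β t ≤ β 1 := by
      have := hβ.integral t.2 (b := 1) (by simp)
      have h2 : 0 ≤ ∫ s in (t : ℝ)..1, ‖B s‖ :=
        intervalIntegral.integral_nonneg t.2.2 fun s _ => norm_nonneg _
      linarith
    have h0 := hβ0 t t.2
    change _ ≤ β 1 ^ n / n.factorial * dist y z
    gcongr
  have hfix := hcontr.isFixedPt_fixedPoint_iterate
  set y := ContractingWith.fixedPoint T^[n] hcontr
  refine ⟨IccExtend zero_le_one y, y.continuous.Icc_extend', fun t ht => ?_⟩
  rw [IccExtend_of_mem _ _ ht]
  exact (congrArg (fun w : C(Icc (0 : ℝ) 1, X) => w ⟨t, ht⟩) hfix).symm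

end

section

/-! ### Weakly continuous curves of measures -/

/-- The retraction of the time axis onto `[0,1]`. -/
def clamp (t : ℝ) : ℝ := projIcc (0 : ℝ) 1 zero_le_one t

lemma clamp_mem (t : ℝ) : clamp t ∈ Icc (0 : ℝ) 1 := (projIcc (0 : ℝ) 1 zero_le_one t).2

lemma clamp_of_mem {t : ℝ} (ht : t ∈ Icc (0 : ℝ) 1) : clamp t = t := by
  simp [clamp, projIcc_of_mem _ ht]

lemma continuous_clamp : Continuous clamp := continuous_subtype_val.comp continuous_projIcc

lemma continuous_comp_clamp {X : Type*} [TopologicalSpace X] {f : ℝ → X}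
    (hf : ContinuousOn f (Icc 0 1)) : Continuous fun t => f (clamp t) :=
  hf.comp_continuous continuous_clamp clamp_mem

variable {d : ℕ} {μ : ℝ → ProbabilityMeasure (E d)}

lemma continuousOn_integral (hμ : ContinuousOn μ (Icc 0 1)) {f : E d → ℝ} (hf : Continuous f)
    {C : ℝ} (hC : ∀ x, ‖f x‖ ≤ C) :
    ContinuousOn (fun t => ∫ x, f x ∂(μ t : Measure (E d))) (Icc 0 1) := by
  intro t ht
  have := (ProbabilityMeasure.tendsto_iff_forall_integral_tendsto.mp (hμ t ht))
    (BoundedContinuousFunction.ofNormedAddCommGroup f hf C hC)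
  exact this

lemma measurable_coe_of_continuous {ν : ℝ → ProbabilityMeasure (E d)} (hν : Continuous ν) :
    Measurable fun t => (ν t : Measure (E d)) := by
  refine Measurable.measure_of_isPiSystem_of_isProbabilityMeasure
    (borel_eq_generateFrom_isClosed (α := E d) ▸ BorelSpace.measurable_eq) isPiSystem_isClosed ?_
  intro s hs
  -- the measure of a closed set is a limit of integrals of thickened indicators
  have hlim : ∀ t, Tendsto (fun n : ℕ => ∫⁻ x, (thickenedIndicator
      (δ := 1 / ((n : ℝ) + 1)) Nat.one_div_pos_of_nat s x : ℝ≥0∞) ∂(ν t : Measure (E d)))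
      atTop (𝓝 ((ν t : Measure (E d)) s)) := fun t =>
    tendsto_lintegral_thickenedIndicator_of_isClosed _ hs (fun _ => Nat.one_div_pos_of_nat)
      tendsto_one_div_add_atTop_nhds_zero_nat
  refine ENNReal.measurable_of_tendsto (fun n => ?_) (tendsto_pi_nhds.mpr hlim)
  exact ((ProbabilityMeasure.continuous_lintegral_boundedContinuousFunction
    (thickenedIndicator (δ := 1 / ((n : ℝ) + 1)) Nat.one_div_pos_of_nat s)).comp hν).measurable

/-- The Markov kernel attached to a curve of measures on `[0,1]`, extended to all times by
constants. -/
def curveKernel (μ : ℝ → ProbabilityMeasure (E d)) (hμ : ContinuousOn μ (Icc 0 1)) :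
    Kernel ℝ (E d) where
  toFun t := (μ (clamp t) : Measure (E d))
  measurable' := measurable_coe_of_continuous (continuous_comp_clamp hμ)

lemma curveKernel_apply (hμ : ContinuousOn μ (Icc 0 1)) (t : ℝ) :
    curveKernel μ hμ t = (μ (clamp t) : Measure (E d)) := rfl

lemma curveKernel_of_mem (hμ : ContinuousOn μ (Icc 0 1)) {t : ℝ} (ht : t ∈ Icc (0 : ℝ) 1) :
    curveKernel μ hμ t = (μ t : Measure (E d)) := by
  rw [curveKernel_apply, clamp_of_mem ht]

instance (hμ : ContinuousOn μ (Icc 0 1)) : IsMarkovKernel (curveKernel μ hμ) :=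
  ⟨fun t => by rw [curveKernel_apply]; infer_instance⟩

/-- The measure `μₜ(dx) dt` on `(0,1) × ℝᵈ`. -/
def spaceTime (μ : ℝ → ProbabilityMeasure (E d)) (hμ : ContinuousOn μ (Icc 0 1)) :
    Measure (ℝ × E d) :=
  (volume.restrict (Ioo (0 : ℝ) 1)) ⊗ₘ curveKernel μ hμ

instance (hμ : ContinuousOn μ (Icc 0 1)) : IsFiniteMeasure (spaceTime μ hμ) := by
  unfold spaceTime; infer_instance

lemma lintegral_spaceTime (hμ : ContinuousOn μ (Icc 0 1)) {f : ℝ × E d → ℝ≥0∞}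
    (hf : Measurable f) : ∫⁻ z, f z ∂(spaceTime μ hμ)
      = ∫⁻ t in Ioo (0 : ℝ) 1, ∫⁻ x, f (t, x) ∂(μ t : Measure (E d)) := by
  rw [spaceTime, Measure.lintegral_compProd hf]
  refine setLIntegral_congr_fun measurableSet_Ioo fun t ht => ?_
  rw [curveKernel_of_mem hμ (Ioo_subset_Icc_self ht)]

lemma integral_spaceTime (hμ : ContinuousOn μ (Icc 0 1)) {f : ℝ × E d → ℝ}
    (hf : Integrable f (spaceTime μ hμ)) : ∫ z, f z ∂(spaceTime μ hμ)
      = ∫ t in Ioo (0 : ℝ) 1, ∫ x, f (t, x) ∂(μ t : Measure (E d)) := by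
  rw [spaceTime, Measure.integral_compProd hf]
  refine setIntegral_congr_fun measurableSet_Ioo fun t ht => ?_
  rw [curveKernel_of_mem hμ (Ioo_subset_Icc_self ht)]

lemma ae_integrable_of_spaceTime (hμ : ContinuousOn μ (Icc 0 1)) {f : ℝ × E d → ℝ}
    (hf : Integrable f (spaceTime μ hμ)) : ∀ᵐ t ∂(volume.restrict (Ioo (0 : ℝ) 1)),
      Integrable (fun x => f (t, x)) (μ t : Measure (E d)) := by
  rw [spaceTime, Measure.integrable_compProd_iff hf.aestronglyMeasurable] at hf
  filter_upwards [hf.1, ae_restrict_mem measurableSet_Ioo] with t h ht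
  rwa [curveKernel_of_mem hμ (Ioo_subset_Icc_self ht)] at h

lemma integrable_integral_of_spaceTime (hμ : ContinuousOn μ (Icc 0 1)) {f : ℝ × E d → ℝ}
    (hf : Integrable f (spaceTime μ hμ)) :
    IntegrableOn (fun t => ∫ x, f (t, x) ∂(μ t : Measure (E d))) (Ioo 0 1) := by
  rw [spaceTime] at hf
  have := hf.integral_compProd
  refine this.congr ?_
  filter_upwards [ae_restrict_mem measurableSet_Ioo] with t ht
  rw [Kernel.prodMkLeft_apply, curveKernel_of_mem hμ (Ioo_subset_Icc_self ht)]

lemma aemeasurable_lintegral_curve (hμ : ContinuousOn μ (Icc 0 1)) {f : ℝ × E d → ℝ≥0∞}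
    (hf : Measurable f) :
    AEMeasurable (fun t => ∫⁻ x, f (t, x) ∂(μ t : Measure (E d)))
      (volume.restrict (Ioo (0 : ℝ) 1)) := by
  refine ⟨fun t => ∫⁻ x, f (t, x) ∂(curveKernel μ hμ t), hf.lintegral_kernel_prod_right', ?_⟩
  filter_upwards [ae_restrict_mem measurableSet_Ioo] with t ht
  rw [curveKernel_of_mem hμ (Ioo_subset_Icc_self ht)]

lemma aestronglyMeasurable_integral_curve (hμ : ContinuousOn μ (Icc 0 1)) {f : ℝ × E d → ℝ}
    (hf : Measurable f) :
    AEStronglyMeasurable (fun t => ∫ x, f (t, x) ∂(μ t : Measure (E d)))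
      (volume.restrict (Ioo (0 : ℝ) 1)) := by
  refine ⟨fun t => ∫ x, f (t, x) ∂(curveKernel μ hμ t),
    hf.stronglyMeasurable.integral_kernel_prod_right', ?_⟩
  filter_upwards [ae_restrict_mem measurableSet_Ioo] with t ht
  rw [curveKernel_of_mem hμ (Ioo_subset_Icc_self ht)]

/-! ### The continuity equation in integrated form -/

variable {μ₀ μ₁ : Measure (E d)} {V : ℝ → E d → E d}

lemma exists_fderiv_bound {f : E d → ℝ} (hf : ContDiff ℝ (⊤ : ℕ∞) f) (hfc : HasCompactSupport f) :
    ∃ K r : ℝ, 0 ≤ K ∧ ∀ x v, ‖fderiv ℝ f x v‖ₑ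
      ≤ (Metric.closedBall (0 : E d) r).indicator (fun _ => ENNReal.ofReal K * ‖v‖ₑ) x := by
  have hfd : Continuous (fderiv ℝ f) := hf.continuous_fderiv (by simp)
  obtain ⟨K, hK⟩ := hfd.bounded_above_of_compact_support (hfc.fderiv ℝ)
  obtain ⟨r, hr⟩ := hfc.isCompact.isBounded.subset_closedBall (0 : E d)
  have hK0 : 0 ≤ K := (norm_nonneg _).trans (hK 0)
  refine ⟨K, r, hK0, fun x v => ?_⟩
  by_cases hx : x ∈ Metric.closedBall (0 : E d) r
  · rw [indicator_of_mem hx, ← ofReal_norm, ← ofReal_norm, ← ENNReal.ofReal_mul hK0]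
    refine ENNReal.ofReal_le_ofReal (((fderiv ℝ f x).le_opNorm v).trans ?_)
    gcongr
    exact hK x
  · have : fderiv ℝ f x = 0 :=
      image_eq_zero_of_notMem_tsupport fun h => hx (hr (tsupport_fderiv_subset ℝ h))
    simp [this]

lemma measurable_fderiv_uncurry {f : E d → ℝ} (hf : ContDiff ℝ (⊤ : ℕ∞) f)
    (hV : Measurable (Function.uncurry V)) :
    Measurable fun z : ℝ × E d => fderiv ℝ f z.2 (V z.1 z.2) := by
  have hfd : Continuous (fderiv ℝ f) := hf.continuous_fderiv (by simp)
  have h1 : Measurable fun z : ℝ × E d => fderiv ℝ f z.2 := (hfd.comp continuous_snd).measurable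
  exact isBoundedBilinearMap_apply.continuous.measurable.comp (h1.prodMk hV)

lemma IsCE.lintegral_fderiv_lt_top (h : IsCE μ₀ μ₁ μ V) {f : E d → ℝ}
    (hf : ContDiff ℝ (⊤ : ℕ∞) f) (hfc : HasCompactSupport f) {a b : ℝ} (ha : 0 < a) (hb : b < 1) :
    ∫⁻ t in Icc a b, ∫⁻ x, ‖fderiv ℝ f x (V t x)‖ₑ ∂(μ t : Measure (E d)) < ⊤ := by
  obtain ⟨K, r, hK0, hK⟩ := exists_fderiv_bound hf hfc
  calc ∫⁻ t in Icc a b, ∫⁻ x, ‖fderiv ℝ f x (V t x)‖ₑ ∂(μ t : Measure (E d))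
      ≤ ∫⁻ t in Icc a b, ENNReal.ofReal K *
          ∫⁻ x in Metric.closedBall (0 : E d) r, ‖V t x‖ₑ ∂(μ t : Measure (E d)) := by
        refine lintegral_mono fun t => ?_
        rw [← lintegral_const_mul' _ _ ENNReal.ofReal_ne_top,
          ← lintegral_indicator Metric.isClosed_closedBall.measurableSet]
        exact lintegral_mono fun x => hK x _
    _ = ENNReal.ofReal K * ∫⁻ t in Icc a b,
          ∫⁻ x in Metric.closedBall (0 : E d) r, ‖V t x‖ₑ ∂(μ t : Measure (E d)) :=
        lintegral_const_mul' _ _ ENNReal.ofReal_ne_top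
    _ < ⊤ := ENNReal.mul_lt_top ENNReal.ofReal_lt_top (h.locally_integrable a b r ha hb)

lemma IsCE.intervalIntegrable_fderiv (h : IsCE μ₀ μ₁ μ V) {f : E d → ℝ}
    (hf : ContDiff ℝ (⊤ : ℕ∞) f) (hfc : HasCompactSupport f) {a b : ℝ} (ha : 0 < a) (hab : a ≤ b)
    (hb : b < 1) :
    IntervalIntegrable (fun t => ∫ x, fderiv ℝ f x (V t x) ∂(μ t : Measure (E d))) volume a b := by
  rw [intervalIntegrable_iff_integrableOn_Icc_of_le hab]
  have hsub : Icc a b ⊆ Ioo (0 : ℝ) 1 := fun t ht => ⟨ha.trans_le ht.1, ht.2.trans_lt hb⟩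
  refine ⟨(aestronglyMeasurable_integral_curve h.weakly_continuous
    (measurable_fderiv_uncurry hf h.borel)).mono_measure (Measure.restrict_mono hsub le_rfl), ?_⟩
  refine lt_of_le_of_lt (lintegral_mono fun t => ?_) (h.lintegral_fderiv_lt_top hf hfc ha hb)
  exact enorm_integral_le_lintegral_enorm _

lemma IsCE.integral_sub_of_Ioo (h : IsCE μ₀ μ₁ μ V) {f : E d → ℝ}
    (hf : ContDiff ℝ (⊤ : ℕ∞) f) (hfc : HasCompactSupport f) {a b : ℝ} (ha : 0 < a) (hab : a ≤ b)
    (hb : b < 1) :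
    ∫ x, f x ∂(μ b : Measure (E d)) - ∫ x, f x ∂(μ a : Measure (E d))
      = ∫ t in a..b, ∫ x, fderiv ℝ f x (V t x) ∂(μ t : Measure (E d)) := by
  obtain ⟨C, hC⟩ := hf.continuous.bounded_above_of_compact_support hfc
  have hFc := continuousOn_integral h.weakly_continuous hf.continuous hC
  refine sub_eq_integral_of_weak_deriv (hFc.mono Ioo_subset_Icc_self)
    (fun a b ha hab hb => h.intervalIntegrable_fderiv hf hfc ha hab hb) (fun ψ hψ hψc hψs => ?_)
    ha hab hb
  obtain ⟨p, q, hp, -, -, hq, hpq⟩ := exists_Icc_superset hψc.isCompact hψs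
  set φ : ℝ × E d → ℝ := fun z => ψ z.1 * f z.2 with hφ
  have hsupp : tsupport φ ⊆ tsupport ψ ×ˢ tsupport f := by
    refine closure_minimal (fun z hz => ?_) ((isClosed_tsupport _).prod (isClosed_tsupport _))
    exact ⟨subset_tsupport _ (left_ne_zero_of_mul hz), subset_tsupport _ (right_ne_zero_of_mul hz)⟩
  have hφ0 := h.equation φ ((hψ.comp contDiff_fst).mul (hf.comp contDiff_snd))
    ((hψc.isCompact.prod hfc.isCompact).of_isClosed_subset (isClosed_tsupport _) hsupp)
    (fun z hz => ⟨hψs (hsupp hz).1, mem_univ _⟩)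
  refine Eq.trans ?_ hφ0
  -- for almost every `t` in the support of `ψ` the inner integral splits
  have hae : ∀ᵐ t ∂(volume.restrict (Icc p q)),
      ∫⁻ x, ‖fderiv ℝ f x (V t x)‖ₑ ∂(μ t : Measure (E d)) < ⊤ := by
    refine ae_lt_top' ?_ (h.lintegral_fderiv_lt_top hf hfc hp hq (a := p) (b := q)).ne
    have hsub : Icc p q ⊆ Ioo (0 : ℝ) 1 := fun t ht => ⟨hp.trans_le ht.1, ht.2.trans_lt hq⟩
    exact AEMeasurable.mono_measure (aemeasurable_lintegral_curve h.weakly_continuous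
      (measurable_fderiv_uncurry hf h.borel).enorm) (Measure.restrict_mono hsub le_rfl)
  rw [ae_restrict_iff' measurableSet_Icc] at hae
  refine setIntegral_congr_ae measurableSet_Ioo ?_
  filter_upwards [hae] with t ht ht01
  have e1 : ∀ x, deriv (fun s => φ (s, x)) t = deriv ψ t * f x := fun x => by
    simp only [hφ]
    exact deriv_mul_const (hψ.differentiable (by simp) t) _
  have e2 : ∀ x v, fderiv ℝ (fun y => φ (t, y)) x v = ψ t * fderiv ℝ f x v := fun x v => by
    simp only [hφ]
    rw [fderiv_const_mul (hf.differentiable (by simp) x)]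
    rfl
  simp only [e1, e2]
  have hfi : Integrable (fun x => deriv ψ t * f x) (μ t : Measure (E d)) :=
    (Integrable.of_bound hf.continuous.aestronglyMeasurable C (ae_of_all _ hC)).const_mul _
  have hgi : Integrable (fun x => ψ t * fderiv ℝ f x (V t x)) (μ t : Measure (E d)) := by
    by_cases htpq : t ∈ Icc p q
    · refine Integrable.const_mul ⟨?_, ht htpq⟩ _
      exact ((measurable_fderiv_uncurry hf h.borel).comp
        measurable_prodMk_left).aestronglyMeasurable
    · have : ψ t = 0 := image_eq_zero_of_notMem_tsupport fun h' =>
        htpq (Ioo_subset_Icc_self (hpq h'))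
      simp [this]
  rw [integral_add hfi hgi, integral_const_mul, integral_const_mul]

/-- Integrated form of the continuity equation, for smooth compactly supported observables. -/
lemma IsCE.integral_sub (h : IsCE μ₀ μ₁ μ V) {f : E d → ℝ}
    (hf : ContDiff ℝ (⊤ : ℕ∞) f) (hfc : HasCompactSupport f) {a b : ℝ} (ha : 0 ≤ a) (hab : a ≤ b)
    (hb : b ≤ 1)
    (hint : IntervalIntegrable (fun t => ∫ x, fderiv ℝ f x (V t x) ∂(μ t : Measure (E d)))
      volume a b) :
    ∫ x, f x ∂(μ b : Measure (E d)) - ∫ x, f x ∂(μ a : Measure (E d))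
      = ∫ t in a..b, ∫ x, fderiv ℝ f x (V t x) ∂(μ t : Measure (E d)) := by
  rcases hab.eq_or_lt with rfl | hlt
  · simp
  obtain ⟨C, hC⟩ := hf.continuous.bounded_above_of_compact_support hfc
  have hFc := continuousOn_integral h.weakly_continuous hf.continuous hC
  set F : ℝ → ℝ := fun t => ∫ x, f x ∂(μ t : Measure (E d))
  set g : ℝ → ℝ := fun t => ∫ x, fderiv ℝ f x (V t x) ∂(μ t : Measure (E d))
  have hI := intervalIntegral.continuousOn_primitive_interval' hint (a := a) (by simp)
  rw [uIcc_of_le hab] at hI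
  have hsub : Icc a b ⊆ Icc (0 : ℝ) 1 := Icc_subset_Icc ha hb
  -- `F - ∫ g` is continuous on `[a,b]` and constant in the interior
  have hHc : ContinuousOn (fun t => F t - ∫ s in a..t, g s) (Icc a b) := (hFc.mono hsub).sub hI
  set H : ℝ → ℝ := fun t => F t - ∫ s in a..t, g s with hH
  have hconst : EqOn H (fun _ => H ((a + b) / 2)) (Ioo a b) := by
    have key : ∀ s ∈ Ioo a b, ∀ t ∈ Ioo a b, s ≤ t → H s = H t := by
      intro s hs t ht hst
      have h1 := h.integral_sub_of_Ioo hf hfc (ha.trans_lt hs.1) hst (ht.2.trans_le hb)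
      have hi : ∀ r ∈ Ioo a b, IntervalIntegrable g volume a r := fun r hr =>
        hint.mono_set (by
          rw [uIcc_of_le hr.1.le, uIcc_of_le hab]; exact Icc_subset_Icc_right hr.2.le)
      have h2 := intervalIntegral.integral_interval_sub_left (hi t ht) (hi s hs)
      simp only [hH, F, g] at h1 h2 ⊢
      linarith
    have hm : (a + b) / 2 ∈ Ioo a b := ⟨by linarith, by linarith⟩
    intro s hs
    rcases le_total s ((a + b) / 2) with hle | hle
    · exact key s hs _ hm hle
    · exact (key _ hm s hs hle).symm
  have hconst' : EqOn H (fun _ => H ((a + b) / 2)) (Icc a b) := by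
    have := hconst.of_subset_closure hHc continuousOn_const Ioo_subset_Icc_self
      (by rw [closure_Ioo hlt.ne])
    exact this
  have e1 := hconst' (left_mem_Icc.mpr hab)
  have e2 := hconst' (right_mem_Icc.mpr hab)
  simp only [hH] at e1 e2
  rw [intervalIntegral.integral_same] at e1
  linarith

end

section

/-! ### Second moments and covariance -/

section Moments

variable {d : ℕ} {ν : Measure (E d)}

lemma act_apply (A : Matrix (Fin d) (Fin d) ℝ) (x : E d) (i : Fin d) :
    act A x i = ∑ j, A i j * x j := by
  simp [act, Matrix.toLpLin_apply, Matrix.mulVec, dotProduct]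

lemma inner_eq_sum (x y : E d) : inner ℝ x y = ∑ i, x i * y i := by
  simp [PiLp.inner_apply, mul_comm]

lemma P2.integrable_sq (hν : ν ∈ P2 d) : Integrable (fun x : E d => ‖x‖ ^ 2) ν :=
  (memLp_two_iff_integrable_sq_norm hν.2.1).mp hν.2

lemma P2.integrable_one_add_sq (hν : ν ∈ P2 d) : Integrable (fun x : E d => (1 + ‖x‖) ^ 2) ν := by
  have := hν.1
  have h1 : Integrable (fun x : E d => 2 + 2 * ‖x‖ ^ 2) ν :=
    (integrable_const 2).add ((P2.integrable_sq hν).const_mul 2)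
  refine h1.mono' (by fun_prop) (ae_of_all _ fun x => ?_)
  rw [Real.norm_of_nonneg (by positivity)]
  nlinarith [sq_nonneg (1 - ‖x‖)]

lemma P2.integrable_of_le (hν : ν ∈ P2 d) {f : E d → ℝ} (hf : AEStronglyMeasurable f ν) {A : ℝ}
    (hA : ∀ x, ‖f x‖ ≤ A * (1 + ‖x‖) ^ 2) : Integrable f ν :=
  ((P2.integrable_one_add_sq hν).const_mul A).mono' hf (ae_of_all _ hA)

lemma norm_le_one_add_sq (x : E d) : ‖x‖ ≤ 1 * (1 + ‖x‖) ^ 2 := by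
  nlinarith [norm_nonneg x]

lemma abs_coord_le (x : E d) (i : Fin d) : |x i| ≤ ‖x‖ := by
  simpa using PiLp.norm_apply_le x i

lemma P2.integrable_id (hν : ν ∈ P2 d) : Integrable (fun x : E d => x) ν := by
  have := hν.1
  exact hν.2.integrable (by norm_num)

lemma P2.integrable_coord (hν : ν ∈ P2 d) (i : Fin d) : Integrable (fun x : E d => x i) ν :=
  P2.integrable_of_le hν (by fun_prop) fun x => (abs_coord_le x i).trans (norm_le_one_add_sq x)

lemma P2.integrable_coord_mul (hν : ν ∈ P2 d) (i j : Fin d) :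
    Integrable (fun x : E d => x i * x j) ν :=
  P2.integrable_of_le (A := 1) hν (by fun_prop) fun x => by
    rw [Real.norm_eq_abs, abs_mul]
    nlinarith [abs_coord_le x i, abs_coord_le x j, abs_nonneg (x i), abs_nonneg (x j), norm_nonneg x,
      mul_le_mul (abs_coord_le x i) (abs_coord_le x j) (abs_nonneg _) (norm_nonneg _)]

lemma mean_apply (hν : ν ∈ P2 d) (i : Fin d) : mean ν i = ∫ x, x i ∂ν := by
  have := (EuclideanSpace.proj i : E d →L[ℝ] ℝ).integral_comp_comm (P2.integrable_id hν)
  simpa [mean] using this.symm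

lemma covMat_apply (hν : ν ∈ P2 d) (i j : Fin d) :
    covMat ν i j = (∫ x, x i * x j ∂ν) - mean ν i * mean ν j := by
  have := hν.1
  have e : ∀ x : E d, (x i - mean ν i) * (x j - mean ν j)
      = x i * x j - mean ν j * x i - mean ν i * x j + mean ν i * mean ν j := fun x => by ring
  have i1 := P2.integrable_coord_mul hν i j
  have i2 := (P2.integrable_coord hν i).const_mul (mean ν j)
  have i3 := (P2.integrable_coord hν j).const_mul (mean ν i)
  simp only [covMat, Matrix.of_apply, e]
  have i12 : Integrable (fun x : E d => x i * x j - mean ν j * x i) ν := i1.sub i2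
  have i123 : Integrable (fun x : E d => x i * x j - mean ν j * x i - mean ν i * x j) ν :=
    i12.sub i3
  rw [integral_add i123 (integrable_const _), integral_sub i12 i3,
    integral_sub i1 i2, integral_const_mul, integral_const_mul, ← mean_apply hν, ← mean_apply hν]
  simp
  ring

lemma covMat_isHermitian (ν : Measure (E d)) : (covMat ν).IsHermitian := by
  ext i j
  simp [covMat, mul_comm]

lemma integrable_inner_sub_sq (hν : ν ∈ P2 d) (p m : E d) :
    Integrable (fun x : E d => (inner ℝ p (x - m)) ^ 2) ν := by
  have := hν.1
  have h1 : Integrable (fun x : E d => ‖p‖ ^ 2 * (2 * ‖x‖ ^ 2 + 2 * ‖m‖ ^ 2)) ν :=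
    (((P2.integrable_sq hν).const_mul 2).add (integrable_const _)).const_mul _
  refine h1.mono' (by fun_prop) (ae_of_all _ fun x => ?_)
  rw [Real.norm_of_nonneg (by positivity)]
  have h2 : (inner ℝ p (x - m)) ^ 2 ≤ ‖p‖ ^ 2 * ‖x - m‖ ^ 2 := by
    rw [← sq_abs, ← mul_pow]
    exact pow_le_pow_left₀ (abs_nonneg _) (abs_real_inner_le_norm _ _) 2
  refine h2.trans (mul_le_mul_of_nonneg_left ?_ (by positivity))
  have := norm_sub_le x m
  nlinarith [norm_nonneg (x - m), sq_nonneg (‖x‖ - ‖m‖)]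

/-- The quadratic form of the covariance is the variance of linear functionals. -/
lemma inner_act_covMat (hν : ν ∈ P2 d) (p : E d) :
    inner ℝ p (act (covMat ν) p) = ∫ x, (inner ℝ p (x - mean ν)) ^ 2 ∂ν := by
  have := hν.1
  have e : ∀ x : E d, (inner ℝ p (x - mean ν)) ^ 2
      = ∑ i, ∑ j, p i * p j * ((x i - mean ν i) * (x j - mean ν j)) := fun x => by
    rw [inner_eq_sum, sq, Finset.sum_mul_sum]
    refine Finset.sum_congr rfl fun i _ => Finset.sum_congr rfl fun j _ => ?_
    simp only [PiLp.sub_apply]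
    ring
  have hint : ∀ i j : Fin d, Integrable
      (fun x : E d => p i * p j * ((x i - mean ν i) * (x j - mean ν j))) ν := fun i j => by
    have h : Integrable (fun x : E d => x i * x j - mean ν j * x i - mean ν i * x j
        + mean ν i * mean ν j) ν :=
      (((P2.integrable_coord_mul hν i j).sub ((P2.integrable_coord hν i).const_mul (mean ν j))).sub
        ((P2.integrable_coord hν j).const_mul (mean ν i))).add (integrable_const _)
    refine (h.congr (ae_of_all _ fun x => ?_)).const_mul _
    ring
  simp only [e]
  rw [integral_finsetSum _ fun i _ => integrable_finsetSum _ fun j _ => hint i j, inner_eq_sum]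
  refine Finset.sum_congr rfl fun i _ => ?_
  rw [integral_finsetSum _ fun j _ => hint i j, act_apply, Finset.mul_sum]
  refine Finset.sum_congr rfl fun j _ => ?_
  rw [integral_const_mul]
  simp only [covMat, Matrix.of_apply]
  ring

lemma inner_act_covMat_nonneg (hν : ν ∈ P2 d) (p : E d) :
    0 ≤ inner ℝ p (act (covMat ν) p) := by
  rw [inner_act_covMat hν]
  exact integral_nonneg fun x => sq_nonneg _

lemma inner_act_eq_dotProduct (C : Matrix (Fin d) (Fin d) ℝ) (p : E d) :
    inner ℝ p (act C p) = (p : Fin d → ℝ) ⬝ᵥ C *ᵥ (p : Fin d → ℝ) := by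
  rw [inner_eq_sum]
  simp only [act_apply]
  rfl

lemma posDef_of_inner {C : Matrix (Fin d) (Fin d) ℝ} (hC : C.IsHermitian)
    (h : ∀ p : E d, p ≠ 0 → 0 < inner ℝ p (act C p)) : C.PosDef := by
  refine Matrix.PosDef.of_dotProduct_mulVec_pos hC fun x hx => ?_
  have := h (WithLp.toLp 2 x) (by simpa using hx)
  rw [inner_act_eq_dotProduct] at this
  simpa using this

lemma PosDef.inner_pos {C : Matrix (Fin d) (Fin d) ℝ} (hC : C.PosDef) {p : E d} (hp : p ≠ 0) :
    0 < inner ℝ p (act C p) := by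
  have := hC.dotProduct_mulVec_pos (x := (p : Fin d → ℝ)) (by
    intro h; exact hp (by ext i; exact congrFun h i))
  rw [inner_act_eq_dotProduct]
  simpa using this

lemma covMat_posSemidef (hν : ν ∈ P2 d) : (covMat ν).PosSemidef := by
  refine Matrix.PosSemidef.of_dotProduct_mulVec_nonneg (covMat_isHermitian ν) fun x => ?_
  have := inner_act_covMat_nonneg hν (WithLp.toLp 2 x)
  rw [inner_act_eq_dotProduct] at this
  simpa using this

lemma inner_act_covMat_le (hν : ν ∈ P2 d) (p : E d) :
    inner ℝ p (act (covMat ν) p) ≤ ∫ x, (inner ℝ p x) ^ 2 ∂ν := by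
  have := hν.1
  have hi : ∀ m : E d, Integrable (fun x : E d => (inner ℝ p (x - m)) ^ 2) ν :=
    integrable_inner_sub_sq hν p
  have hp : Integrable (fun x : E d => inner ℝ p x) ν := (P2.integrable_id hν).const_inner p
  have hm : ∫ x, inner ℝ p x ∂ν = inner ℝ p (mean ν) := by
    rw [mean, integral_inner (P2.integrable_id hν) p]
  have h0 : Integrable (fun x : E d => (inner ℝ p x) ^ 2) ν := by simpa using hi 0
  rw [inner_act_covMat hν]
  have e : ∀ x : E d, (inner ℝ p (x - mean ν)) ^ 2 = (inner ℝ p x) ^ 2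
      - 2 * inner ℝ p (mean ν) * inner ℝ p x + (inner ℝ p (mean ν)) ^ 2 := fun x => by
    rw [inner_sub_right]; ring
  simp only [e]
  have h1 : Integrable (fun x : E d => (inner ℝ p x) ^ 2
      - 2 * inner ℝ p (mean ν) * inner ℝ p x) ν := h0.sub (hp.const_mul _)
  rw [integral_add h1 (integrable_const _), integral_sub h0 (hp.const_mul _), integral_const_mul, hm]
  simp
  nlinarith [sq_nonneg (inner ℝ p (mean ν))]

end Moments

/-! ### Cutoffs -/

variable {d : ℕ}

/-- Smooth functions of at most quadratic growth, with gradient of at most linear growth. -/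
structure QuadGrowth (f : E d → ℝ) (A : ℝ) : Prop where
  smooth : ContDiff ℝ (⊤ : ℕ∞) f
  bound : ∀ x, |f x| ≤ A * (1 + ‖x‖) ^ 2
  fderiv_bound : ∀ x, ‖fderiv ℝ f x‖ ≤ A * (1 + ‖x‖)

lemma exists_cutoff (d : ℕ) : ∃ (K : ℝ) (χ : ℕ → E d → ℝ), 0 ≤ K ∧
    (∀ n, ContDiff ℝ (⊤ : ℕ∞) (χ n)) ∧ (∀ n, HasCompactSupport (χ n)) ∧
    (∀ n x, 0 ≤ χ n x) ∧ (∀ n x, χ n x ≤ 1) ∧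
    (∀ n x, ‖fderiv ℝ (χ n) x‖ ≤ K / (1 + ‖x‖)) ∧
    (∀ x, ∀ᶠ n in atTop, χ n x = 1 ∧ fderiv ℝ (χ n) x = 0) := by
  let b : ContDiffBump (0 : E d) := ⟨1, 2, by norm_num, by norm_num⟩
  have hb : ContDiff ℝ (⊤ : ℕ∞) b := b.contDiff
  obtain ⟨K, hK⟩ := (hb.continuous_fderiv (by simp)).bounded_above_of_compact_support
    (b.hasCompactSupport.fderiv ℝ)
  have hK0 : 0 ≤ K := (norm_nonneg _).trans (hK 0)
  let c : ℕ → ℝ := fun n => 1 / ((n : ℝ) + 1)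
  have hc : ∀ n, 0 < c n := fun n => Nat.one_div_pos_of_nat
  let χ : ℕ → E d → ℝ := fun n x => b (c n • x)
  have hfd : ∀ n x, fderiv ℝ (χ n) x = c n • fderiv ℝ b (c n • x) := fun n x => by
    have := fderiv_comp_smul (𝕜 := ℝ) (f := (b : E d → ℝ)) (c n) (x := x)
    exact this
  refine ⟨3 * K, χ, by positivity, fun n => hb.comp (contDiff_const_smul _), fun n => ?_,
    fun n x => b.nonneg, fun n x => b.le_one, fun n x => ?_, fun x => ?_⟩
  · exact b.hasCompactSupport.comp_smul (hc n).ne'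
  · rw [hfd, norm_smul, Real.norm_of_nonneg (hc n).le]
    rw [le_div_iff₀ (by positivity)]
    by_cases hx : c n • x ∈ tsupport (b : E d → ℝ)
    · rw [b.tsupport_eq, mem_closedBall_zero_iff, norm_smul, Real.norm_of_nonneg (hc n).le] at hx
      change c n * ‖x‖ ≤ 2 at hx
      have h1 : c n ≤ 1 := by
        simp only [c]
        rw [div_le_one (by positivity)]
        linarith [(n.cast_nonneg : (0 : ℝ) ≤ n)]
      calc c n * ‖fderiv ℝ b (c n • x)‖ * (1 + ‖x‖)
          = (c n + c n * ‖x‖) * ‖fderiv ℝ b (c n • x)‖ := by ring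
        _ ≤ 3 * K := mul_le_mul (by linarith) (hK _) (norm_nonneg _) (by norm_num)
    · have : fderiv ℝ b (c n • x) = 0 :=
        image_eq_zero_of_notMem_tsupport fun h => hx (tsupport_fderiv_subset ℝ h)
      rw [this]
      simp
      positivity
  · obtain ⟨n₀, hn₀⟩ := exists_nat_gt ‖x‖
    filter_upwards [eventually_ge_atTop n₀] with n hn
    have hlt : c n * ‖x‖ < 1 := by
      simp only [c]
      rw [one_div_mul_eq_div, div_lt_one (by positivity)]
      have : (n₀ : ℝ) ≤ n := by exact_mod_cast hn
      linarith
    have hmem : c n • x ∈ Metric.ball (0 : E d) 1 := by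
      rw [mem_ball_zero_iff, norm_smul, Real.norm_of_nonneg (hc n).le]; exact hlt
    refine ⟨b.one_of_mem_closedBall (Metric.ball_subset_closedBall hmem), ?_⟩
    rw [hfd]
    have : (b : E d → ℝ) =ᶠ[𝓝 (c n • x)] fun _ => 1 := by
      filter_upwards [Metric.isOpen_ball.mem_nhds hmem] with y hy
      exact b.one_of_mem_closedBall (Metric.ball_subset_closedBall hy)
    rw [this.fderiv_eq]
    simp

/-- Functions of quadratic growth are limits of test functions with uniform bounds. -/
lemma QuadGrowth.exists_approx {f : E d → ℝ} {A : ℝ} (hf : QuadGrowth f A) :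
    ∃ (A' : ℝ) (F : ℕ → E d → ℝ), 0 ≤ A' ∧ (∀ n, ContDiff ℝ (⊤ : ℕ∞) (F n)) ∧
      (∀ n, HasCompactSupport (F n)) ∧ (∀ n x, |F n x| ≤ |f x|) ∧
      (∀ n x, 0 ≤ f x → F n x ≤ f x) ∧
      (∀ n x, ‖fderiv ℝ (F n) x‖ ≤ A' * (1 + ‖x‖)) ∧
      (∀ x, ∀ᶠ n in atTop, F n x = f x ∧ fderiv ℝ (F n) x = fderiv ℝ f x) := by
  obtain ⟨K, χ, hK, hχs, hχc, hχ0, hχ1, hχd, hχlim⟩ := exists_cutoff d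
  have hA : 0 ≤ A := by
    have := (abs_nonneg _).trans (hf.bound 0)
    simpa using this
  have hfd : ∀ n x, fderiv ℝ (fun y => χ n y * f y) x
      = χ n x • fderiv ℝ f x + f x • fderiv ℝ (χ n) x := fun n x =>
    fderiv_fun_mul ((hχs n).differentiable (by simp) x) (hf.smooth.differentiable (by simp) x)
  refine ⟨A + K * A, fun n x => χ n x * f x, by positivity, fun n => (hχs n).mul hf.smooth,
    fun n => (hχc n).mul_right, fun n x => ?_, fun n x hx => ?_, fun n x => ?_, fun x => ?_⟩
  · rw [abs_mul, abs_of_nonneg (hχ0 n x)]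
    exact mul_le_of_le_one_left (abs_nonneg _) (hχ1 n x)
  · exact mul_le_of_le_one_left hx (hχ1 n x)
  · rw [hfd]
    refine (norm_add_le _ _).trans ?_
    rw [norm_smul, norm_smul, Real.norm_of_nonneg (hχ0 n x), add_mul]
    have h1 : χ n x * ‖fderiv ℝ f x‖ ≤ A * (1 + ‖x‖) :=
      (mul_le_of_le_one_left (norm_nonneg _) (hχ1 n x)).trans (hf.fderiv_bound x)
    have h2 : ‖f x‖ * ‖fderiv ℝ (χ n) x‖ ≤ (A * (1 + ‖x‖) ^ 2) * (K / (1 + ‖x‖)) :=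
      mul_le_mul (hf.bound x) (hχd n x) (norm_nonneg _) (by positivity)
    have h3 : (A * (1 + ‖x‖) ^ 2) * (K / (1 + ‖x‖)) = K * A * (1 + ‖x‖) := by
      field_simp
    linarith
  · filter_upwards [hχlim x] with n hn
    rw [hfd, hn.1, hn.2]
    simp

lemma quadGrowth_coord (i : Fin d) : QuadGrowth (fun x : E d => x i) 1 := by
  have e : (fun x : E d => x i) = (EuclideanSpace.proj i : E d →L[ℝ] ℝ) := rfl
  refine ⟨by rw [e]; exact ContinuousLinearMap.contDiff _, fun x =>
    (abs_coord_le x i).trans (norm_le_one_add_sq x), fun x => ?_⟩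
  rw [e, ContinuousLinearMap.fderiv]
  refine (ContinuousLinearMap.opNorm_le_bound _ zero_le_one fun y => ?_).trans
    (by linarith [norm_nonneg x])
  simpa using abs_coord_le y i

lemma fderiv_coord (i : Fin d) (x v : E d) : fderiv ℝ (fun x : E d => x i) x v = v i := by
  have e : (fun x : E d => x i) = (EuclideanSpace.proj i : E d →L[ℝ] ℝ) := rfl
  rw [e, ContinuousLinearMap.fderiv]
  rfl

lemma fderiv_coord_mul (i j : Fin d) (x v : E d) :
    fderiv ℝ (fun x : E d => x i * x j) x v = x i * v j + x j * v i := by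
  rw [fderiv_fun_mul ((quadGrowth_coord i).smooth.differentiable (by simp) x)
    ((quadGrowth_coord j).smooth.differentiable (by simp) x)]
  simp [fderiv_coord]

lemma quadGrowth_coord_mul (i j : Fin d) : QuadGrowth (fun x : E d => x i * x j) 2 := by
  refine ⟨(quadGrowth_coord i).smooth.mul (quadGrowth_coord j).smooth, fun x => ?_, fun x => ?_⟩
  · rw [abs_mul]
    nlinarith [abs_coord_le x i, abs_coord_le x j, abs_nonneg (x i), abs_nonneg (x j), norm_nonneg x,
      mul_le_mul (abs_coord_le x i) (abs_coord_le x j) (abs_nonneg _) (norm_nonneg _)]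
  · refine ContinuousLinearMap.opNorm_le_bound _ (by positivity) fun v => ?_
    rw [fderiv_coord_mul]
    refine (abs_add_le _ _).trans ?_
    rw [abs_mul, abs_mul]
    have h1 := mul_le_mul (abs_coord_le x i) (abs_coord_le v j) (abs_nonneg _) (norm_nonneg _)
    have h2 := mul_le_mul (abs_coord_le x j) (abs_coord_le v i) (abs_nonneg _) (norm_nonneg _)
    nlinarith [norm_nonneg x, norm_nonneg v]

lemma quadGrowth_one_add_sq : QuadGrowth (fun x : E d => 1 + ‖x‖ ^ 2) 2 := by
  refine ⟨contDiff_const.add (contDiff_norm_sq ℝ), fun x => ?_, fun x => ?_⟩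
  · rw [abs_of_nonneg (by positivity)]
    nlinarith [norm_nonneg x]
  · rw [fderiv_const_add, fderiv_norm_sq_apply]
    refine ContinuousLinearMap.opNorm_le_bound _ (by positivity) fun v => ?_
    simp
    have := abs_real_inner_le_norm x v
    nlinarith [norm_nonneg x, norm_nonneg v]

end

section

/-! ### Control of the flux by the action -/

variable {d : ℕ} {μ : ℝ → ProbabilityMeasure (E d)} {μ₀ μ₁ : Measure (E d)} {V : ℝ → E d → E d}

lemma lintegral_mul_le_of_sq_le {α : Type*} [MeasurableSpace α] {ν : Measure α}
    {f g : α → ℝ≥0∞} (hf : AEMeasurable f ν) (hg : AEMeasurable g ν) {u v : ℝ} (hu : 0 ≤ u)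
    (hv : 0 ≤ v) (h1 : ∫⁻ x, f x ^ 2 ∂ν ≤ ENNReal.ofReal (u ^ 2))
    (h2 : ∫⁻ x, g x ^ 2 ∂ν ≤ ENNReal.ofReal (v ^ 2)) :
    ∫⁻ x, f x * g x ∂ν ≤ ENNReal.ofReal (u * v) := by
  have hroot : ∀ (w : ℝ) (_ : 0 ≤ w), (ENNReal.ofReal (w ^ 2)) ^ (1 / 2 : ℝ) = ENNReal.ofReal w := by
    intro w hw
    rw [ENNReal.ofReal_rpow_of_nonneg (by positivity) (by norm_num), ← Real.sqrt_eq_rpow,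
      Real.sqrt_sq hw]
  have := ENNReal.lintegral_mul_le_Lp_mul_Lq ν (p := 2) (q := 2)
    (Real.holderConjugate_iff.mpr (by norm_num)) hf hg
  simp only [Pi.mul_apply, ENNReal.rpow_two] at this
  refine this.trans ?_
  rw [ENNReal.ofReal_mul hu, ← hroot u hu, ← hroot v hv]
  gcongr

/-- A bound on the flux in direction `p` relative to the variance in direction `p`. -/
structure DirControl (μ : ℝ → ProbabilityMeasure (E d)) (V : ℝ → E d → E d) (p : E d)
    (β : ℝ → ℝ) : Prop where
  memLp : MemLp β 2 (volume.restrict (Ioo (0 : ℝ) 1))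
  nonneg : ∀ t, 0 ≤ β t
  bound : ∀ᵐ t ∂(volume.restrict (Ioo (0 : ℝ) 1)),
    ∫⁻ x, ENNReal.ofReal ((inner ℝ p (V t x)) ^ 2) ∂(μ t : Measure (E d))
      ≤ ENNReal.ofReal (β t ^ 2 * inner ℝ p (act (covMat (μ t : Measure (E d))) p))

/-- Cauchy–Schwarz for the modulated norm. The quotient form is also correct when the variance in
direction `p` vanishes. -/
lemma div_le_modNormSq {C : Matrix (Fin d) (Fin d) ℝ} (hC : C.PosSemidef) (p ξ : E d) :
    ENNReal.ofReal ((inner ℝ p ξ) ^ 2) / ENNReal.ofReal (inner ℝ p (act C p))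
      ≤ modNormSq C ξ := by
  refine le_iInf₂ fun η hη => ENNReal.div_le_of_le_mul ?_
  subst hη
  have hq : ∀ x : E d, 0 ≤ inner ℝ x (act C x) := fun x => by
    rw [inner_act_eq_dotProduct]
    simpa using hC.dotProduct_mulVec_nonneg (x : Fin d → ℝ)
  have hsymm : inner ℝ η (act C p) = inner ℝ p (act C η) := by
    rw [← inner_act hC.1, real_inner_comm]
  have hact : ∀ (s : ℝ) , act C (η + s • p) = act C η + s • act C p := fun s => by
    simp [act]
  have hquad : ∀ s : ℝ, 0 ≤ inner ℝ p (act C p) * (s * s) + 2 * inner ℝ p (act C η) * s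
      + inner ℝ η (act C η) := fun s => by
    have := hq (η + s • p)
    rw [hact, inner_add_left, inner_add_right, inner_add_right, inner_smul_left, inner_smul_right,
      inner_smul_left, inner_smul_right, hsymm] at this
    simp at this
    linarith
  have hdisc := discrim_le_zero hquad
  rw [discrim] at hdisc
  rw [mul_comm, real_inner_comm, ← ENNReal.ofReal_mul (hq p)]
  rw [real_inner_comm η (act C η), real_inner_comm]
  exact ENNReal.ofReal_le_ofReal (by nlinarith)

lemma measurable_inner_uncurry (hV : Measurable (Function.uncurry V)) (p : E d) :
    Measurable fun z : ℝ × E d => inner ℝ p (V z.1 z.2) :=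
  (innerSL ℝ p).continuous.measurable.comp hV

lemma aemeasurable_inner_act_covMat (hμ : ContinuousOn μ (Icc 0 1))
    (hP2 : ∀ t ∈ Icc (0 : ℝ) 1, (μ t : Measure (E d)) ∈ P2 d) (p : E d) :
    AEMeasurable (fun t => inner ℝ p (act (covMat (μ t : Measure (E d))) p))
      (volume.restrict (Ioo (0 : ℝ) 1)) := by
  have hm : ∀ {f : E d → ℝ}, Measurable f → AEMeasurable
      (fun t => ∫ x, f x ∂(μ t : Measure (E d))) (volume.restrict (Ioo (0 : ℝ) 1)) := fun hf =>
    (aestronglyMeasurable_integral_curve hμ (hf.comp measurable_snd)).aemeasurable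
  have h1 : AEMeasurable (fun t => ∑ i, p i * ∑ j, ((∫ x : E d, x i * x j ∂(μ t : Measure (E d)))
      - (∫ x : E d, x i ∂(μ t : Measure (E d))) * (∫ x : E d, x j ∂(μ t : Measure (E d)))) * p j)
      (volume.restrict (Ioo (0 : ℝ) 1)) :=
    Finset.aemeasurable_fun_sum _ fun i _ => (Finset.aemeasurable_fun_sum _ fun j _ =>
      ((hm (by fun_prop)).sub ((hm (by fun_prop)).mul (hm (by fun_prop)))).mul_const _).const_mul _
  refine h1.congr ?_
  filter_upwards [ae_restrict_mem measurableSet_Ioo] with t ht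
  have ht' := hP2 t (Ioo_subset_Icc_self ht)
  rw [inner_eq_sum]
  simp only [act_apply, covMat_apply ht', mean_apply ht']

/-- Finite action controls the flux in every direction, with square integrable constant. -/
lemma IsCE.exists_dirControl (h : IsCE μ₀ μ₁ μ V)
    (hfin : ∫⁻ t in Ioo (0 : ℝ) 1, ∫⁻ x, 1 / 2 * modNormSq (covMat (μ t : Measure (E d))) (V t x)
      ∂(μ t : Measure (E d)) < ⊤) (p : E d) : ∃ β, DirControl μ V p β := by
  set F : ℝ → ℝ≥0∞ := fun t =>
    ∫⁻ x, ENNReal.ofReal ((inner ℝ p (V t x)) ^ 2) ∂(μ t : Measure (E d)) with hF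
  set q : ℝ → ℝ := fun t => inner ℝ p (act (covMat (μ t : Measure (E d))) p) with hq
  set r : ℝ → ℝ≥0∞ := fun t => F t / ENNReal.ofReal (q t) with hr
  have hVp := measurable_inner_uncurry h.borel p
  have hFm : AEMeasurable F (volume.restrict (Ioo (0 : ℝ) 1)) :=
    aemeasurable_lintegral_curve h.weakly_continuous (hVp.pow_const 2).ennreal_ofReal
  have hrm : AEMeasurable r (volume.restrict (Ioo (0 : ℝ) 1)) :=
    hFm.div (aemeasurable_inner_act_covMat h.weakly_continuous h.finite_moment p).ennreal_ofReal
  have hrle : ∀ t ∈ Ioo (0 : ℝ) 1, r t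
      ≤ 2 * ∫⁻ x, 1 / 2 * modNormSq (covMat (μ t : Measure (E d))) (V t x)
        ∂(μ t : Measure (E d)) := fun t ht => by
    have hps := covMat_posSemidef (h.finite_moment t (Ioo_subset_Icc_self ht))
    have hm : Measurable fun x => ENNReal.ofReal ((inner ℝ p (V t x)) ^ 2) :=
      ((hVp.comp measurable_prodMk_left).pow_const 2).ennreal_ofReal
    rw [lintegral_const_mul' _ _ (by simp), ← mul_assoc]
    have : (2 : ℝ≥0∞) * (1 / 2) = 1 := by
      rw [one_div]; exact ENNReal.mul_inv_cancel (by norm_num) (by norm_num)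
    rw [this, one_mul]
    simp only [hr, hF, div_eq_mul_inv]
    rw [← lintegral_mul_const _ hm]
    exact lintegral_mono fun x => div_le_modNormSq hps p (V t x)
  have hrfin : ∫⁻ t in Ioo (0 : ℝ) 1, r t ≠ ⊤ := by
    refine ne_of_lt (lt_of_le_of_lt (setLIntegral_mono' measurableSet_Ioo hrle) ?_)
    rw [lintegral_const_mul' _ _ (by norm_num)]
    exact ENNReal.mul_lt_top (by norm_num) hfin
  refine ⟨fun t => √(r t).toReal, ?_, fun t => Real.sqrt_nonneg _, ?_⟩
  · rw [memLp_two_iff_integrable_sq hrm.ennreal_toReal.sqrt.aestronglyMeasurable]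
    refine (integrable_toReal_of_lintegral_ne_top hrm hrfin).congr (ae_of_all _ fun t => ?_)
    simp [Real.sq_sqrt]
  · filter_upwards [ae_lt_top' hrm hrfin, ae_restrict_mem measurableSet_Ioo] with t ht ht01
    have hq0 : 0 ≤ q t := inner_act_covMat_nonneg (h.finite_moment t (Ioo_subset_Icc_self ht01)) p
    rw [Real.sq_sqrt ENNReal.toReal_nonneg, ENNReal.ofReal_mul ENNReal.toReal_nonneg,
      ENNReal.ofReal_toReal ht.ne]
    change F t ≤ r t * ENNReal.ofReal (q t)
    by_cases h0 : ENNReal.ofReal (q t) = 0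
    · have : F t = 0 := by
        by_contra hne
        simp only [hr, h0, ENNReal.div_zero hne] at ht
        exact lt_irrefl _ ht
      simp [this]
    · rw [hr, ENNReal.div_mul_cancel h0 ENNReal.ofReal_ne_top]

lemma enorm_sq_eq_sum (v : E d) : ‖v‖ₑ ^ 2 = ∑ i, ENNReal.ofReal (v i ^ 2) := by
  rw [← ofReal_norm, ← ENNReal.ofReal_pow (norm_nonneg _), EuclideanSpace.norm_sq_eq,
    ENNReal.ofReal_sum_of_nonneg fun i _ => by positivity]
  simp

lemma inner_single (i : Fin d) (v : E d) : inner ℝ (EuclideanSpace.single i (1 : ℝ)) v = v i := by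
  simp [EuclideanSpace.inner_single_left]

/-- The directional controls bound the full kinetic energy by the second moment. -/
lemma exists_energy_control (h : IsCE μ₀ μ₁ μ V)
    (hdir : ∀ p, ∃ β, DirControl μ V p β) :
    ∃ β : ℝ → ℝ, MemLp β 2 (volume.restrict (Ioo (0 : ℝ) 1)) ∧ (∀ t, 0 ≤ β t) ∧
      ∀ᵐ t ∂(volume.restrict (Ioo (0 : ℝ) 1)), ∫⁻ x, ‖V t x‖ₑ ^ 2 ∂(μ t : Measure (E d))
        ≤ ENNReal.ofReal (β t ^ 2 * ∫ x, (1 + ‖x‖ ^ 2) ∂(μ t : Measure (E d))) := by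
  choose β hβ using fun i : Fin d => hdir (EuclideanSpace.single i 1)
  refine ⟨fun t => ∑ i, β i t, memLp_finsetSum _ fun i _ => (hβ i).memLp,
    fun t => Finset.sum_nonneg fun i _ => (hβ i).nonneg t, ?_⟩
  filter_upwards [ae_all_iff.mpr fun i => (hβ i).bound, ae_restrict_mem measurableSet_Ioo]
    with t ht ht01
  have hP := h.finite_moment t (Ioo_subset_Icc_self ht01)
  have hprob := hP.1
  have hN : ∀ i, inner ℝ (EuclideanSpace.single i (1 : ℝ))
      (act (covMat (μ t : Measure (E d))) (EuclideanSpace.single i 1))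
      ≤ ∫ x, (1 + ‖x‖ ^ 2) ∂(μ t : Measure (E d)) := fun i => by
    refine (inner_act_covMat_le hP _).trans (integral_mono ?_
      ((integrable_const _).add (P2.integrable_sq hP)) fun x => ?_)
    · simpa using integrable_inner_sub_sq hP (EuclideanSpace.single i 1) 0
    · simp only [inner_single]
      have := abs_coord_le x i
      have : x i ^ 2 ≤ ‖x‖ ^ 2 := sq_le_sq' (by linarith [neg_abs_le (x i)])
        ((le_abs_self _).trans this)
      linarith
  have hN0 : 0 ≤ ∫ x, (1 + ‖x‖ ^ 2) ∂(μ t : Measure (E d)) :=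
    integral_nonneg fun x => by positivity
  simp only [inner_single] at ht hN
  have hVi : ∀ i, Measurable fun x => ENNReal.ofReal (V t x i ^ 2) := fun i => by
    have := (measurable_inner_uncurry h.borel (EuclideanSpace.single i 1)).comp
      (measurable_prodMk_left (x := t))
    simp only [inner_single, Function.comp_def] at this
    exact (this.pow_const 2).ennreal_ofReal
  calc ∫⁻ x, ‖V t x‖ₑ ^ 2 ∂(μ t : Measure (E d))
      = ∑ i, ∫⁻ x, ENNReal.ofReal (V t x i ^ 2) ∂(μ t : Measure (E d)) := by
        simp only [enorm_sq_eq_sum]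
        rw [lintegral_finsetSum _ fun i _ => hVi i]
    _ ≤ ∑ i, ENNReal.ofReal (β i t ^ 2 * ∫ x, (1 + ‖x‖ ^ 2) ∂(μ t : Measure (E d))) := by
        refine Finset.sum_le_sum fun i _ => (ht i).trans (ENNReal.ofReal_le_ofReal ?_)
        exact mul_le_mul_of_nonneg_left (hN i) (sq_nonneg _)
    _ = ENNReal.ofReal ((∑ i, β i t ^ 2) * ∫ x, (1 + ‖x‖ ^ 2) ∂(μ t : Measure (E d))) := by
        rw [← ENNReal.ofReal_sum_of_nonneg fun i _ => by positivity, Finset.sum_mul]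
    _ ≤ _ := by
        refine ENNReal.ofReal_le_ofReal (mul_le_mul_of_nonneg_right ?_ hN0)
        exact Finset.sum_sq_le_sq_sum_of_nonneg fun i _ => (hβ i).nonneg t

/-- Along a curve of finite action the second moment is bounded. -/
lemma exists_moment_bound (h : IsCE μ₀ μ₁ μ V) {β : ℝ → ℝ}
    (hβ2 : MemLp β 2 (volume.restrict (Ioo (0 : ℝ) 1))) (hβ0 : ∀ t, 0 ≤ β t)
    (hβ : ∀ᵐ t ∂(volume.restrict (Ioo (0 : ℝ) 1)), ∫⁻ x, ‖V t x‖ₑ ^ 2 ∂(μ t : Measure (E d))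
        ≤ ENNReal.ofReal (β t ^ 2 * ∫ x, (1 + ‖x‖ ^ 2) ∂(μ t : Measure (E d)))) :
    ∃ B, ∀ t ∈ Icc (0 : ℝ) 1, ∫ x, (1 + ‖x‖ ^ 2) ∂(μ t : Measure (E d)) ≤ B := by
  obtain ⟨A, F, hA, hFs, hFc, hFle, hFle', hFd, hFlim⟩ := (quadGrowth_one_add_sq (d := d)).exists_approx
  set N : ℝ → ℝ := fun t => ∫ x, (1 + ‖x‖ ^ 2) ∂(μ t : Measure (E d)) with hN
  have hN0 : ∀ t, 0 ≤ N t := fun t => integral_nonneg fun x => by positivity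
  have hint : ∀ t ∈ Icc (0 : ℝ) 1,
      Integrable (fun x : E d => 1 + ‖x‖ ^ 2) (μ t : Measure (E d)) := fun t ht => by
    have := (h.finite_moment t ht).1
    exact (integrable_const _).add (P2.integrable_sq (h.finite_moment t ht))
  have hFint : ∀ n, ∀ t ∈ Icc (0 : ℝ) 1, Integrable (F n) (μ t : Measure (E d)) := fun n t ht =>
    (hint t ht).mono' (hFs n).continuous.aestronglyMeasurable (ae_of_all _ fun x =>
      (hFle n x).trans (le_of_eq (abs_of_nonneg (by positivity))))
  have hlim : ∀ t ∈ Icc (0 : ℝ) 1, Tendsto (fun n => ∫ x, F n x ∂(μ t : Measure (E d))) atTop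
      (𝓝 (N t)) := fun t ht => by
    refine tendsto_integral_of_dominated_convergence _
      (fun n => (hFs n).continuous.aestronglyMeasurable) (hint t ht)
      (fun n => ae_of_all _ fun x => (hFle n x).trans (le_of_eq (abs_of_nonneg (by positivity))))
      (ae_of_all _ fun x => ?_)
    exact tendsto_const_nhds.congr' ((hFlim x).mono fun n hn => hn.1.symm)
  have hβi : IntegrableOn β (Ioo 0 1) := hβ2.integrable (by norm_num)
  have hβii : IntervalIntegrable β volume 0 1 := by
    rw [intervalIntegrable_iff_integrableOn_Ioo_of_le zero_le_one]; exact hβi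
  have hAm : Measurable fun x : E d => ENNReal.ofReal (A * (1 + ‖x‖)) := by fun_prop
  refine exists_bound_of_increments (N := N) (α := fun t => 2 * A * β t) (fun K => ?_)
    (hβii.const_mul _) (fun t => by have := hβ0 t; positivity) hN0 ?_
  -- lower semicontinuity: `N` is the supremum of continuous functions of time
  · have : {t | t ∈ Icc (0 : ℝ) 1 ∧ N t ≤ K}
        = ⋂ n, (Icc 0 1 ∩ (fun t => ∫ x, F n x ∂(μ t : Measure (E d))) ⁻¹' Iic K) := by
      ext t
      simp only [mem_ofPred_eq, mem_iInter, mem_inter_iff, mem_preimage, mem_Iic]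
      constructor
      · rintro ⟨ht, hK⟩ n
        exact ⟨ht, (integral_mono (hFint n t ht) (hint t ht)
          fun x => hFle' n x (by positivity)).trans hK⟩
      · intro hall
        exact ⟨(hall 0).1, le_of_tendsto' (hlim t (hall 0).1) fun n => (hall n).2⟩
    rw [this]
    refine isClosed_iInter fun n => ?_
    obtain ⟨C, hC⟩ := (hFs n).continuous.bounded_above_of_compact_support (hFc n)
    exact (continuousOn_integral h.weakly_continuous (hFs n).continuous
      hC).preimage_isClosed_of_isClosed isClosed_Icc isClosed_Iic
  · intro a b B ha hab hb hB
    have hsub : Icc a b ⊆ Icc (0 : ℝ) 1 := Icc_subset_Icc ha hb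
    have hB0 : 0 ≤ B := (hN0 a).trans (hB a (left_mem_Icc.mpr hab))
    have hsub' : Ioo a b ⊆ Ioo (0 : ℝ) 1 := Ioo_subset_Ioo ha hb
    have haeb : ∀ᵐ t ∂(volume.restrict (Ioo a b)), ∀ n,
        ‖∫ x, fderiv ℝ (F n) x (V t x) ∂(μ t : Measure (E d))‖ ≤ B * (2 * A * β t) := by
      filter_upwards [ae_restrict_of_ae_restrict_of_subset hsub' hβ,
        ae_restrict_mem measurableSet_Ioo] with t ht htab n
      have htI := hsub (Ioo_subset_Icc_self htab)
      have hVm : Measurable (V t) := h.borel.comp measurable_prodMk_left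
      have h1 : ∫⁻ x, ENNReal.ofReal (A * (1 + ‖x‖)) ^ 2 ∂(μ t : Measure (E d))
          ≤ ENNReal.ofReal ((2 * A * √(N t)) ^ 2) := by
        have e : ∀ x : E d, ENNReal.ofReal (A * (1 + ‖x‖)) ^ 2
            ≤ ENNReal.ofReal ((2 * A) ^ 2 * (1 + ‖x‖ ^ 2)) := fun x => by
          rw [← ENNReal.ofReal_pow (by positivity)]
          refine ENNReal.ofReal_le_ofReal ?_
          have : (1 + ‖x‖) ^ 2 ≤ 4 * (1 + ‖x‖ ^ 2) := by nlinarith [sq_nonneg (1 - ‖x‖), sq_nonneg ‖x‖]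
          nlinarith [mul_le_mul_of_nonneg_left this (sq_nonneg A)]
        refine (lintegral_mono e).trans ?_
        rw [← ofReal_integral_eq_lintegral_ofReal ((hint t htI).const_mul _)
          (ae_of_all _ fun x => by positivity), integral_const_mul, mul_pow (2 * A) (√(N t)),
          Real.sq_sqrt (hN0 t)]
      have h2 : ∫⁻ x, ‖V t x‖ₑ ^ 2 ∂(μ t : Measure (E d))
          ≤ ENNReal.ofReal ((β t * √(N t)) ^ 2) := by
        rw [mul_pow, Real.sq_sqrt (hN0 t)]; exact ht
      have h3 := lintegral_mul_le_of_sq_le (hAm.aemeasurable)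
        (hVm.enorm.aemeasurable) (by positivity) (by have := hβ0 t; positivity) h1 h2
      have h4 : ‖∫ x, fderiv ℝ (F n) x (V t x) ∂(μ t : Measure (E d))‖ₑ
          ≤ ENNReal.ofReal (B * (2 * A * β t)) := by
        refine (enorm_integral_le_lintegral_enorm _).trans ?_
        refine (lintegral_mono fun x => ?_).trans (h3.trans (ENNReal.ofReal_le_ofReal ?_))
        · rw [← ofReal_norm, ← ofReal_norm, ← ENNReal.ofReal_mul (by positivity)]
          refine ENNReal.ofReal_le_ofReal (((fderiv ℝ (F n) x).le_opNorm _).trans ?_)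
          gcongr
          exact hFd n x
        · have e : 2 * A * √(N t) * (β t * √(N t)) = N t * (2 * A * β t) := by
            linear_combination (2 * A * β t) * Real.mul_self_sqrt (hN0 t)
          rw [e]
          have := hβ0 t
          gcongr
          exact hB t (Ioo_subset_Icc_self htab)
      rw [← ofReal_norm] at h4
      exact (ENNReal.ofReal_le_ofReal_iff (by have := hβ0 t; positivity)).mp h4
    have hαi : IntervalIntegrable (fun t => B * (2 * A * β t)) volume a b :=
      ((hβii.mono_set (by rw [uIcc_of_le hab, uIcc_of_le zero_le_one]; exact hsub)).const_mul
        (2 * A)).const_mul B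
    have hgi : ∀ n, IntervalIntegrable
        (fun t => ∫ x, fderiv ℝ (F n) x (V t x) ∂(μ t : Measure (E d))) volume a b := fun n => by
      rw [intervalIntegrable_iff_integrableOn_Ioo_of_le hab] at hαi ⊢
      refine Integrable.mono' hαi ?_ (haeb.mono fun t ht => ht n)
      exact (aestronglyMeasurable_integral_curve h.weakly_continuous
        (measurable_fderiv_uncurry (hFs n) h.borel)).mono_measure (Measure.restrict_mono hsub' le_rfl)
    have hinc : ∀ n, |∫ x, F n x ∂(μ b : Measure (E d)) - ∫ x, F n x ∂(μ a : Measure (E d))|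
        ≤ B * ∫ t in a..b, 2 * A * β t := fun n => by
      rw [h.integral_sub (hFs n) (hFc n) ha hab hb (hgi n), ← intervalIntegral.integral_const_mul,
        ← Real.norm_eq_abs]
      refine intervalIntegral.norm_integral_le_of_norm_le hab ?_ hαi
      rw [← ae_restrict_iff' measurableSet_Ioc, ← restrict_Ioo_eq_restrict_Ioc]
      exact haeb.mono fun t ht => ht n
    exact le_of_tendsto' ((hlim b (hsub (right_mem_Icc.mpr hab))).sub
      (hlim a (hsub (left_mem_Icc.mpr hab)))).abs hinc

end

section

/-! ### Curves of finite kinetic energy -/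

variable {d : ℕ} {μ : ℝ → ProbabilityMeasure (E d)} {μ₀ μ₁ : Measure (E d)} {V : ℝ → E d → E d}

/-- Solutions of the continuity equation with bounded second moment, for which the first moment of
the flux is integrable in time. -/
structure IsFlow (μ₀ μ₁ : Measure (E d)) (μ : ℝ → ProbabilityMeasure (E d))
    (V : ℝ → E d → E d) : Prop where
  ce : IsCE μ₀ μ₁ μ V
  moment : ∃ B, ∀ t ∈ Icc (0 : ℝ) 1, ∫ x, (1 + ‖x‖ ^ 2) ∂(μ t : Measure (E d)) ≤ B
  flux : ∫⁻ t in Ioo (0 : ℝ) 1, ∫⁻ x, ENNReal.ofReal ((1 + ‖x‖) * ‖V t x‖)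
    ∂(μ t : Measure (E d)) < ⊤

lemma lintegral_one_add_sq_le {ν : Measure (E d)} (hν : ν ∈ P2 d) {B : ℝ}
    (hB : ∫ x, (1 + ‖x‖ ^ 2) ∂ν ≤ B) : ∫⁻ x, ENNReal.ofReal (1 + ‖x‖ ^ 2) ∂ν ≤ ENNReal.ofReal B := by
  have := hν.1
  have hi : Integrable (fun x : E d => 1 + ‖x‖ ^ 2) ν :=
    (integrable_const _).add (P2.integrable_sq hν)
  rw [← ofReal_integral_eq_lintegral_ofReal hi (ae_of_all _ fun x => by positivity)]
  exact ENNReal.ofReal_le_ofReal hB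

lemma IsCE.isFlow_of_energy (h : IsCE μ₀ μ₁ μ V) {B : ℝ}
    (hB : ∀ t ∈ Icc (0 : ℝ) 1, ∫ x, (1 + ‖x‖ ^ 2) ∂(μ t : Measure (E d)) ≤ B)
    (hE : ∫⁻ t in Ioo (0 : ℝ) 1, ∫⁻ x, ‖V t x‖ₑ ^ 2 ∂(μ t : Measure (E d)) < ⊤) :
    IsFlow μ₀ μ₁ μ V := by
  refine ⟨h, ⟨B, hB⟩, ?_⟩
  have hle : ∀ t ∈ Ioo (0 : ℝ) 1,
      ∫⁻ x, ENNReal.ofReal ((1 + ‖x‖) * ‖V t x‖) ∂(μ t : Measure (E d))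
      ≤ ENNReal.ofReal 2 * ENNReal.ofReal B + ∫⁻ x, ‖V t x‖ₑ ^ 2 ∂(μ t : Measure (E d)) := by
    intro t ht
    have hP := h.finite_moment t (Ioo_subset_Icc_self ht)
    have e : ∀ x : E d, ENNReal.ofReal ((1 + ‖x‖) * ‖V t x‖)
        ≤ ENNReal.ofReal 2 * ENNReal.ofReal (1 + ‖x‖ ^ 2) + ‖V t x‖ₑ ^ 2 := fun x => by
      rw [← ofReal_norm, ← ENNReal.ofReal_pow (norm_nonneg _),
        ← ENNReal.ofReal_mul (by norm_num),
        ← ENNReal.ofReal_add (by positivity) (by positivity)]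
      refine ENNReal.ofReal_le_ofReal ?_
      nlinarith [sq_nonneg (1 + ‖x‖ - ‖V t x‖), sq_nonneg (1 - ‖x‖), sq_nonneg ‖V t x‖]
    refine (lintegral_mono e).trans ?_
    rw [lintegral_add_left (by fun_prop), lintegral_const_mul _ (by fun_prop)]
    gcongr
    exact lintegral_one_add_sq_le hP (hB t (Ioo_subset_Icc_self ht))
  refine lt_of_le_of_lt (setLIntegral_mono' measurableSet_Ioo hle) ?_
  rw [lintegral_add_left measurable_const]
  refine ENNReal.add_lt_top.mpr ⟨?_, hE⟩
  simp [ENNReal.mul_lt_top]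

lemma IsCE.isFlow (h : IsCE μ₀ μ₁ μ V) (hdir : ∀ p, ∃ β, DirControl μ V p β) :
    IsFlow μ₀ μ₁ μ V := by
  obtain ⟨β, hβ2, hβ0, hβ⟩ := exists_energy_control h hdir
  obtain ⟨B, hB⟩ := exists_moment_bound h hβ2 hβ0 hβ
  refine h.isFlow_of_energy hB ?_
  have hi : Integrable (fun t => β t ^ 2 * B) (volume.restrict (Ioo (0 : ℝ) 1)) :=
    hβ2.integrable_sq.mul_const B
  refine lt_of_le_of_lt ?_ hi.lintegral_lt_top
  refine lintegral_mono_ae ?_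
  filter_upwards [hβ, ae_restrict_mem measurableSet_Ioo] with t ht ht01
  refine ht.trans (ENNReal.ofReal_le_ofReal ?_)
  exact mul_le_mul_of_nonneg_left (hB t (Ioo_subset_Icc_self ht01)) (sq_nonneg _)

namespace IsFlow

lemma measurable_apply (h : IsFlow μ₀ μ₁ μ V) (t : ℝ) : Measurable (V t) :=
  h.ce.borel.comp measurable_prodMk_left

lemma integrable_velocity (h : IsFlow μ₀ μ₁ μ V) :
    Integrable (fun z : ℝ × E d => (1 + ‖z.2‖) * ‖V z.1 z.2‖)
      (spaceTime μ h.ce.weakly_continuous) := by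
  have hm : Measurable (fun z : ℝ × E d => (1 + ‖z.2‖) * ‖V z.1 z.2‖) :=
    (by fun_prop : Measurable fun z : ℝ × E d => 1 + ‖z.2‖).mul h.ce.borel.norm
  refine ⟨hm.aestronglyMeasurable, ?_⟩
  rw [hasFiniteIntegral_iff_ofReal (ae_of_all _ fun z => by positivity),
    lintegral_spaceTime _ hm.ennreal_ofReal]
  exact h.flux

lemma ae_integrable_velocity (h : IsFlow μ₀ μ₁ μ V) : ∀ᵐ t ∂(volume.restrict (Ioo (0 : ℝ) 1)),
    Integrable (fun x : E d => (1 + ‖x‖) * ‖V t x‖) (μ t : Measure (E d)) :=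
  ae_integrable_of_spaceTime _ h.integrable_velocity

lemma integrable_of_velocity_bound {t : ℝ}
    (ht : Integrable (fun x : E d => (1 + ‖x‖) * ‖V t x‖) (μ t : Measure (E d))) {g : E d → ℝ}
    (hg : Measurable g) {A : ℝ} (hA : ∀ x, |g x| ≤ A * ((1 + ‖x‖) * ‖V t x‖)) :
    Integrable g (μ t : Measure (E d)) :=
  (ht.const_mul A).mono' hg.aestronglyMeasurable (ae_of_all _ hA)

/-- The continuity equation holds in integrated form for observables of quadratic growth. -/
lemma isACWith_integral (h : IsFlow μ₀ μ₁ μ V) {f : E d → ℝ} {A : ℝ} (hf : QuadGrowth f A) :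
    IsACWith (fun t => ∫ x, f x ∂(μ t : Measure (E d)))
      (fun t => ∫ x, fderiv ℝ f x (V t x) ∂(μ t : Measure (E d))) := by
  obtain ⟨A', F, hA', hFs, hFc, hFle, -, hFd, hFlim⟩ := hf.exists_approx
  have hA : 0 ≤ A := by
    have := (abs_nonneg _).trans (hf.bound 0)
    simpa using this
  have hvint := integrable_integral_of_spaceTime _ h.integrable_velocity
  set w : ℝ → ℝ := fun t => ∫ x, (1 + ‖x‖) * ‖V t x‖ ∂(μ t : Measure (E d)) with hw
  have hwi : IntervalIntegrable w volume 0 1 := by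
    rw [intervalIntegrable_iff_integrableOn_Ioo_of_le zero_le_one]; exact hvint
  have hbound : ∀ {g : E d → ℝ} {A : ℝ}, 0 ≤ A → (∀ x, ‖fderiv ℝ g x‖ ≤ A * (1 + ‖x‖)) →
      ∀ t, ∀ x, ‖fderiv ℝ g x (V t x)‖ ≤ A * ((1 + ‖x‖) * ‖V t x‖) := by
    intro g A hA hg t x
    refine ((fderiv ℝ g x).le_opNorm _).trans ?_
    rw [← mul_assoc]
    gcongr
    exact hg x
  have hgb : ∀ {g : E d → ℝ} {A : ℝ}, 0 ≤ A → (∀ x, ‖fderiv ℝ g x‖ ≤ A * (1 + ‖x‖)) →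
      ∀ᵐ t ∂(volume.restrict (Ioo (0 : ℝ) 1)),
        ‖∫ x, fderiv ℝ g x (V t x) ∂(μ t : Measure (E d))‖ ≤ A * w t := by
    intro g A hA hg
    filter_upwards [h.ae_integrable_velocity] with t ht
    rw [hw, ← integral_const_mul]
    exact norm_integral_le_of_norm_le (ht.const_mul A) (ae_of_all _ (hbound hA hg t))
  have hgi : ∀ {g : E d → ℝ} {A : ℝ}, ContDiff ℝ (⊤ : ℕ∞) g → 0 ≤ A →
      (∀ x, ‖fderiv ℝ g x‖ ≤ A * (1 + ‖x‖)) →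
      IntervalIntegrable (fun t => ∫ x, fderiv ℝ g x (V t x) ∂(μ t : Measure (E d)))
        volume 0 1 := by
    intro g A hgs hA hg
    rw [intervalIntegrable_iff_integrableOn_Ioo_of_le zero_le_one]
    exact (hvint.const_mul A).mono' (aestronglyMeasurable_integral_curve h.ce.weakly_continuous
      (measurable_fderiv_uncurry hgs h.ce.borel)) (hgb hA hg)
  refine IsACWith.of_integral (hgi hf.smooth hA hf.fderiv_bound) fun t ht => ?_
  have hsub : uIcc 0 t ⊆ uIcc 0 1 := by
    rw [uIcc_of_le ht.1, uIcc_of_le zero_le_one]; exact Icc_subset_Icc_right ht.2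
  have hlim : ∀ t ∈ Icc (0 : ℝ) 1, Tendsto (fun n => ∫ x, F n x ∂(μ t : Measure (E d))) atTop
      (𝓝 (∫ x, f x ∂(μ t : Measure (E d)))) := fun t ht => by
    refine tendsto_integral_of_dominated_convergence (fun x => A * (1 + ‖x‖) ^ 2)
      (fun n => (hFs n).continuous.aestronglyMeasurable)
      ((P2.integrable_one_add_sq (h.ce.finite_moment t ht)).const_mul A)
      (fun n => ae_of_all _ fun x => (hFle n x).trans (hf.bound x)) (ae_of_all _ fun x => ?_)
    exact tendsto_const_nhds.congr' ((hFlim x).mono fun n hn => hn.1.symm)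
  have hlim2 : Tendsto (fun n => ∫ s in (0 : ℝ)..t, ∫ x, fderiv ℝ (F n) x (V s x)
      ∂(μ s : Measure (E d))) atTop
      (𝓝 (∫ s in (0 : ℝ)..t, ∫ x, fderiv ℝ f x (V s x) ∂(μ s : Measure (E d)))) := by
    have haesub : ∀ {P : ℝ → Prop}, (∀ᵐ s ∂(volume.restrict (Ioo (0 : ℝ) 1)), P s) →
        ∀ᵐ s, s ∈ uIoc 0 t → P s := by
      intro P hP
      rw [restrict_Ioo_eq_restrict_Ioc, ae_restrict_iff' measurableSet_Ioc] at hP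
      filter_upwards [hP] with s hs hmem
      rw [uIoc_of_le ht.1] at hmem
      exact hs ⟨hmem.1, hmem.2.trans ht.2⟩
    refine intervalIntegral.tendsto_integral_filter_of_dominated_convergence (fun s => A' * w s)
      (Eventually.of_forall fun n => ?_) (Eventually.of_forall fun n => haesub (hgb hA' (hFd n)))
      ((hwi.mono_set hsub).const_mul _) (haesub ?_)
    · exact ((hgi (hFs n) hA' (hFd n)).mono_set hsub).aestronglyMeasurable_restrict_uIoc
    · filter_upwards [h.ae_integrable_velocity] with s hs
      refine tendsto_integral_of_dominated_convergence _
        (fun n => ((measurable_fderiv_uncurry (hFs n) h.ce.borel).comp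
          measurable_prodMk_left).aestronglyMeasurable)
        (hs.const_mul A') (fun n => ae_of_all _ (hbound hA' (hFd n) s)) (ae_of_all _ fun x => ?_)
      exact tendsto_const_nhds.congr' ((hFlim x).mono fun n hn => by simp only [hn.2])
  have heq : ∀ n, ∫ x, F n x ∂(μ t : Measure (E d)) - ∫ x, F n x ∂(μ 0 : Measure (E d))
      = ∫ s in (0 : ℝ)..t, ∫ x, fderiv ℝ (F n) x (V s x) ∂(μ s : Measure (E d)) := fun n =>
    h.ce.integral_sub (hFs n) (hFc n) le_rfl ht.1 ht.2 ((hgi (hFs n) hA' (hFd n)).mono_set hsub)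
  have := tendsto_nhds_unique (((hlim t ht).sub (hlim 0 (by simp))).congr heq) hlim2
  linarith

lemma mean_isACWith (h : IsFlow μ₀ μ₁ μ V) (i : Fin d) :
    IsACWith (fun t => mean (μ t : Measure (E d)) i)
      (fun t => ∫ x, V t x i ∂(μ t : Measure (E d))) := by
  have := h.isACWith_integral (quadGrowth_coord i)
  simp only [fderiv_coord] at this
  exact this.congr fun t ht => (mean_apply (h.ce.finite_moment t ht) i).symm

lemma measurable_coord (h : IsFlow μ₀ μ₁ μ V) (t : ℝ) (i : Fin d) :
    Measurable fun x => V t x i := by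
  have := h.measurable_apply t
  fun_prop

lemma integrable_coord_velocity (h : IsFlow μ₀ μ₁ μ V) {t : ℝ}
    (ht : Integrable (fun x : E d => (1 + ‖x‖) * ‖V t x‖) (μ t : Measure (E d))) (i : Fin d) :
    Integrable (fun x => V t x i) (μ t : Measure (E d)) :=
  integrable_of_velocity_bound ht (h.measurable_coord t i) (A := 1) fun x => by
    rw [one_mul, add_mul, one_mul]
    linarith [abs_coord_le (V t x) i, mul_nonneg (norm_nonneg x) (norm_nonneg (V t x))]

lemma integrable_coord_mul_velocity (h : IsFlow μ₀ μ₁ μ V) {t : ℝ}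
    (ht : Integrable (fun x : E d => (1 + ‖x‖) * ‖V t x‖) (μ t : Measure (E d))) (i j : Fin d) :
    Integrable (fun x : E d => x i * V t x j) (μ t : Measure (E d)) :=
  integrable_of_velocity_bound ht
    ((by fun_prop : Measurable fun x : E d => x i).mul (h.measurable_coord t j)) (A := 1)
    fun x => by
    rw [abs_mul]
    have := mul_le_mul (abs_coord_le x i) (abs_coord_le (V t x) j) (abs_nonneg _) (norm_nonneg _)
    rw [one_mul, add_mul, one_mul]
    linarith [norm_nonneg (V t x)]

lemma cov_isACWith (h : IsFlow μ₀ μ₁ μ V) (i j : Fin d) :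
    IsACWith (fun t => covMat (μ t : Measure (E d)) i j)
      (fun t => ∫ x, ((x i - mean (μ t : Measure (E d)) i) * V t x j
        + (x j - mean (μ t : Measure (E d)) j) * V t x i) ∂(μ t : Measure (E d))) := by
  have h1 := h.isACWith_integral (quadGrowth_coord_mul i j)
  simp only [fderiv_coord_mul] at h1
  have h2 := h1.sub ((h.mean_isACWith i).mul (h.mean_isACWith j))
  refine (h2.congr fun t ht => (covMat_apply (h.ce.finite_moment t ht) i j).symm).congr_deriv ?_
  filter_upwards [h.ae_integrable_velocity] with t ht
  have i1 := h.integrable_coord_mul_velocity ht i j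
  have i2 := h.integrable_coord_mul_velocity ht j i
  have i3 := (h.integrable_coord_velocity ht j).const_mul (mean (μ t : Measure (E d)) i)
  have i4 := (h.integrable_coord_velocity ht i).const_mul (mean (μ t : Measure (E d)) j)
  have i12 : Integrable (fun x : E d => x i * V t x j + x j * V t x i) (μ t : Measure (E d)) :=
    i1.add i2
  have i34 : Integrable (fun x : E d => mean (μ t : Measure (E d)) i * V t x j
      + mean (μ t : Measure (E d)) j * V t x i) (μ t : Measure (E d)) := i3.add i4
  have e : ∀ x : E d, (x i - mean (μ t : Measure (E d)) i) * V t x j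
      + (x j - mean (μ t : Measure (E d)) j) * V t x i
      = (x i * V t x j + x j * V t x i) - (mean (μ t : Measure (E d)) i * V t x j
      + mean (μ t : Measure (E d)) j * V t x i) := fun x => by ring
  simp only [e]
  rw [MeasureTheory.integral_sub i12 i34, integral_add i3 i4, integral_const_mul,
    integral_const_mul]
  ring

/-- Nondegeneracy of the covariance propagates: in each direction the logarithmic derivative of the
variance is integrable. -/
lemma covMat_posDef (h : IsFlow μ₀ μ₁ μ V) (hdir : ∀ p, ∃ β, DirControl μ V p β)
    (h0 : (covMat μ₀).PosDef) {t : ℝ} (ht : t ∈ Icc (0 : ℝ) 1) :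
    (covMat (μ t : Measure (E d))).PosDef := by
  refine posDef_of_inner (covMat_isHermitian _) fun p hp => ?_
  obtain ⟨β, hβ⟩ := hdir p
  set N : ℝ → ℝ := fun t => inner ℝ p (act (covMat (μ t : Measure (E d))) p) with hN
  set D' : ℝ → Fin d → Fin d → ℝ := fun t i j => ∫ x, ((x i - mean (μ t : Measure (E d)) i) * V t x j
        + (x j - mean (μ t : Measure (E d)) j) * V t x i) ∂(μ t : Measure (E d)) with hD'
  have hNac : IsACWith N (fun t => ∑ i, p i * ∑ j, D' t i j * p j) := by
    have := IsACWith.sum Finset.univ fun i _ => (IsACWith.sum Finset.univ fun j _ =>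
      (h.cov_isACWith i j).mul_const (p j)).const_mul (p i)
    refine this.congr fun t _ => ?_
    simp only [hN, inner_eq_sum, act_apply]
  have hNn : ∀ t ∈ Icc (0 : ℝ) 1, 0 ≤ N t := fun t ht =>
    inner_act_covMat_nonneg (h.ce.finite_moment t ht) p
  have hβi : IntegrableOn β (Ioo 0 1) := hβ.memLp.integrable (by norm_num)
  have hβii : IntervalIntegrable β volume 0 1 := by
    rw [intervalIntegrable_iff_integrableOn_Ioo_of_le zero_le_one]; exact hβi
  have hder : ∀ᵐ t ∂(volume.restrict (Ioo (0 : ℝ) 1)),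
      |∑ i, p i * ∑ j, D' t i j * p j| ≤ N t * (2 * β t) := by
    filter_upwards [h.ae_integrable_velocity, hβ.bound, ae_restrict_mem measurableSet_Ioo]
      with t ht hb ht01
    have htI := Ioo_subset_Icc_self ht01
    have hP := h.ce.finite_moment t htI
    set m := mean (μ t : Measure (E d)) with hm
    have i1 : ∀ i j, Integrable (fun x : E d => (x i - m i) * V t x j) (μ t : Measure (E d)) := by
      intro i j
      refine ((h.integrable_coord_mul_velocity ht i j).sub
        ((h.integrable_coord_velocity ht j).const_mul (m i))).congr (ae_of_all _ fun x => ?_)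
      simp only [Pi.sub_apply]
      ring
    have i2 : ∀ i j, Integrable (fun x : E d => (x i - m i) * V t x j + (x j - m j) * V t x i)
        (μ t : Measure (E d)) := fun i j => (i1 i j).add (i1 j i)
    have e1 : ∑ i, p i * ∑ j, D' t i j * p j
        = ∫ x, 2 * (inner ℝ p (x - m) * inner ℝ p (V t x)) ∂(μ t : Measure (E d)) := by
      have : ∀ x : E d, 2 * (inner ℝ p (x - m) * inner ℝ p (V t x))
          = ∑ i, p i * ∑ j, ((x i - m i) * V t x j + (x j - m j) * V t x i) * p j := fun x => by
        have s1 : ∑ i, p i * ∑ j, ((x i - m i) * V t x j) * p j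
            = inner ℝ p (x - m) * inner ℝ p (V t x) := by
          rw [inner_eq_sum, inner_eq_sum, Finset.sum_mul_sum]
          refine Finset.sum_congr rfl fun i _ => ?_
          rw [Finset.mul_sum]
          refine Finset.sum_congr rfl fun j _ => ?_
          simp only [PiLp.sub_apply]
          ring
        have s2 : ∑ i, p i * ∑ j, ((x j - m j) * V t x i) * p j
            = inner ℝ p (x - m) * inner ℝ p (V t x) := by
          rw [inner_eq_sum, inner_eq_sum, mul_comm, Finset.sum_mul_sum]
          refine Finset.sum_congr rfl fun i _ => ?_
          rw [Finset.mul_sum]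
          refine Finset.sum_congr rfl fun j _ => ?_
          simp only [PiLp.sub_apply]
          ring
        simp only [add_mul, Finset.sum_add_distrib, mul_add]
        rw [s1, s2]; ring
      simp only [this]
      rw [integral_finsetSum _ fun i _ => (integrable_finsetSum _ fun j _ =>
        (i2 i j).mul_const (p j)).const_mul (p i)]
      refine Finset.sum_congr rfl fun i _ => ?_
      rw [integral_const_mul, integral_finsetSum _ fun j _ => (i2 i j).mul_const (p j)]
      simp only [integral_mul_const, hD']
      rfl
    -- Cauchy–Schwarz for the derivative `2 ∫ ⟨p, x - m⟩ ⟨p, V⟩` of the variance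
    rw [e1, integral_const_mul, abs_mul, abs_two]
    have hVm : Measurable fun x => inner ℝ p (V t x) :=
      (measurable_inner_uncurry h.ce.borel p).comp measurable_prodMk_left
    have hxm : Measurable fun x : E d => (inner ℝ p (x - m) : ℝ) := by fun_prop
    have b1 : ∫⁻ x, ‖(inner ℝ p (x - m) : ℝ)‖ₑ ^ 2 ∂(μ t : Measure (E d))
        ≤ ENNReal.ofReal (√(N t) ^ 2) := by
      have e : ∀ x : E d, ‖(inner ℝ p (x - m) : ℝ)‖ₑ ^ 2
          = ENNReal.ofReal ((inner ℝ p (x - m)) ^ 2) := fun x => by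
        rw [← enorm_pow, Real.enorm_of_nonneg (sq_nonneg _)]
      simp only [e]
      rw [← ofReal_integral_eq_lintegral_ofReal (integrable_inner_sub_sq hP p m)
        (ae_of_all _ fun x => sq_nonneg _), Real.sq_sqrt (hNn t htI), hN]
      simp only
      rw [inner_act_covMat hP]
    have b2 : ∫⁻ x, ‖(inner ℝ p (V t x) : ℝ)‖ₑ ^ 2 ∂(μ t : Measure (E d))
        ≤ ENNReal.ofReal ((β t * √(N t)) ^ 2) := by
      have e : ∀ x : E d, ‖(inner ℝ p (V t x) : ℝ)‖ₑ ^ 2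
          = ENNReal.ofReal ((inner ℝ p (V t x)) ^ 2) := fun x => by
        rw [← enorm_pow, Real.enorm_of_nonneg (sq_nonneg _)]
      simp only [e]
      rw [mul_pow, Real.sq_sqrt (hNn t htI)]
      exact hb
    have b3 := lintegral_mul_le_of_sq_le hxm.enorm.aemeasurable hVm.enorm.aemeasurable
      (Real.sqrt_nonneg _) (mul_nonneg (hβ.nonneg t) (Real.sqrt_nonneg _)) b1 b2
    have b4 : ‖∫ x, inner ℝ p (x - m) * inner ℝ p (V t x) ∂(μ t : Measure (E d))‖ₑ
        ≤ ENNReal.ofReal (√(N t) * (β t * √(N t))) := by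
      refine (enorm_integral_le_lintegral_enorm _).trans (le_trans (le_of_eq ?_) b3)
      simp only [enorm_mul]
    have hnn : 0 ≤ √(N t) * (β t * √(N t)) :=
      mul_nonneg (Real.sqrt_nonneg _) (mul_nonneg (hβ.nonneg t) (Real.sqrt_nonneg _))
    rw [← ofReal_norm, ENNReal.ofReal_le_ofReal_iff hnn, Real.norm_eq_abs] at b4
    have : √(N t) * (β t * √(N t)) = N t * β t := by
      linear_combination (β t) * Real.mul_self_sqrt (hNn t htI)
    linarith
  refine pos_of_increments (N := N) (α := fun t => 2 * β t) (hβii.const_mul 2)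
    (fun t => by have := hβ.nonneg t; positivity) hNac.continuousOn hNn ?_ ?_ t ht
  · intro a b B ha hab hb hB
    have hsub : Icc a b ⊆ Icc (0 : ℝ) 1 := Icc_subset_Icc ha hb
    rw [← hNac.integral (hsub (left_mem_Icc.mpr hab)) (hsub (right_mem_Icc.mpr hab)),
      ← intervalIntegral.integral_const_mul, ← Real.norm_eq_abs]
    refine intervalIntegral.norm_integral_le_of_norm_le hab ?_
      (((hβii.mono_set (by rw [uIcc_of_le hab, uIcc_of_le zero_le_one]; exact hsub)).const_mul
        2).const_mul B)
    rw [restrict_Ioo_eq_restrict_Ioc, ae_restrict_iff' measurableSet_Ioc] at hder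
    filter_upwards [hder] with t ht hmem
    refine (ht ⟨ha.trans_lt hmem.1, hmem.2.trans hb⟩).trans ?_
    have := hβ.nonneg t
    gcongr
    exact hB t (Ioc_subset_Icc_self hmem)
  · simp only [hN]
    rw [h.ce.start]
    exact PosDef.inner_pos h0 hp

end IsFlow

end

section

/-! ### Test functions depending on time -/

variable {d : ℕ} {μ : ℝ → ProbabilityMeasure (E d)} {μ₀ μ₁ : Measure (E d)} {V : ℝ → E d → E d}

lemma floor_div_mem {n : ℕ} (hn : 0 < n) {s : ℝ} (hs : s ∈ Ioo (0 : ℝ) 1) :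
    (⌊(n : ℝ) * s⌋ : ℝ) / n ∈ Icc (0 : ℝ) 1 ∧ ((⌊(n : ℝ) * s⌋ : ℝ) + 1) / n ∈ Icc (0 : ℝ) 1 := by
  have hn' : (0 : ℝ) < n := by exact_mod_cast hn
  have h0 : (0 : ℝ) ≤ ⌊(n : ℝ) * s⌋ := by
    exact_mod_cast Int.floor_nonneg.mpr (mul_nonneg hn'.le hs.1.le)
  have h1 : (⌊(n : ℝ) * s⌋ : ℝ) + 1 ≤ n := by
    have : ⌊(n : ℝ) * s⌋ < n := Int.floor_lt.mpr (by
      push_cast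
      nlinarith [hs.2])
    exact_mod_cast this
  refine ⟨⟨by positivity, ?_⟩, ⟨by positivity, ?_⟩⟩
  · rw [div_le_one hn']; linarith
  · rw [div_le_one hn']; linarith

lemma tendsto_floor_div (s : ℝ) :
    Tendsto (fun n : ℕ => (⌊(n : ℝ) * s⌋ : ℝ) / n) atTop (𝓝 s) ∧
    Tendsto (fun n : ℕ => ((⌊(n : ℝ) * s⌋ : ℝ) + 1) / n) atTop (𝓝 s) := by
  have h1 : Tendsto (fun n : ℕ => (1 : ℝ) / n) atTop (𝓝 0) := tendsto_one_div_atTop_nhds_zero_nat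
  have h2 : Tendsto (fun n : ℕ => (⌊(n : ℝ) * s⌋ : ℝ) / n) atTop (𝓝 s) := by
    refine tendsto_of_tendsto_of_tendsto_of_le_of_le' (g := fun n : ℕ => s - 1 / n)
      (h := fun _ => s) (by simpa using tendsto_const_nhds.sub h1) tendsto_const_nhds ?_ ?_
    · filter_upwards [eventually_gt_atTop 0] with n hn
      have hn' : (0 : ℝ) < n := by exact_mod_cast hn
      rw [le_div_iff₀ hn', sub_mul, one_div, inv_mul_cancel₀ hn'.ne']
      linarith [Int.sub_one_lt_floor ((n : ℝ) * s)]
    · filter_upwards [eventually_gt_atTop 0] with n hn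
      have hn' : (0 : ℝ) < n := by exact_mod_cast hn
      rw [div_le_iff₀ hn']
      linarith [Int.floor_le ((n : ℝ) * s)]
  refine ⟨h2, ?_⟩
  have := h2.add h1
  simp only [add_zero, ← add_div] at this
  exact this

/-- Integrated continuity equation for observables that are absolutely continuous in time: sum the
increments over a uniform partition, moving first the measure and then the observable, and refine
the partition. -/
lemma IsFlow.integral_sub_time (h : IsFlow μ₀ μ₁ μ V) {Φ Ψ : ℝ → E d → ℝ}
    (hΦ : ∀ t ∈ Icc (0 : ℝ) 1, ContDiff ℝ (⊤ : ℕ∞) (Φ t))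
    (hΦc : ∀ t ∈ Icc (0 : ℝ) 1, HasCompactSupport (Φ t))
    (hfd : Continuous fun z : (ℝ × E d) × E d => fderiv ℝ (Φ z.1.1) z.1.2 z.2) {K : ℝ}
    (hK : ∀ t ∈ Icc (0 : ℝ) 1, ∀ x v, ‖fderiv ℝ (Φ t) x v‖ ≤ K * ‖v‖)
    (hAC : ∀ x, IsACWith (fun t => Φ t x) (fun t => Ψ t x))
    (hΨm : Measurable (Function.uncurry Ψ)) (hΨc : ∀ t, Continuous (Ψ t)) {β : ℝ → ℝ}
    (hβ : IntegrableOn β (Ioo 0 1)) (hΨb : ∀ t ∈ Ioo (0 : ℝ) 1, ∀ x, ‖Ψ t x‖ ≤ β t) :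
    ∫ x, Φ 1 x ∂(μ 1 : Measure (E d)) - ∫ x, Φ 0 x ∂(μ 0 : Measure (E d))
      = ∫ t in Ioo (0 : ℝ) 1, ∫ x, (Ψ t x + fderiv ℝ (Φ t) x (V t x)) ∂(μ t : Measure (E d)) := by
  have hKw : ∀ t ∈ Icc (0 : ℝ) 1, ∀ x v, ‖fderiv ℝ (Φ t) x v‖ ≤ |K| * ((1 + ‖x‖) * ‖v‖) := by
    intro t ht x v
    refine (hK t ht x v).trans ?_
    have : K * ‖v‖ ≤ |K| * ‖v‖ := mul_le_mul_of_nonneg_right (le_abs_self K) (norm_nonneg _)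
    refine this.trans (mul_le_mul_of_nonneg_left ?_ (abs_nonneg _))
    nlinarith [norm_nonneg x, norm_nonneg v, mul_nonneg (norm_nonneg x) (norm_nonneg v)]
  have hvint := integrable_integral_of_spaceTime _ h.integrable_velocity
  set w : ℝ → ℝ := fun t => ∫ x, (1 + ‖x‖) * ‖V t x‖ ∂(μ t : Measure (E d)) with hw
  have hμ := h.ce.weakly_continuous
  -- the end points of the cell of the partition into `n` parts that contains `s`
  set lo : ℕ → ℝ → ℝ := fun n s => (⌊(n : ℝ) * s⌋ : ℝ) / n with hlo
  set up : ℕ → ℝ → ℝ := fun n s => ((⌊(n : ℝ) * s⌋ : ℝ) + 1) / n with hup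
  have hlom : ∀ n, Measurable (lo n) := fun n => by simp only [hlo]; fun_prop
  have hupm : ∀ n, Measurable (up n) := fun n => by simp only [hup]; fun_prop
  set G : ℕ → ℝ → ℝ := fun n s => (∫ x, Ψ s x ∂(μ (up n s) : Measure (E d)))
    + ∫ x, fderiv ℝ (Φ (lo n s)) x (V s x) ∂(μ s : Measure (E d)) with hG
  have hVm : Measurable fun z : ℝ × E d => V z.1 z.2 := h.ce.borel
  have hfm : ∀ n, Measurable fun z : ℝ × E d => fderiv ℝ (Φ (lo n z.1)) z.2 (V z.1 z.2) := fun n =>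
    hfd.measurable.comp ((((hlom n).comp measurable_fst).prodMk measurable_snd).prodMk hVm)
  -- a bound of the integrands uniform in `n`, for dominated convergence
  have hG1 : ∀ n, 0 < n → ∀ s ∈ Ioo (0 : ℝ) 1,
      ‖∫ x, Ψ s x ∂(μ (up n s) : Measure (E d))‖ ≤ β s := by
    intro n hn s hs
    refine (norm_integral_le_of_norm_le_const (ae_of_all _ (hΨb s hs))).trans ?_
    simp
  have hG2 : ∀ n, 0 < n → ∀ᵐ s ∂(volume.restrict (Ioo (0 : ℝ) 1)),
      ‖∫ x, fderiv ℝ (Φ (lo n s)) x (V s x) ∂(μ s : Measure (E d))‖ ≤ |K| * w s := by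
    intro n hn
    filter_upwards [h.ae_integrable_velocity, ae_restrict_mem measurableSet_Ioo] with s hs hs01
    rw [hw, ← integral_const_mul]
    exact norm_integral_le_of_norm_le (hs.const_mul _)
      (ae_of_all _ fun x => hKw _ (floor_div_mem hn hs01).1 x _)
  have hm1 : ∀ n, 0 < n → AEStronglyMeasurable (fun s => ∫ x, Ψ s x ∂(μ (up n s) : Measure (E d)))
      (volume.restrict (Ioo (0 : ℝ) 1)) := by
    intro n hn
    refine ⟨fun s => ∫ x, Ψ s x ∂((curveKernel μ hμ).comap (up n) (hupm n) s),
      hΨm.stronglyMeasurable.integral_kernel_prod_right', ?_⟩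
    filter_upwards [ae_restrict_mem measurableSet_Ioo] with s hs
    rw [Kernel.comap_apply, curveKernel_of_mem hμ (floor_div_mem hn hs).2]
  have hm2 : ∀ n, AEStronglyMeasurable
      (fun s => ∫ x, fderiv ℝ (Φ (lo n s)) x (V s x) ∂(μ s : Measure (E d)))
      (volume.restrict (Ioo (0 : ℝ) 1)) := fun n => aestronglyMeasurable_integral_curve hμ (hfm n)
  have hi1 : ∀ n, 0 < n → IntegrableOn (fun s => ∫ x, Ψ s x ∂(μ (up n s) : Measure (E d)))
      (Ioo 0 1) := fun n hn => hβ.mono' (hm1 n hn) (by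
    filter_upwards [ae_restrict_mem measurableSet_Ioo] with s hs using hG1 n hn s hs)
  have hi2 : ∀ n, 0 < n → IntegrableOn
      (fun s => ∫ x, fderiv ℝ (Φ (lo n s)) x (V s x) ∂(μ s : Measure (E d))) (Ioo 0 1) :=
    fun n hn => (hvint.const_mul |K|).mono' (hm2 n) (hG2 n hn)
  have hGi : ∀ n, 0 < n → IntegrableOn (G n) (Ioo 0 1) := fun n hn => (hi1 n hn).add (hi2 n hn)
  -- over one cell: first move the measure with `Φ a` fixed, then the observable with `μ b` fixed
  have hcell : ∀ (a b : ℝ), 0 ≤ a → a ≤ b → b ≤ 1 →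
      ∫ x, Φ b x ∂(μ b : Measure (E d)) - ∫ x, Φ a x ∂(μ a : Measure (E d))
      = ∫ s in a..b, ((∫ x, Ψ s x ∂(μ b : Measure (E d)))
        + ∫ x, fderiv ℝ (Φ a) x (V s x) ∂(μ s : Measure (E d))) := by
    intro a b ha hab hb
    have haI : a ∈ Icc (0 : ℝ) 1 := ⟨ha, hab.trans hb⟩
    have hbI : b ∈ Icc (0 : ℝ) 1 := ⟨ha.trans hab, hb⟩
    have hsub : Ioo a b ⊆ Ioo (0 : ℝ) 1 := Ioo_subset_Ioo ha hb
    have hΦi : ∀ t ∈ Icc (0 : ℝ) 1, ∀ s : ℝ, Integrable (Φ t) (μ s : Measure (E d)) := by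
      intro t ht s
      obtain ⟨C, hC⟩ := (hΦ t ht).continuous.bounded_above_of_compact_support (hΦc t ht)
      exact Integrable.of_bound (hΦ t ht).continuous.aestronglyMeasurable C (ae_of_all _ hC)
    have j2 : IntervalIntegrable (fun s => ∫ x, fderiv ℝ (Φ a) x (V s x) ∂(μ s : Measure (E d)))
        volume a b := by
      rw [intervalIntegrable_iff_integrableOn_Ioo_of_le hab]
      refine ((hvint.mono_set hsub).const_mul |K|).mono'
        ((aestronglyMeasurable_integral_curve hμ (measurable_fderiv_uncurry (hΦ a haI)
          h.ce.borel)).mono_measure (Measure.restrict_mono hsub le_rfl)) ?_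
      filter_upwards [ae_restrict_of_ae_restrict_of_subset hsub h.ae_integrable_velocity] with s hs
      rw [hw, ← integral_const_mul]
      exact norm_integral_le_of_norm_le (hs.const_mul _) (ae_of_all _ fun x => hKw _ haI x _)
    have hprod : Integrable (Function.uncurry Ψ)
        ((volume.restrict (Ioo a b)).prod (μ b : Measure (E d))) := by
      have hb1 : Integrable (fun z : ℝ × E d => β z.1)
          ((volume.restrict (Ioo a b)).prod (μ b : Measure (E d))) :=
        (hβ.mono_set hsub).comp_fst (ν := (μ b : Measure (E d)))
      refine hb1.mono' hΨm.aestronglyMeasurable ?_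
      have : ∀ᵐ z ∂((volume.restrict (Ioo a b)).prod (μ b : Measure (E d))), z.1 ∈ Ioo a b :=
        Measure.quasiMeasurePreserving_fst.ae (ae_restrict_mem measurableSet_Ioo)
      filter_upwards [this] with z hz
      exact hΨb z.1 (hsub hz) z.2
    have j1 : IntervalIntegrable (fun s => ∫ x, Ψ s x ∂(μ b : Measure (E d))) volume a b := by
      rw [intervalIntegrable_iff_integrableOn_Ioo_of_le hab]
      exact hprod.integral_prod_left
    rw [intervalIntegral.integral_add j1 j2,
      ← h.ce.integral_sub (hΦ a haI) (hΦc a haI) ha hab hb j2]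
    have : ∫ s in a..b, ∫ x, Ψ s x ∂(μ b : Measure (E d))
        = ∫ x, (Φ b x - Φ a x) ∂(μ b : Measure (E d)) := by
      rw [intervalIntegral.integral_of_le hab, integral_Ioc_eq_integral_Ioo,
        integral_integral_swap hprod]
      refine integral_congr_ae (ae_of_all _ fun x => ?_)
      simp only
      rw [← (hAC x).integral haI hbI, intervalIntegral.integral_of_le hab,
        integral_Ioc_eq_integral_Ioo]
    rw [this, integral_sub (hΦi b hbI b) (hΦi a haI b)]
    ring
  -- sum over the cells
  have htel : ∀ n : ℕ, 0 < n →
      ∫ x, Φ 1 x ∂(μ 1 : Measure (E d)) - ∫ x, Φ 0 x ∂(μ 0 : Measure (E d))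
      = ∫ s in Ioo (0 : ℝ) 1, G n s := by
    intro n hn
    have hn' : (0 : ℝ) < n := by exact_mod_cast hn
    have hmem : ∀ i ≤ n, (i : ℝ) / n ∈ Icc (0 : ℝ) 1 := fun i hi =>
      ⟨by positivity, by rw [div_le_one hn']; exact_mod_cast hi⟩
    have hGii : IntervalIntegrable (G n) volume 0 1 := by
      rw [intervalIntegrable_iff_integrableOn_Ioo_of_le zero_le_one]; exact hGi n hn
    have hmono : ∀ i : ℕ, (i : ℝ) / n ≤ ((i + 1 : ℕ) : ℝ) / n := fun i => by
      gcongr; exact_mod_cast Nat.le_succ i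
    have h1 : ∀ i < n, ∫ x, Φ (((i + 1 : ℕ) : ℝ) / n) x ∂(μ (((i + 1 : ℕ) : ℝ) / n) : Measure (E d))
        - ∫ x, Φ ((i : ℝ) / n) x ∂(μ ((i : ℝ) / n) : Measure (E d))
        = ∫ s in ((i : ℝ) / n)..(((i + 1 : ℕ) : ℝ) / n), G n s := by
      intro i hi
      rw [hcell _ _ (hmem i hi.le).1 (hmono i) (hmem (i + 1) hi).2,
        intervalIntegral.integral_of_le (hmono i), intervalIntegral.integral_of_le (hmono i),
        integral_Ioc_eq_integral_Ioo, integral_Ioc_eq_integral_Ioo]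
      refine setIntegral_congr_fun measurableSet_Ioo fun s hs => ?_
      have hfl : ⌊(n : ℝ) * s⌋ = i := by
        rw [Int.floor_eq_iff]
        have h1 := hs.1
        have h2 := hs.2
        rw [div_lt_iff₀ hn'] at h1
        rw [lt_div_iff₀ hn'] at h2
        push_cast at h2 ⊢
        constructor <;> linarith
      simp only [hG, hlo, hup, hfl]
      push_cast
      rfl
    have h2 := intervalIntegral.sum_integral_adjacent_intervals (f := G n) (μ := volume)
      (a := fun i : ℕ => (i : ℝ) / n) (n := n) fun i hi => hGii.mono_set (by
        rw [uIcc_of_le zero_le_one]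
        exact uIcc_subset_Icc (hmem i hi.le) (hmem (i + 1) hi))
    have h3 := Finset.sum_range_sub
      (fun i : ℕ => ∫ x, Φ ((i : ℝ) / n) x ∂(μ ((i : ℝ) / n) : Measure (E d))) n
    rw [Finset.sum_congr rfl fun i hi => h1 i (Finset.mem_range.mp hi), h2] at h3
    simp only [Nat.cast_zero, zero_div, div_self hn'.ne'] at h3
    rw [← h3, intervalIntegral.integral_of_le zero_le_one, integral_Ioc_eq_integral_Ioo]
  -- both end points of the cell of `s` tend to `s`
  have hlim : Tendsto (fun n : ℕ => ∫ s in Ioo (0 : ℝ) 1, G (n + 1) s) atTop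
      (𝓝 (∫ t in Ioo (0 : ℝ) 1, ∫ x, (Ψ t x + fderiv ℝ (Φ t) x (V t x))
        ∂(μ t : Measure (E d)))) := by
    refine tendsto_integral_of_dominated_convergence (fun s => β s + |K| * w s)
      (fun n => (hGi (n + 1) n.succ_pos).aestronglyMeasurable) (hβ.add (hvint.const_mul _))
      (fun n => ?_) ?_
    · filter_upwards [hG2 (n + 1) n.succ_pos, ae_restrict_mem measurableSet_Ioo] with s hs hs01
      exact (norm_add_le _ _).trans (add_le_add (hG1 (n + 1) n.succ_pos s hs01) hs)
    · filter_upwards [h.ae_integrable_velocity, ae_restrict_mem measurableSet_Ioo] with s hs hs01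
      have hsI := Ioo_subset_Icc_self hs01
      have l1 : Tendsto (fun n : ℕ => ∫ x, Ψ s x ∂(μ (up (n + 1) s) : Measure (E d))) atTop
          (𝓝 (∫ x, Ψ s x ∂(μ s : Measure (E d)))) := by
        refine (continuousOn_integral hμ (hΨc s) (hΨb s hs01) s hsI).tendsto.comp ?_
        refine tendsto_nhdsWithin_iff.mpr
          ⟨(tendsto_floor_div s).2.comp (tendsto_add_atTop_nat 1), ?_⟩
        exact Eventually.of_forall fun n => (floor_div_mem n.succ_pos hs01).2
      have l2 : Tendsto (fun n : ℕ => ∫ x, fderiv ℝ (Φ (lo (n + 1) s)) x (V s x)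
          ∂(μ s : Measure (E d))) atTop
          (𝓝 (∫ x, fderiv ℝ (Φ s) x (V s x) ∂(μ s : Measure (E d)))) := by
        refine tendsto_integral_of_dominated_convergence _
          (fun n => ((hfm (n + 1)).comp measurable_prodMk_left).aestronglyMeasurable)
          (hs.const_mul |K|) (fun n => ae_of_all _ fun x =>
            hKw _ (floor_div_mem n.succ_pos hs01).1 x _) (ae_of_all _ fun x => ?_)
        have hc : Continuous fun t : ℝ => fderiv ℝ (Φ t) x (V s x) :=
          hfd.comp ((continuous_id.prodMk continuous_const).prodMk continuous_const)
        exact (hc.tendsto s).comp ((tendsto_floor_div s).1.comp (tendsto_add_atTop_nat 1))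
      have hi : ∫ x, (Ψ s x + fderiv ℝ (Φ s) x (V s x)) ∂(μ s : Measure (E d))
          = (∫ x, Ψ s x ∂(μ s : Measure (E d)))
            + ∫ x, fderiv ℝ (Φ s) x (V s x) ∂(μ s : Measure (E d)) := by
        refine integral_add (Integrable.of_bound (hΨc s).aestronglyMeasurable _
          (ae_of_all _ (hΨb s hs01))) ((hs.const_mul |K|).mono' ?_ (ae_of_all _ fun x =>
            hKw _ hsI x _))
        exact ((measurable_fderiv_uncurry (hΦ s hsI) h.ce.borel).comp
          measurable_prodMk_left).aestronglyMeasurable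
      rw [hi]
      exact l1.add l2
  refine tendsto_nhds_unique ?_ hlim
  exact tendsto_const_nhds.congr fun n => htel (n + 1) n.succ_pos

end

section

/-! ### Absolutely continuous curves in Euclidean space -/

variable {d : ℕ}

lemma norm_le_sum_abs (x : E d) : ‖x‖ ≤ ∑ i, |x i| := by
  have h : x = ∑ i, x i • EuclideanSpace.single i (1 : ℝ) := by
    ext j
    simp [Finset.sum_apply, Pi.single_apply]
  conv_lhs => rw [h]
  refine (norm_sum_le _ _).trans (Finset.sum_le_sum fun i _ => ?_)
  simp [norm_smul]

/-- A bound for the operator norm of a matrix. -/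
def entryNorm (A : Matrix (Fin d) (Fin d) ℝ) : ℝ := ∑ i, ∑ j, |A i j|

lemma entryNorm_nonneg (A : Matrix (Fin d) (Fin d) ℝ) : 0 ≤ entryNorm A :=
  Finset.sum_nonneg fun _ _ => Finset.sum_nonneg fun _ _ => abs_nonneg _

lemma norm_act_le (A : Matrix (Fin d) (Fin d) ℝ) (x : E d) : ‖act A x‖ ≤ entryNorm A * ‖x‖ := by
  refine (norm_le_sum_abs _).trans ?_
  rw [entryNorm, Finset.sum_mul]
  refine Finset.sum_le_sum fun i _ => ?_
  rw [act_apply, Finset.sum_mul]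
  refine (Finset.abs_sum_le_sum_abs _ _).trans (Finset.sum_le_sum fun j _ => ?_)
  rw [abs_mul]
  exact mul_le_mul_of_nonneg_left (abs_coord_le x j) (abs_nonneg _)

lemma act_eq (A : Matrix (Fin d) (Fin d) ℝ) (x : E d) :
    act A x = WithLp.toLp 2 (A *ᵥ (WithLp.ofLp x)) := by
  ext i
  simp [act_apply, Matrix.mulVec, dotProduct]

lemma act_mul (A B : Matrix (Fin d) (Fin d) ℝ) (x : E d) : act (A * B) x = act A (act B x) := by
  simp [act_eq, Matrix.mulVec_mulVec]

lemma act_one (x : E d) : act 1 x = x := by simp [act_eq]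

lemma act_add (A : Matrix (Fin d) (Fin d) ℝ) (x y : E d) : act A (x + y) = act A x + act A y :=
  map_add _ _ _

lemma act_sub (A : Matrix (Fin d) (Fin d) ℝ) (x y : E d) : act A (x - y) = act A x - act A y :=
  map_sub _ _ _

lemma act_neg (A : Matrix (Fin d) (Fin d) ℝ) (x : E d) : act A (-x) = -act A x := map_neg _ _

lemma continuous_act_comp {X : Type*} [TopologicalSpace X] {A : X → Matrix (Fin d) (Fin d) ℝ}
    {f : X → E d} (hA : Continuous A) (hf : Continuous f) : Continuous fun z => act (A z) (f z) := by
  simp only [act_eq]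
  exact (PiLp.continuous_toLp 2 _).comp (hA.matrix_mulVec ((PiLp.continuous_ofLp 2 _).comp hf))

lemma continuous_act (A : Matrix (Fin d) (Fin d) ℝ) : Continuous (act A) :=
  continuous_act_comp continuous_const continuous_id

lemma measurable_act_comp {X : Type*} [MeasurableSpace X] {A : X → Matrix (Fin d) (Fin d) ℝ}
    {f : X → E d} (hA : ∀ i j, Measurable fun z => A z i j) (hf : Measurable f) :
    Measurable fun z => act (A z) (f z) := by
  have : Measurable fun z => WithLp.toLp 2 fun i => ∑ j, A z i j * f z j := by
    refine (PiLp.continuous_toLp 2 _).measurable.comp (measurable_pi_lambda _ fun i => ?_)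
    refine Finset.measurable_sum _ fun j _ => (hA i j).mul ?_
    fun_prop
  convert this using 2 with z
  ext i
  simp [act_apply]

/-- The linear action as a continuous linear map. -/
def actL (A : Matrix (Fin d) (Fin d) ℝ) : E d →L[ℝ] E d :=
  LinearMap.toContinuousLinearMap (Matrix.toEuclideanLin A)

lemma actL_apply (A : Matrix (Fin d) (Fin d) ℝ) (x : E d) : actL A x = act A x := rfl

lemma _root_.AbsolutelyContinuousOnInterval.of_dist_le {X ι : Type*} [PseudoMetricSpace X]
    {Y : Type*} [PseudoMetricSpace Y] (s : Finset ι) {f : ι → ℝ → Y} {F : ℝ → X} {a b K : ℝ}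
    (hf : ∀ i ∈ s, AbsolutelyContinuousOnInterval (f i) a b)
    (h : ∀ x y, dist (F x) (F y) ≤ K * ∑ i ∈ s, dist (f i x) (f i y)) :
    AbsolutelyContinuousOnInterval F a b := by
  have hlim := (tendsto_finsetSum s hf).const_mul K
  simp only [Finset.sum_const_zero, mul_zero] at hlim
  refine squeeze_zero (fun t => Finset.sum_nonneg fun i _ => dist_nonneg) (fun t => ?_) hlim
  rw [Finset.sum_comm, Finset.mul_sum]
  exact Finset.sum_le_sum fun i _ => h _ _

lemma hasDerivAt_euclidean {y : ℝ → E d} {y' : E d} {t : ℝ}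
    (h : ∀ i, HasDerivAt (fun s => y s i) (y' i) t) : HasDerivAt y y' t := by
  have h1 : HasDerivAt (fun s => WithLp.ofLp (y s)) (WithLp.ofLp y') t := hasDerivAt_pi.mpr h
  exact (PiLp.continuousLinearEquiv 2 ℝ (fun _ : Fin d => ℝ)).symm.toContinuousLinearMap.hasFDerivAt.comp_hasDerivAt t h1

/-- The chain rule along an absolutely continuous curve. -/
lemma isACWith_comp {φ : ℝ × E d → ℝ} (hφ : ContDiff ℝ (⊤ : ℕ∞) φ) (hφc : HasCompactSupport φ)
    {y y' : ℝ → E d} (hy : ∀ i, IsACWith (fun t => y t i) (fun t => y' t i)) :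
    IsACWith (fun t => φ (t, y t)) (fun t => fderiv ℝ φ (t, y t) (1, y' t)) := by
  obtain ⟨C, hC⟩ := ContDiff.lipschitzWith_of_hasCompactSupport hφc hφ (by simp)
  constructor
  · refine AbsolutelyContinuousOnInterval.of_dist_le (Finset.univ : Finset (Option (Fin d)))
      (f := fun i t => i.elim t fun i => y t i) (K := C) ?_ fun a b => ?_
    · rintro (_ | i) -
      · exact (LipschitzWith.id.lipschitzOnWith).absolutelyContinuousOnInterval
      · exact (hy i).ac
    · refine (hC.dist_le_mul _ _).trans (mul_le_mul_of_nonneg_left ?_ C.2)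
      rw [Fintype.sum_option, Prod.dist_eq]
      simp only [Option.elim]
      have h1 : dist (y a) (y b) ≤ ∑ i, dist (y a i) (y b i) := by
        rw [dist_eq_norm]
        exact norm_le_sum_abs _
      have h2 : 0 ≤ ∑ i, dist (y a i) (y b i) := Finset.sum_nonneg fun _ _ => dist_nonneg
      exact max_le (by linarith) (by linarith [dist_nonneg (x := a) (y := b)])
  · have hall : ∀ᵐ t ∂(volume.restrict (Ioo (0 : ℝ) 1)),
        ∀ i, HasDerivAt (fun s => y s i) (y' t i) t := ae_all_iff.mpr fun i => (hy i).hasDerivAt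
    filter_upwards [hall] with t ht
    have h1 := ((hasDerivAt_id t).prodMk (hasDerivAt_euclidean ht))
    exact ((hφ.differentiable (by simp) (t, y t)).hasFDerivAt).comp_hasDerivAt t h1

/-! ### Affine images of measures -/

lemma memLp_affine {ν : Measure (E d)} (hν : ν ∈ P2 d) (A : Matrix (Fin d) (Fin d) ℝ) (q : E d) :
    MemLp (fun x => act A x + q) 2 ν := by
  have := hν.1
  refine MemLp.add ?_ (memLp_const q)
  exact hν.2.of_le_mul (continuous_act A).aestronglyMeasurable (ae_of_all _ (norm_act_le A))

lemma continuous_affine (A : Matrix (Fin d) (Fin d) ℝ) (q : E d) :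
    Continuous fun x => act A x + q := (continuous_act A).add continuous_const

lemma P2_map {ν : Measure (E d)} (hν : ν ∈ P2 d) (A : Matrix (Fin d) (Fin d) ℝ) (q : E d) :
    ν.map (fun x => act A x + q) ∈ P2 d := by
  have := hν.1
  have hm : AEMeasurable (fun x => act A x + q) ν := (continuous_affine A q).measurable.aemeasurable
  refine ⟨Measure.isProbabilityMeasure_map hm, ?_⟩
  rw [memLp_map_measure_iff (by fun_prop) hm]
  exact memLp_affine hν A q

lemma mean_map {ν : Measure (E d)} (hν : ν ∈ P2 d) (A : Matrix (Fin d) (Fin d) ℝ) (q : E d) :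
    mean (ν.map fun x => act A x + q) = act A (mean ν) + q := by
  have := hν.1
  have hi : Integrable (fun x => act A x) ν := (actL A).integrable_comp (P2.integrable_id hν)
  have hc : ∫ x, act A x ∂ν = act A (mean ν) := (actL A).integral_comp_comm (P2.integrable_id hν)
  rw [mean, integral_map (continuous_affine A q).measurable.aemeasurable (by fun_prop),
    integral_add hi (integrable_const _), hc]
  simp

lemma covMat_map {ν : Measure (E d)} (hν : ν ∈ P2 d) (A : Matrix (Fin d) (Fin d) ℝ) (q : E d) :
    covMat (ν.map fun x => act A x + q) = A * covMat ν * Aᵀ := by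
  have := hν.1
  ext i j
  have hi : ∀ k l, Integrable (fun x : E d => (x k - mean ν k) * (x l - mean ν l)) ν := by
    intro k l
    have h : Integrable (fun x : E d => x k * x l - mean ν l * x k - mean ν k * x l
        + mean ν k * mean ν l) ν :=
      (((P2.integrable_coord_mul hν k l).sub ((P2.integrable_coord hν k).const_mul (mean ν l))).sub
        ((P2.integrable_coord hν l).const_mul (mean ν k))).add (integrable_const _)
    refine h.congr (ae_of_all _ fun x => ?_)
    ring
  simp only [covMat, Matrix.of_apply, mean_map hν]
  rw [integral_map (continuous_affine A q).measurable.aemeasurable (by fun_prop)]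
  have e : ∀ x : E d, ((act A x + q) i - (act A (mean ν) + q) i)
      * ((act A x + q) j - (act A (mean ν) + q) j)
      = ∑ k, ∑ l, A i k * A j l * ((x k - mean ν k) * (x l - mean ν l)) := fun x => by
    have e1 : ∀ i, (act A x + q) i - (act A (mean ν) + q) i = ∑ k, A i k * (x k - mean ν k) := by
      intro i
      simp only [PiLp.add_apply, act_apply, mul_sub, Finset.sum_sub_distrib]
      ring
    rw [e1, e1, Finset.sum_mul_sum]
    refine Finset.sum_congr rfl fun k _ => Finset.sum_congr rfl fun l _ => ?_
    ring
  simp only [e]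
  rw [integral_finsetSum _ fun k _ => integrable_finsetSum _ fun l _ => (hi k l).const_mul _]
  simp only [Matrix.mul_apply, Matrix.transpose_apply, Finset.sum_mul]
  refine Eq.trans (Finset.sum_congr rfl fun k _ => ?_) Finset.sum_comm
  rw [integral_finsetSum _ fun l _ => (hi k l).const_mul _]
  refine Finset.sum_congr rfl fun l _ => ?_
  rw [integral_const_mul]
  simp only [Matrix.of_apply]
  ring

/-! ### Affine images of curves of measures -/

/-- An absolutely continuous curve of invertible affine maps `x ↦ Pₜ x + qₜ`, together with the
inverse `Qₜ` of the linear part and the time derivatives of `P` and `q`. -/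
structure AffineCurve (d : ℕ) where
  P : ℝ → Matrix (Fin d) (Fin d) ℝ
  Q : ℝ → Matrix (Fin d) (Fin d) ℝ
  P' : ℝ → Matrix (Fin d) (Fin d) ℝ
  q : ℝ → E d
  q' : ℝ → E d
  continuous_P : Continuous P
  continuous_Q : Continuous Q
  continuous_q : Continuous q
  measurable_P' : ∀ i j, Measurable fun t => P' t i j
  measurable_q' : Measurable q'
  ac_P : ∀ i j, IsACWith (fun t => P t i j) (fun t => P' t i j)
  ac_q : ∀ i, IsACWith (fun t => q t i) (fun t => q' t i)
  mul_eq_one : ∀ t, P t * Q t = 1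

namespace AffineCurve

variable (X : AffineCurve d)

/-- The affine map at time `t`. -/
def map (t : ℝ) (x : E d) : E d := act (X.P t) x + X.q t

/-- The inverse of the affine map at time `t`. -/
def inv (t : ℝ) (y : E d) : E d := act (X.Q t) (y - X.q t)

lemma inv_map (t : ℝ) (x : E d) : X.inv t (X.map t x) = x := by
  rw [inv, map, add_sub_cancel_right, ← act_mul, mul_eq_one_comm.mp (X.mul_eq_one t), act_one]

lemma map_inv (t : ℝ) (y : E d) : X.map t (X.inv t y) = y := by
  rw [inv, map, ← act_mul, X.mul_eq_one t, act_one, sub_add_cancel]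

lemma continuous_map_uncurry : Continuous fun z : ℝ × E d => X.map z.1 z.2 :=
  (continuous_act_comp (X.continuous_P.comp continuous_fst) continuous_snd).add
    (X.continuous_q.comp continuous_fst)

lemma continuous_map (t : ℝ) : Continuous (X.map t) := continuous_affine _ _

lemma continuous_inv_uncurry : Continuous fun z : ℝ × E d => X.inv z.1 z.2 :=
  continuous_act_comp (X.continuous_Q.comp continuous_fst)
    (continuous_snd.sub (X.continuous_q.comp continuous_fst))

/-- The velocity field transported along a curve of affine maps, in the coordinates before the
map. -/
def drift (V : ℝ → E d → E d) (t : ℝ) (x : E d) : E d :=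
  X.q' t + act (X.P' t) x + act (X.P t) (V t x)

/-- The velocity field transported along a curve of affine maps. -/
def pushVelocity (V : ℝ → E d → E d) (t : ℝ) (y : E d) : E d := X.drift V t (X.inv t y)

/-- The image of a curve of measures under a curve of affine maps. -/
def pushMeasure (μ : ℝ → ProbabilityMeasure (E d)) (t : ℝ) : ProbabilityMeasure (E d) :=
  (μ t).map (X.continuous_map t).measurable.aemeasurable

variable {μ : ℝ → ProbabilityMeasure (E d)} {μ₀ μ₁ : Measure (E d)} {V : ℝ → E d → E d}

lemma pushVelocity_map (V : ℝ → E d → E d) (t : ℝ) (x : E d) :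
    X.pushVelocity V t (X.map t x) = X.drift V t x := by
  rw [pushVelocity, inv_map]

lemma coe_pushMeasure (μ : ℝ → ProbabilityMeasure (E d)) (t : ℝ) :
    (X.pushMeasure μ t : Measure (E d)) = (μ t : Measure (E d)).map (X.map t) := rfl

lemma measurable_drift (hV : Measurable (Function.uncurry V)) :
    Measurable (Function.uncurry (X.drift V)) := by
  have h1 : Measurable fun z : ℝ × E d => X.q' z.1 := X.measurable_q'.comp measurable_fst
  have h2 : Measurable fun z : ℝ × E d => act (X.P' z.1) z.2 :=
    measurable_act_comp (fun i j => (X.measurable_P' i j).comp measurable_fst) measurable_snd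
  have h3 : Measurable fun z : ℝ × E d => act (X.P z.1) (V z.1 z.2) :=
    measurable_act_comp (fun i j => ((X.continuous_P.matrix_elem i j).measurable).comp
      measurable_fst) hV
  exact (h1.add h2).add h3

lemma measurable_pushVelocity (hV : Measurable (Function.uncurry V)) :
    Measurable (Function.uncurry (X.pushVelocity V)) := by
  have h1 : Measurable fun z : ℝ × E d => (z.1, X.inv z.1 z.2) :=
    measurable_fst.prodMk X.continuous_inv_uncurry.measurable
  have h2 : Function.uncurry (X.pushVelocity V)
      = Function.uncurry (X.drift V) ∘ fun z : ℝ × E d => (z.1, X.inv z.1 z.2) := rfl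
  rw [h2]
  exact (X.measurable_drift hV).comp h1

lemma integral_push {f : E d → ℝ} (hf : Measurable f) (t : ℝ) :
    ∫ y, f y ∂(X.pushMeasure μ t : Measure (E d)) = ∫ x, f (X.map t x) ∂(μ t : Measure (E d)) := by
  rw [coe_pushMeasure, integral_map (X.continuous_map t).measurable.aemeasurable
    hf.aestronglyMeasurable]

lemma lintegral_push {f : E d → ℝ≥0∞} (hf : Measurable f) (t : ℝ) :
    ∫⁻ y, f y ∂(X.pushMeasure μ t : Measure (E d))
      = ∫⁻ x, f (X.map t x) ∂(μ t : Measure (E d)) := by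
  rw [coe_pushMeasure, lintegral_map hf (X.continuous_map t).measurable]

lemma continuousOn_pushMeasure (hμ : ContinuousOn μ (Icc 0 1)) :
    ContinuousOn (X.pushMeasure μ) (Icc 0 1) := by
  have h1 : ContinuousOn (fun t : ℝ => ((diracProba t).prod (μ t)).map
      X.continuous_map_uncurry.measurable.aemeasurable) (Icc 0 1) :=
    (ProbabilityMeasure.continuous_map X.continuous_map_uncurry).comp_continuousOn
      (ProbabilityMeasure.continuous_prod.comp_continuousOn
        (continuous_diracProba.continuousOn.prodMk hμ))
  refine h1.congr fun t _ => ?_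
  apply Subtype.ext
  change (μ t : Measure (E d)).map (X.map t)
    = ((Measure.dirac t).prod (μ t : Measure (E d))).map fun z : ℝ × E d => X.map z.1 z.2
  rw [Measure.dirac_prod, Measure.map_map X.continuous_map_uncurry.measurable
    measurable_prodMk_left]
  rfl

/-- On `[0,1]` the affine maps have uniformly bounded coefficients. -/
lemma exists_bound : ∃ c : ℝ, 1 ≤ c ∧ ∀ t ∈ Icc (0 : ℝ) 1,
    entryNorm (X.P t) ≤ c ∧ entryNorm (X.Q t) ≤ c ∧ ‖X.q t‖ ≤ c
      ∧ ∀ x, 1 + ‖X.map t x‖ ≤ c * (1 + ‖x‖) := by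
  have hc : ∀ {A : ℝ → Matrix (Fin d) (Fin d) ℝ}, Continuous A →
      Continuous fun t => entryNorm (A t) := fun hA =>
    continuous_finsetSum _ fun i _ => continuous_finsetSum _ fun j _ => (hA.matrix_elem i j).abs
  obtain ⟨a, ha⟩ := (isCompact_Icc (a := (0 : ℝ)) (b := 1)).exists_bound_of_continuousOn
    (((hc X.continuous_P).add (hc X.continuous_Q)).add X.continuous_q.norm).continuousOn
  refine ⟨1 + a, ?_, fun t ht => ?_⟩
  · have := (norm_nonneg _).trans (ha 0 (by simp))
    linarith
  have h : entryNorm (X.P t) + entryNorm (X.Q t) + ‖X.q t‖ ≤ a :=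
    (le_abs_self _).trans (ha t ht)
  have h1 := entryNorm_nonneg (X.P t)
  have h2 := entryNorm_nonneg (X.Q t)
  have h3 := norm_nonneg (X.q t)
  refine ⟨by linarith, by linarith, by linarith, fun x => ?_⟩
  have h4 : ‖X.map t x‖ ≤ entryNorm (X.P t) * ‖x‖ + ‖X.q t‖ :=
    (norm_add_le _ _).trans (by gcongr; exact norm_act_le _ _)
  have h5 : entryNorm (X.P t) * ‖x‖ ≤ a * ‖x‖ :=
    mul_le_mul_of_nonneg_right (by linarith) (norm_nonneg x)
  nlinarith [norm_nonneg x]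

/-- A bound for the coefficients of the drift. -/
def speed (t : ℝ) : ℝ := ∑ i, |X.q' t i| + entryNorm (X.P' t)

lemma speed_nonneg (t : ℝ) : 0 ≤ X.speed t :=
  add_nonneg (Finset.sum_nonneg fun _ _ => abs_nonneg _) (entryNorm_nonneg _)

lemma integrableOn_speed : IntegrableOn X.speed (Ioo 0 1) := by
  refine (integrable_finsetSum _ fun i _ => (X.ac_q i).integrableOn.abs).add ?_
  exact integrable_finsetSum _ fun i _ => integrable_finsetSum _ fun j _ =>
    (X.ac_P i j).integrableOn.abs

lemma norm_drift_zero_le (t : ℝ) (x : E d) :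
    ‖X.q' t + act (X.P' t) x‖ ≤ X.speed t * (1 + ‖x‖) := by
  have h1 := norm_add_le (X.q' t) (act (X.P' t) x)
  have h2 := norm_le_sum_abs (X.q' t)
  have h3 := norm_act_le (X.P' t) x
  have h4 : 0 ≤ ∑ i, |X.q' t i| := Finset.sum_nonneg fun _ _ => abs_nonneg _
  have h5 := entryNorm_nonneg (X.P' t)
  rw [speed]
  nlinarith [norm_nonneg x, mul_nonneg h4 (norm_nonneg x)]

lemma moment_push (h : IsFlow μ₀ μ₁ μ V) : ∃ B, ∀ t ∈ Icc (0 : ℝ) 1,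
    ∫ y, (1 + ‖y‖ ^ 2) ∂(X.pushMeasure μ t : Measure (E d)) ≤ B := by
  obtain ⟨c, hc1, hc⟩ := X.exists_bound
  obtain ⟨B, hB⟩ := h.moment
  refine ⟨2 * c ^ 2 * B, fun t ht => ?_⟩
  have hP := h.ce.finite_moment t ht
  have hi : Integrable (fun x : E d => 1 + ‖x‖ ^ 2) (μ t : Measure (E d)) :=
    (integrable_const _).add (P2.integrable_sq hP)
  rw [X.integral_push (by fun_prop) t]
  calc ∫ x, (1 + ‖X.map t x‖ ^ 2) ∂(μ t : Measure (E d))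
      ≤ ∫ x, 2 * c ^ 2 * (1 + ‖x‖ ^ 2) ∂(μ t : Measure (E d)) := by
        refine integral_mono_of_nonneg (ae_of_all _ fun x => by positivity) (hi.const_mul _)
          (ae_of_all _ fun x => ?_)
        have h1 := (hc t ht).2.2.2 x
        have h2 : (1 + ‖X.map t x‖) ^ 2 ≤ (c * (1 + ‖x‖)) ^ 2 :=
          pow_le_pow_left₀ (by positivity) h1 2
        have h3 : (1 + ‖x‖) ^ 2 ≤ 2 * (1 + ‖x‖ ^ 2) := by nlinarith [sq_nonneg (1 - ‖x‖)]
        have h4 := mul_le_mul_of_nonneg_left h3 (sq_nonneg c)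
        have h5 := norm_nonneg (X.map t x)
        simp only
        nlinarith
    _ = 2 * c ^ 2 * ∫ x, (1 + ‖x‖ ^ 2) ∂(μ t : Measure (E d)) := integral_const_mul _ _
    _ ≤ 2 * c ^ 2 * B := by gcongr; exact hB t ht

lemma flux_push (h : IsFlow μ₀ μ₁ μ V) :
    ∫⁻ t in Ioo (0 : ℝ) 1, ∫⁻ y, ENNReal.ofReal ((1 + ‖y‖) * ‖X.pushVelocity V t y‖)
      ∂(X.pushMeasure μ t : Measure (E d)) < ⊤ := by
  obtain ⟨c, hc1, hc⟩ := X.exists_bound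
  obtain ⟨B, hB⟩ := h.moment
  have hVt := X.measurable_pushVelocity h.ce.borel
  have key : ∀ t ∈ Ioo (0 : ℝ) 1,
      ∫⁻ y, ENNReal.ofReal ((1 + ‖y‖) * ‖X.pushVelocity V t y‖) ∂(X.pushMeasure μ t : Measure (E d))
      ≤ ENNReal.ofReal (2 * c * X.speed t) * ENNReal.ofReal B + ENNReal.ofReal (c ^ 2)
        * ∫⁻ x, ENNReal.ofReal ((1 + ‖x‖) * ‖V t x‖) ∂(μ t : Measure (E d)) := by
    intro t ht
    have htI := Ioo_subset_Icc_self ht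
    have hm : Measurable (X.pushVelocity V t) := hVt.comp measurable_prodMk_left
    have hVm := h.measurable_apply t
    have hs := X.speed_nonneg t
    rw [X.lintegral_push (by fun_prop) t]
    have e : ∀ x, ENNReal.ofReal ((1 + ‖X.map t x‖) * ‖X.pushVelocity V t (X.map t x)‖)
        ≤ ENNReal.ofReal (2 * c * X.speed t) * ENNReal.ofReal (1 + ‖x‖ ^ 2)
          + ENNReal.ofReal (c ^ 2) * ENNReal.ofReal ((1 + ‖x‖) * ‖V t x‖) := fun x => by
      rw [← ENNReal.ofReal_mul (by positivity), ← ENNReal.ofReal_mul (by positivity),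
        ← ENNReal.ofReal_add (by positivity) (by positivity), X.pushVelocity_map]
      refine ENNReal.ofReal_le_ofReal ?_
      have h1 := (hc t htI).2.2.2 x
      have h2 : ‖X.drift V t x‖ ≤ X.speed t * (1 + ‖x‖) + c * ‖V t x‖ := by
        refine (norm_add_le _ _).trans (add_le_add (X.norm_drift_zero_le t x) ?_)
        exact (norm_act_le _ _).trans (mul_le_mul_of_nonneg_right (hc t htI).1 (norm_nonneg _))
      have h3 : (1 + ‖x‖) ^ 2 ≤ 2 * (1 + ‖x‖ ^ 2) := by nlinarith [sq_nonneg (1 - ‖x‖)]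
      calc (1 + ‖X.map t x‖) * ‖X.drift V t x‖
          ≤ (c * (1 + ‖x‖)) * (X.speed t * (1 + ‖x‖) + c * ‖V t x‖) := by gcongr
        _ = c * X.speed t * (1 + ‖x‖) ^ 2 + c ^ 2 * ((1 + ‖x‖) * ‖V t x‖) := by ring
        _ ≤ c * X.speed t * (2 * (1 + ‖x‖ ^ 2)) + c ^ 2 * ((1 + ‖x‖) * ‖V t x‖) := by gcongr
        _ = _ := by ring
    refine (lintegral_mono e).trans ?_
    rw [lintegral_add_left (by fun_prop), lintegral_const_mul _ (by fun_prop),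
      lintegral_const_mul _ (by fun_prop)]
    gcongr
    exact lintegral_one_add_sq_le (h.ce.finite_moment t htI) (hB t htI)
  have hsp : IntegrableOn (fun t => 2 * c * X.speed t) (Ioo 0 1) := X.integrableOn_speed.const_mul _
  refine lt_of_le_of_lt (setLIntegral_mono' measurableSet_Ioo key) ?_
  rw [lintegral_add_left' (hsp.aestronglyMeasurable.aemeasurable.ennreal_ofReal.mul_const _),
    lintegral_mul_const' _ _ ENNReal.ofReal_ne_top, lintegral_const_mul' _ _ ENNReal.ofReal_ne_top]
  exact ENNReal.add_lt_top.mpr ⟨ENNReal.mul_lt_top hsp.lintegral_lt_top ENNReal.ofReal_lt_top,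
    ENNReal.mul_lt_top ENNReal.ofReal_lt_top h.flux⟩

lemma finite_moment_push (h : IsFlow μ₀ μ₁ μ V) {t : ℝ} (ht : t ∈ Icc (0 : ℝ) 1) :
    (X.pushMeasure μ t : Measure (E d)) ∈ P2 d := P2_map (h.ce.finite_moment t ht) _ _

/-- The transported velocity field solves the continuity equation: test functions composed with
the curve of affine maps are absolutely continuous in time. -/
lemma equation_push (h : IsFlow μ₀ μ₁ μ V) {φ : ℝ × E d → ℝ} (hφ : ContDiff ℝ (⊤ : ℕ∞) φ)
    (hφc : HasCompactSupport φ) (hφs : tsupport φ ⊆ Ioo (0 : ℝ) 1 ×ˢ univ) :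
    ∫ t in Ioo (0 : ℝ) 1, ∫ y, (deriv (fun s => φ (s, y)) t
      + fderiv ℝ (fun z => φ (t, z)) y (X.pushVelocity V t y))
        ∂(X.pushMeasure μ t : Measure (E d)) = 0 := by
  obtain ⟨c, hc1, hc⟩ := X.exists_bound
  have hφd : Differentiable ℝ φ := hφ.differentiable (by simp)
  have hφf : Continuous (fderiv ℝ φ) := hφ.continuous_fderiv (by simp)
  obtain ⟨K, hK⟩ := hφf.bounded_above_of_compact_support (hφc.fderiv ℝ)
  have hK0 : 0 ≤ K := (norm_nonneg _).trans (hK 0)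
  obtain ⟨r, hr⟩ := hφc.isCompact.isBounded.subset_closedBall (0 : ℝ × E d)
  have hdt : ∀ t y, deriv (fun s => φ (s, y)) t = fderiv ℝ φ (t, y) (1, 0) := fun t y =>
    ((hφd (t, y)).hasFDerivAt.comp_hasDerivAt t
      ((hasDerivAt_id t).prodMk (hasDerivAt_const t y))).deriv
  have hdy : ∀ t y v, fderiv ℝ (fun z => φ (t, z)) y v = fderiv ℝ φ (t, y) (0, v) := by
    intro t y v
    have h1 : HasFDerivAt (fun z : E d => (t, z)) (ContinuousLinearMap.inr ℝ ℝ (E d)) y :=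
      hasFDerivAt_prodMk_right t y
    have h2 := (hφd (t, y)).hasFDerivAt.comp y h1
    have h3 : fderiv ℝ (fun z => φ (t, z)) y = _ := h2.fderiv
    rw [h3]
    simp
  set Φ : ℝ → E d → ℝ := fun t x => φ (t, X.map t x) with hΦ
  set Ψ : ℝ → E d → ℝ := fun t x => fderiv ℝ φ (t, X.map t x) (1, X.q' t + act (X.P' t) x) with hΨ
  have hmap : ∀ t x, HasFDerivAt (X.map t) (actL (X.P t)) x := fun t x =>
    ((actL (X.P t)).hasFDerivAt).add_const _
  have hfdΦ : ∀ t x v, fderiv ℝ (Φ t) x v = fderiv ℝ φ (t, X.map t x) (0, act (X.P t) v) := by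
    intro t x v
    have h1 : HasFDerivAt (fun x => (t, X.map t x))
        ((ContinuousLinearMap.inr ℝ ℝ (E d)).comp (actL (X.P t))) x :=
      (hasFDerivAt_prodMk_right t (X.map t x)).comp x (hmap t x)
    have h2 := (hφd (t, X.map t x)).hasFDerivAt.comp x h1
    have h3 : fderiv ℝ (Φ t) x = _ := h2.fderiv
    rw [h3]
    simp [actL_apply]
  have hcm : Continuous fun z : ℝ × E d => (z.1, X.map z.1 z.2) :=
    continuous_fst.prodMk X.continuous_map_uncurry
  have hev : Continuous fun z : ((ℝ × E d) × (ℝ × E d)) => fderiv ℝ φ z.1 z.2 :=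
    isBoundedBilinearMap_apply.continuous.comp
      ((hφf.comp continuous_fst).prodMk continuous_snd)
  have hΦs : ∀ t, ContDiff ℝ (⊤ : ℕ∞) (Φ t) := fun t =>
    hφ.comp (contDiff_const.prodMk (((actL (X.P t)).contDiff).add contDiff_const))
  -- points whose image lies in the support of the test function are bounded
  have hbd : ∀ t ∈ Icc (0 : ℝ) 1, ∀ x, (t, X.map t x) ∈ tsupport φ → ‖x‖ ≤ c * (r + c) := by
    intro t ht x hx
    have h1 : ‖X.map t x‖ ≤ r := by
      have := hr hx
      rw [mem_closedBall_zero_iff, Prod.norm_def] at this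
      exact (le_max_right _ _).trans this
    rw [← X.inv_map t x]
    refine (norm_act_le _ _).trans ?_
    have h2 := norm_sub_le (X.map t x) (X.q t)
    obtain ⟨-, h3, h4, -⟩ := hc t ht
    exact mul_le_mul h3 (by linarith) (norm_nonneg _) (by linarith)
  have hΦc : ∀ t ∈ Icc (0 : ℝ) 1, HasCompactSupport (Φ t) := by
    intro t ht
    refine HasCompactSupport.intro (isCompact_closedBall (0 : E d) (c * (r + c))) fun x hx => ?_
    refine image_eq_zero_of_notMem_tsupport (f := φ) (x := (t, X.map t x)) fun hmem => hx ?_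
    rw [mem_closedBall_zero_iff]
    exact hbd t ht x hmem
  have hfd : Continuous fun z : (ℝ × E d) × E d => fderiv ℝ (Φ z.1.1) z.1.2 z.2 := by
    simp only [hfdΦ]
    exact hev.comp ((hcm.comp continuous_fst).prodMk (continuous_const.prodMk
      (continuous_act_comp (X.continuous_P.comp (continuous_fst.comp continuous_fst))
        continuous_snd)))
  have hKΦ : ∀ t ∈ Icc (0 : ℝ) 1, ∀ x v, ‖fderiv ℝ (Φ t) x v‖ ≤ K * c * ‖v‖ := by
    intro t ht x v
    rw [hfdΦ, mul_assoc]
    refine ((fderiv ℝ φ _).le_opNorm _).trans (mul_le_mul (hK _) ?_ (norm_nonneg _) hK0)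
    rw [Prod.norm_def]
    simp only [norm_zero]
    rw [max_eq_right (norm_nonneg _)]
    exact (norm_act_le _ _).trans (mul_le_mul_of_nonneg_right (hc t ht).1 (norm_nonneg _))
  have hAC : ∀ x, IsACWith (fun t => Φ t x) (fun t => Ψ t x) := by
    intro x
    refine isACWith_comp hφ hφc fun i => ?_
    have h1 := (IsACWith.sum Finset.univ fun j _ => (X.ac_P i j).mul_const (x j)).add (X.ac_q i)
    convert h1 using 2 with t t
    · simp [map, act_apply]
    · simp [act_apply, add_comm]
  have hΨm : Measurable (Function.uncurry Ψ) := by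
    have h1 : Measurable fun z : ℝ × E d => X.q' z.1 + act (X.P' z.1) z.2 :=
      (X.measurable_q'.comp measurable_fst).add
        (measurable_act_comp (fun i j => (X.measurable_P' i j).comp measurable_fst) measurable_snd)
    exact hev.measurable.comp (hcm.measurable.prodMk (measurable_const.prodMk h1))
  have hΨc : ∀ t, Continuous (Ψ t) := fun t =>
    hev.comp ((continuous_const.prodMk (X.continuous_map t)).prodMk
      (continuous_const.prodMk (continuous_const.add (continuous_act _))))
  have hΨb : ∀ t ∈ Ioo (0 : ℝ) 1, ∀ x,
      ‖Ψ t x‖ ≤ K * (1 + X.speed t * (1 + |c * (r + c)|)) := by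
    intro t ht x
    have hs := X.speed_nonneg t
    by_cases hx : (t, X.map t x) ∈ tsupport φ
    · have hb := (hbd t (Ioo_subset_Icc_self ht) x hx).trans (le_abs_self _)
      refine ((fderiv ℝ φ _).le_opNorm _).trans (mul_le_mul (hK _) ?_ (norm_nonneg _) hK0)
      rw [Prod.norm_def]
      have h1 : ‖X.q' t + act (X.P' t) x‖ ≤ X.speed t * (1 + |c * (r + c)|) :=
        (X.norm_drift_zero_le t x).trans (by gcongr)
      simp only [norm_one]
      exact max_le (by nlinarith [mul_nonneg hs (abs_nonneg (c * (r + c)))]) (by linarith)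
    · have : fderiv ℝ φ (t, X.map t x) = 0 :=
        image_eq_zero_of_notMem_tsupport fun h' => hx (tsupport_fderiv_subset ℝ h')
      simp only [hΨ, this, _root_.zero_apply, norm_zero]
      positivity
  have hβ : IntegrableOn (fun t => K * (1 + X.speed t * (1 + |c * (r + c)|))) (Ioo 0 1) :=
    ((integrable_const _).add (X.integrableOn_speed.mul_const _)).const_mul _
  have hmain := h.integral_sub_time (fun t _ => hΦs t) hΦc hfd hKΦ hAC hΨm hΨc hβ hΨb
  have hz : ∀ t, t ∉ Ioo (0 : ℝ) 1 → ∀ x, Φ t x = 0 := fun t ht x =>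
    image_eq_zero_of_notMem_tsupport (f := φ) (x := (t, X.map t x)) fun hm => ht (hφs hm).1
  have hz0 : ∀ x, Φ 0 x = 0 := hz 0 (by simp)
  have hz1 : ∀ x, Φ 1 x = 0 := hz 1 (by simp)
  simp only [hz0, hz1, MeasureTheory.integral_zero, sub_zero] at hmain
  refine Eq.trans (integral_congr_ae (ae_of_all _ fun t => ?_)) hmain.symm
  simp only [hdt, hdy]
  have hm : Measurable fun y => fderiv ℝ φ (t, y) (1, 0)
      + fderiv ℝ φ (t, y) (0, X.pushVelocity V t y) := by
    have h1 : Measurable (X.pushVelocity V t) :=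
      (X.measurable_pushVelocity h.ce.borel).comp measurable_prodMk_left
    exact (hev.measurable.comp ((measurable_const.prodMk measurable_id).prodMk
      measurable_const)).add (hev.measurable.comp ((measurable_const.prodMk measurable_id).prodMk
      (measurable_const.prodMk h1)))
  rw [X.integral_push hm t]
  refine integral_congr_ae (ae_of_all _ fun x => ?_)
  simp only [hfdΦ, hΨ, X.pushVelocity_map]
  rw [← map_add, ← map_add]
  simp [drift]

/-- Flows are preserved by absolutely continuous curves of invertible affine maps. -/
theorem isFlow_push (h : IsFlow μ₀ μ₁ μ V) :
    IsFlow (μ₀.map (X.map 0)) (μ₁.map (X.map 1)) (X.pushMeasure μ) (X.pushVelocity V) := by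
  refine ⟨⟨?_, ?_, X.continuousOn_pushMeasure h.ce.weakly_continuous,
    fun t ht => X.finite_moment_push h ht, X.measurable_pushVelocity h.ce.borel, ?_,
    fun φ hφ hφc hφs => X.equation_push h hφ hφc hφs⟩, X.moment_push h, X.flux_push h⟩
  · rw [coe_pushMeasure, h.ce.start]
  · rw [coe_pushMeasure, h.ce.finish]
  · intro a b r ha hb
    refine lt_of_le_of_lt ?_ (X.flux_push h)
    have hsub : Icc a b ⊆ Ioo (0 : ℝ) 1 := fun t ht => ⟨ha.trans_le ht.1, ht.2.trans_lt hb⟩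
    refine (lintegral_mono_set hsub).trans (lintegral_mono fun t => ?_)
    refine (setLIntegral_le_lintegral _ _).trans (lintegral_mono fun y => ?_)
    rw [← ofReal_norm]
    refine ENNReal.ofReal_le_ofReal ?_
    nlinarith [norm_nonneg y, norm_nonneg (X.pushVelocity V t y),
      mul_nonneg (norm_nonneg y) (norm_nonneg (X.pushVelocity V t y))]

end AffineCurve

end

section

/-! ### Splitting the action -/

variable {d : ℕ} {ν : ℝ → ProbabilityMeasure (E d)} {ν₀ ν₁ : Measure (E d)} {W : ℝ → E d → E d}

lemma IsACWith.deriv_eq_zero {f f' : ℝ → ℝ} (hf : IsACWith f f') {c : ℝ}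
    (hc : ∀ t ∈ Icc (0 : ℝ) 1, f t = c) : ∀ᵐ t ∂(volume.restrict (Ioo (0 : ℝ) 1)), f' t = 0 := by
  filter_upwards [hf.hasDerivAt, ae_restrict_mem measurableSet_Ioo] with t ht ht01
  refine ht.unique ((hasDerivAt_const t c).congr_of_eventuallyEq ?_)
  filter_upwards [Ioo_mem_nhds ht01.1 ht01.2] with s hs using hc s (Ioo_subset_Icc_self hs)

/-- The theorem of Pythagoras, without assuming that the second summand has finite norm. -/
lemma lintegral_norm_add_sq {μ : Measure (E d)} {g v : E d → E d} (hg : Measurable g)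
    (hv : Measurable v) (hg2 : Integrable (fun x => ‖g x‖ ^ 2) μ)
    (hi : Integrable (fun x => inner ℝ (g x) (v x)) μ) (h0 : ∫ x, inner ℝ (g x) (v x) ∂μ = 0) :
    ∫⁻ x, ENNReal.ofReal (‖g x + v x‖ ^ 2) ∂μ
      = ENNReal.ofReal (∫ x, ‖g x‖ ^ 2 ∂μ) + ∫⁻ x, ENNReal.ofReal (‖v x‖ ^ 2) ∂μ := by
  by_cases hv2 : Integrable (fun x => ‖v x‖ ^ 2) μ
  · have e : ∀ x, ‖g x + v x‖ ^ 2 = ‖g x‖ ^ 2 + 2 * inner ℝ (g x) (v x) + ‖v x‖ ^ 2 := fun x =>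
      norm_add_sq_real _ _
    have i1 : Integrable (fun x => ‖g x‖ ^ 2 + 2 * inner ℝ (g x) (v x)) μ :=
      hg2.add (hi.const_mul 2)
    have i2 : Integrable (fun x => ‖g x + v x‖ ^ 2) μ := by
      simp only [e]; exact i1.add hv2
    rw [← ofReal_integral_eq_lintegral_ofReal i2 (ae_of_all _ fun x => sq_nonneg _),
      ← ofReal_integral_eq_lintegral_ofReal hv2 (ae_of_all _ fun x => sq_nonneg _),
      ← ENNReal.ofReal_add (integral_nonneg fun x => sq_nonneg _)
        (integral_nonneg fun x => sq_nonneg _)]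
    congr 1
    simp only [e]
    rw [integral_add i1 hv2, integral_add hg2 (hi.const_mul 2), integral_const_mul, h0]
    ring
  · have t1 : ∫⁻ x, ENNReal.ofReal (‖v x‖ ^ 2) ∂μ = ⊤ := by
      by_contra hne
      refine hv2 ⟨(hv.norm.pow_const 2).aestronglyMeasurable, ?_⟩
      rw [hasFiniteIntegral_iff_ofReal (ae_of_all _ fun x => sq_nonneg _)]
      exact lt_top_iff_ne_top.mpr hne
    rw [t1, add_top]
    by_contra hne
    refine hv2 ?_
    have i2 : Integrable (fun x => ‖g x + v x‖ ^ 2) μ := by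
      refine ⟨((hg.add hv).norm.pow_const 2).aestronglyMeasurable, ?_⟩
      rw [hasFiniteIntegral_iff_ofReal (ae_of_all _ fun x => sq_nonneg _)]
      exact lt_top_iff_ne_top.mpr hne
    refine ((i2.const_mul 2).add (hg2.const_mul 2)).mono' (hv.norm.pow_const 2).aestronglyMeasurable
      (ae_of_all _ fun x => ?_)
    rw [Real.norm_of_nonneg (sq_nonneg _), Pi.add_apply]
    have h1 : ‖v x‖ ≤ ‖g x + v x‖ + ‖g x‖ := by
      calc ‖v x‖ = ‖(g x + v x) - g x‖ := by rw [add_sub_cancel_left]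
        _ ≤ _ := norm_sub_le _ _
    nlinarith [norm_nonneg (v x), norm_nonneg (g x), norm_nonneg (g x + v x),
      sq_nonneg (‖g x + v x‖ - ‖g x‖)]

/-- In normalized coordinates an affine vector field `a + S x` with symmetric `S` is orthogonal to
the velocity, since mean and covariance are preserved. -/
lemma lintegral_affine_add_sq {μ : Measure (E d)} (hμ : μ ∈ P2 d) (hm : mean μ = 0)
    (hc : covMat μ = 1) {v : E d → E d} (hv : Measurable v)
    (hvi : ∀ i, Integrable (fun x => v x i) μ)
    (hxv : ∀ i j, Integrable (fun x : E d => x i * v x j) μ) (hv0 : ∀ i, ∫ x, v x i ∂μ = 0)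
    (hxv0 : ∀ i j, ∫ x, x i * v x j ∂μ + ∫ x, x j * v x i ∂μ = 0) (a : E d)
    {S : Matrix (Fin d) (Fin d) ℝ} (hS : Sᵀ = S) :
    ∫⁻ x, ENNReal.ofReal (‖a + act S x + v x‖ ^ 2) ∂μ
      = ENNReal.ofReal (‖a‖ ^ 2 + Matrix.trace (S * S)) + ∫⁻ x, ENNReal.ofReal (‖v x‖ ^ 2) ∂μ := by
  have := hμ.1
  have hx1 : ∀ i, ∫ x : E d, x i ∂μ = 0 := fun i => by rw [← mean_apply hμ, hm]; rfl
  have hx2 : ∀ i j, ∫ x : E d, x i * x j ∂μ = (1 : Matrix (Fin d) (Fin d) ℝ) i j := fun i j => by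
    have := covMat_apply hμ i j
    rw [hc, hm] at this
    simpa using this.symm
  have hg : Continuous fun x => a + act S x := continuous_const.add (continuous_act S)
  have eS : ∀ x : E d, ‖a + act S x‖ ^ 2 = ‖a‖ ^ 2 + (∑ i, ∑ j, 2 * (a i * S i j) * x j
      + ∑ i, ∑ j, ∑ k, S i j * S i k * (x j * x k)) := fun x => by
    rw [norm_add_sq_real, ← real_inner_self_eq_norm_sq (act S x), inner_eq_sum, inner_eq_sum,
      add_assoc]
    congr 2
    · rw [Finset.mul_sum]
      refine Finset.sum_congr rfl fun i _ => ?_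
      rw [act_apply, Finset.mul_sum, Finset.mul_sum]
      refine Finset.sum_congr rfl fun j _ => ?_
      ring
    · refine Finset.sum_congr rfl fun i _ => ?_
      rw [act_apply, Finset.sum_mul_sum]
      refine Finset.sum_congr rfl fun j _ => Finset.sum_congr rfl fun k _ => ?_
      ring
  have j1 : ∀ i j, Integrable (fun x : E d => 2 * (a i * S i j) * x j) μ := fun i j =>
    (P2.integrable_coord hμ j).const_mul _
  have j2 : ∀ i j k, Integrable (fun x : E d => S i j * S i k * (x j * x k)) μ := fun i j k =>
    (P2.integrable_coord_mul hμ j k).const_mul _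
  have j1' : Integrable (fun x : E d => ∑ i, ∑ j, 2 * (a i * S i j) * x j) μ :=
    integrable_finsetSum _ fun i _ => integrable_finsetSum _ fun j _ => j1 i j
  have j2' : Integrable (fun x : E d => ∑ i, ∑ j, ∑ k, S i j * S i k * (x j * x k)) μ :=
    integrable_finsetSum _ fun i _ => integrable_finsetSum _ fun j _ =>
      integrable_finsetSum _ fun k _ => j2 i j k
  have ec : ∀ x : E d, inner ℝ (a + act S x) (v x)
      = ∑ i, a i * v x i + ∑ i, ∑ j, S i j * (x j * v x i) := fun x => by
    rw [inner_add_left, inner_eq_sum, inner_eq_sum]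
    congr 1
    refine Finset.sum_congr rfl fun i _ => ?_
    rw [act_apply, Finset.sum_mul]
    refine Finset.sum_congr rfl fun j _ => ?_
    ring
  have k1 : Integrable (fun x => ∑ i, a i * v x i) μ :=
    integrable_finsetSum _ fun i _ => (hvi i).const_mul _
  have k2 : Integrable (fun x : E d => ∑ i, ∑ j, S i j * (x j * v x i)) μ :=
    integrable_finsetSum _ fun i _ => integrable_finsetSum _ fun j _ => (hxv j i).const_mul _
  have hsq : ∫ x, ‖a + act S x‖ ^ 2 ∂μ = ‖a‖ ^ 2 + Matrix.trace (S * S) := by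
    have j12 : Integrable (fun x : E d => ∑ i, ∑ j, 2 * (a i * S i j) * x j
      + ∑ i, ∑ j, ∑ k, S i j * S i k * (x j * x k)) μ := j1'.add j2'
    have l1 : ∫ x : E d, ∑ i, ∑ j, 2 * (a i * S i j) * x j ∂μ
        = ∑ i, ∫ x : E d, ∑ j, 2 * (a i * S i j) * x j ∂μ :=
      integral_finsetSum _ fun i _ => integrable_finsetSum _ fun j _ => j1 i j
    have l2 : ∫ x : E d, ∑ i, ∑ j, ∑ k, S i j * S i k * (x j * x k) ∂μ
        = ∑ i, ∫ x : E d, ∑ j, ∑ k, S i j * S i k * (x j * x k) ∂μ :=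
      integral_finsetSum _ fun i _ => integrable_finsetSum _ fun j _ =>
        integrable_finsetSum _ fun k _ => j2 i j k
    simp only [eS]
    rw [integral_add (integrable_const _) j12, integral_add j1' j2', l1, l2]
    have s1 : ∀ i, ∫ x : E d, ∑ j, 2 * (a i * S i j) * x j ∂μ = 0 := fun i => by
      rw [integral_finsetSum _ fun j _ => j1 i j]
      refine Finset.sum_eq_zero fun j _ => ?_
      rw [integral_const_mul, hx1, mul_zero]
    have s2 : ∀ i, ∫ x : E d, ∑ j, ∑ k, S i j * S i k * (x j * x k) ∂μ = ∑ j, S i j * S j i := by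
      intro i
      rw [integral_finsetSum _ fun j _ => integrable_finsetSum _ fun k _ => j2 i j k]
      refine Finset.sum_congr rfl fun j _ => ?_
      rw [integral_finsetSum _ fun k _ => j2 i j k]
      simp only [integral_const_mul, hx2, Matrix.one_apply]
      simp only [mul_ite, mul_one, mul_zero, Finset.sum_ite_eq, Finset.mem_univ, if_true]
      rw [show S j i = Sᵀ i j from rfl, hS]
    simp only [s1, s2, Finset.sum_const_zero, zero_add]
    simp [Matrix.trace, Matrix.mul_apply]
  have hcross : ∫ x, inner ℝ (a + act S x) (v x) ∂μ = 0 := by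
    have l2 : ∫ x : E d, ∑ i, ∑ j, S i j * (x j * v x i) ∂μ
        = ∑ i, ∫ x : E d, ∑ j, S i j * (x j * v x i) ∂μ :=
      integral_finsetSum _ fun i _ => integrable_finsetSum _ fun j _ => (hxv j i).const_mul _
    simp only [ec]
    rw [integral_add k1 k2, integral_finsetSum _ fun i _ => (hvi i).const_mul _, l2]
    have s2 : ∀ i, ∫ x : E d, ∑ j, S i j * (x j * v x i) ∂μ = ∑ j, S i j * ∫ x, x j * v x i ∂μ := by
      intro i
      rw [integral_finsetSum _ fun j _ => (hxv j i).const_mul _]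
      simp only [integral_const_mul]
    simp only [integral_const_mul, hv0, mul_zero, Finset.sum_const_zero, zero_add, s2]
    -- the sum equals its own negative after exchanging the indices
    have s3 : ∑ i, ∑ j, S i j * ∫ x, x j * v x i ∂μ
        = - ∑ i, ∑ j, S i j * ∫ x, x j * v x i ∂μ := by
      conv_lhs => rw [Finset.sum_comm]
      rw [← Finset.sum_neg_distrib]
      refine Finset.sum_congr rfl fun i _ => ?_
      rw [← Finset.sum_neg_distrib]
      refine Finset.sum_congr rfl fun j _ => ?_
      have h1 := hxv0 i j
      have h2 : S j i = S i j := by rw [show S j i = Sᵀ i j from rfl, hS]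
      rw [h2]
      linear_combination S i j * h1
    linarith
  rw [← hsq]
  refine lintegral_norm_add_sq hg.measurable hv ?_ ?_ hcross
  · simp only [eS]; exact (integrable_const _).add (j1'.add j2')
  · simp only [ec]; exact k1.add k2

lemma inner_act_left (A : Matrix (Fin d) (Fin d) ℝ) (x y : E d) :
    inner ℝ (act A x) y = inner ℝ x (act Aᵀ y) := by
  simp only [inner_eq_sum, act_apply, Finset.sum_mul, Finset.mul_sum, Matrix.transpose_apply]
  rw [Finset.sum_comm]
  refine Finset.sum_congr rfl fun i _ => Finset.sum_congr rfl fun j _ => ?_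
  ring

/-- The modulated norm in terms of a left square root `P` of the covariance with inverse `Q`. -/
lemma modNormSq_mul_transpose {P Q : Matrix (Fin d) (Fin d) ℝ} (h : P * Q = 1) (ξ : E d) :
    modNormSq (P * Pᵀ) ξ = ENNReal.ofReal (‖act Q ξ‖ ^ 2) := by
  have hH : (P * Pᵀ).IsHermitian := by
    rw [Matrix.IsHermitian, Matrix.conjTranspose_eq_transpose_of_trivial, Matrix.transpose_mul,
      Matrix.transpose_transpose]
  have h2 : Pᵀ * Qᵀ = 1 := by
    rw [← Matrix.transpose_mul, mul_eq_one_comm.mp h, Matrix.transpose_one]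
  rw [modNormSq_of_eq hH (η := act (Qᵀ * Q) ξ)]
  · rw [act_mul, real_inner_comm, inner_act_left, Matrix.transpose_transpose,
      real_inner_self_eq_norm_sq]
  · rw [← act_mul, Matrix.mul_assoc, ← Matrix.mul_assoc Pᵀ, h2, Matrix.one_mul, h, act_one]

lemma moment_integrand {P Q P' : Matrix (Fin d) (Fin d) ℝ} (h : P * Q = 1)
    (hS : (Q * P')ᵀ = Q * P') (a : E d) :
    1 / 2 * inner ℝ a (act (P * Pᵀ)⁻¹ a)
      + 1 / 8 * Matrix.trace ((P' * Pᵀ + P * P'ᵀ) * (P * Pᵀ)⁻¹ * (P' * Pᵀ + P * P'ᵀ) * (P * Pᵀ)⁻¹)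
      = 1 / 2 * (‖act Q a‖ ^ 2 + Matrix.trace ((Q * P') * (Q * P'))) := by
  have h2 : Pᵀ * Qᵀ = 1 := by
    rw [← Matrix.transpose_mul, mul_eq_one_comm.mp h, Matrix.transpose_one]
  have hinv : (P * Pᵀ)⁻¹ = Qᵀ * Q := by
    refine Matrix.inv_eq_right_inv ?_
    rw [Matrix.mul_assoc, ← Matrix.mul_assoc Pᵀ, h2, Matrix.one_mul, h]
  have hP' : P' = P * (Q * P') := by rw [← Matrix.mul_assoc, h, Matrix.one_mul]
  set S := Q * P' with hSdef
  have hC' : P' * Pᵀ + P * P'ᵀ = (2 : ℝ) • (P * S * Pᵀ) := by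
    rw [hP', Matrix.transpose_mul, hS, two_smul, Matrix.mul_assoc P S]
  have hprod : (P * S * Pᵀ) * (Qᵀ * Q) = P * S * Q := by
    rw [Matrix.mul_assoc, ← Matrix.mul_assoc Pᵀ, h2, Matrix.one_mul]
  have hQP := mul_eq_one_comm.mp h
  have htr : Matrix.trace (P * S * Q * (P * S * Q)) = Matrix.trace (S * S) := by
    have : P * S * Q * (P * S * Q) = P * (S * S * Q) := by
      simp only [Matrix.mul_assoc]
      rw [← Matrix.mul_assoc Q P, hQP, Matrix.one_mul]
    rw [this, Matrix.trace_mul_comm, Matrix.mul_assoc, hQP, Matrix.mul_one]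
  rw [hinv, hC']
  simp only [Matrix.smul_mul, Matrix.mul_smul, Matrix.trace_smul]
  rw [hprod, Matrix.mul_assoc, hprod, htr, act_mul, real_inner_comm, inner_act_left,
    Matrix.transpose_transpose, real_inner_self_eq_norm_sq]
  simp only [smul_eq_mul]
  ring

/-- The action splits under a curve of affine maps `x ↦ Pₜ x + qₜ` for which `Pₜ⁻¹ Pₜ'` is
symmetric: the affine part contributes the moment action, the rest is the kinetic energy in
normalized coordinates. -/
theorem action_push (X : AffineCurve d) (h : IsFlow ν₀ ν₁ ν W)
    (hId : ∀ t ∈ Icc (0 : ℝ) 1, mean (ν t : Measure (E d)) = 0 ∧ covMat (ν t : Measure (E d)) = 1)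
    (hS : ∀ᵐ t ∂(volume.restrict (Ioo (0 : ℝ) 1)), (X.Q t * X.P' t)ᵀ = X.Q t * X.P' t) :
    ∫⁻ t in Ioo (0 : ℝ) 1, ∫⁻ y, 1 / 2 * modNormSq (covMat (X.pushMeasure ν t : Measure (E d)))
        (X.pushVelocity W t y) ∂(X.pushMeasure ν t : Measure (E d))
      = (∫⁻ t in Ioo (0 : ℝ) 1, ENNReal.ofReal
          (1 / 2 * inner ℝ (X.q' t) (act (X.P t * (X.P t)ᵀ)⁻¹ (X.q' t))
          + 1 / 8 * Matrix.trace ((X.P' t * (X.P t)ᵀ + X.P t * (X.P' t)ᵀ) * (X.P t * (X.P t)ᵀ)⁻¹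
            * (X.P' t * (X.P t)ᵀ + X.P t * (X.P' t)ᵀ) * (X.P t * (X.P t)ᵀ)⁻¹)))
        + ∫⁻ t in Ioo (0 : ℝ) 1, ∫⁻ x, 1 / 2 * ‖W t x‖ₑ ^ 2 ∂(ν t : Measure (E d)) := by
  have hWm : AEMeasurable (fun t => ∫⁻ x, 1 / 2 * ‖W t x‖ₑ ^ 2 ∂(ν t : Measure (E d)))
      (volume.restrict (Ioo (0 : ℝ) 1)) :=
    aemeasurable_lintegral_curve h.ce.weakly_continuous
      (f := fun z => 1 / 2 * ‖W z.1 z.2‖ₑ ^ 2) ((h.ce.borel.enorm.pow_const 2).const_mul _)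
  rw [← lintegral_add_right' _ hWm]
  -- mean and covariance are constant, so their time derivatives, which are moments of `W`, vanish
  have hv0 : ∀ᵐ t ∂(volume.restrict (Ioo (0 : ℝ) 1)), ∀ i,
      ∫ x, W t x i ∂(ν t : Measure (E d)) = 0 := ae_all_iff.mpr fun i =>
    (h.mean_isACWith i).deriv_eq_zero (c := 0) fun t ht => by rw [(hId t ht).1]; rfl
  have hxv0 : ∀ᵐ t ∂(volume.restrict (Ioo (0 : ℝ) 1)), ∀ i j,
      ∫ x, ((x i - mean (ν t : Measure (E d)) i) * W t x j
        + (x j - mean (ν t : Measure (E d)) j) * W t x i) ∂(ν t : Measure (E d)) = 0 :=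
    ae_all_iff.mpr fun i => ae_all_iff.mpr fun j =>
      (h.cov_isACWith i j).deriv_eq_zero (c := (1 : Matrix (Fin d) (Fin d) ℝ) i j)
        fun t ht => by rw [(hId t ht).2]
  refine lintegral_congr_ae ?_
  filter_upwards [hv0, hxv0, hS, h.ae_integrable_velocity, ae_restrict_mem measurableSet_Ioo]
    with t hv0 hxv0 hS hvi ht
  have htI := Ioo_subset_Icc_self ht
  have hP := h.ce.finite_moment t htI
  obtain ⟨hm, hc⟩ := hId t htI
  have hPQ := X.mul_eq_one t
  have hcov : covMat (X.pushMeasure ν t : Measure (E d)) = X.P t * (X.P t)ᵀ := by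
    rw [X.coe_pushMeasure, show X.map t = fun x => act (X.P t) x + X.q t from rfl, covMat_map hP,
      hc, Matrix.mul_one]
  have hVm : Measurable (X.pushVelocity W t) :=
    (X.measurable_pushVelocity h.ce.borel).comp measurable_prodMk_left
  have hhalf : (1 / 2 : ℝ≥0∞) = ENNReal.ofReal (1 / 2) := by
    rw [ENNReal.ofReal_div_of_pos (by norm_num)]; simp
  rw [hcov, moment_integrand hPQ hS]
  simp only [modNormSq_mul_transpose hPQ]
  have hQV : Measurable fun y => 1 / 2 * ENNReal.ofReal
      (‖act (X.Q t) (X.pushVelocity W t y)‖ ^ 2) :=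
    ((((continuous_act (X.Q t)).measurable.comp hVm).norm.pow_const 2).ennreal_ofReal).const_mul _
  rw [X.lintegral_push hQV]
  simp only [X.pushVelocity_map]
  -- in normalized coordinates the velocity is an affine field plus `W`
  have e1 : ∀ x, act (X.Q t) (X.drift W t x)
      = act (X.Q t) (X.q' t) + act (X.Q t * X.P' t) x + W t x := fun x => by
    rw [AffineCurve.drift, act_add, act_add, ← act_mul, ← act_mul, mul_eq_one_comm.mp hPQ, act_one]
  simp only [e1]
  have hxv0' : ∀ i j, ∫ x, x i * W t x j ∂(ν t : Measure (E d))
      + ∫ x, x j * W t x i ∂(ν t : Measure (E d)) = 0 := fun i j => by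
    have := hxv0 i j
    rw [hm] at this
    rw [← integral_add (h.integrable_coord_mul_velocity hvi i j)
      (h.integrable_coord_mul_velocity hvi j i), ← this]
    simp
  have hWt := h.measurable_apply t
  have hQd : Measurable fun x => act (X.Q t) (X.q' t) + act (X.Q t * X.P' t) x + W t x :=
    (((continuous_act _).const_add _).measurable).add hWt
  rw [lintegral_const_mul _ (hQd.norm.pow_const 2).ennreal_ofReal,
    lintegral_const_mul _ (hWt.enorm.pow_const 2),
    lintegral_affine_add_sq hP hm hc hWt (h.integrable_coord_velocity hvi)
      (h.integrable_coord_mul_velocity hvi) hv0 hxv0' _ hS, mul_add, hhalf,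
    ← ENNReal.ofReal_mul (by norm_num)]
  congr 2
  refine lintegral_congr fun x => ?_
  rw [← ofReal_norm, ← ENNReal.ofReal_pow (norm_nonneg _)]

end

section

/-! ### Absolutely continuous curves of matrices -/

variable {d : ℕ}

/-- Entrywise absolute continuity with a prescribed derivative. -/
def MatACWith (A A' : ℝ → Matrix (Fin d) (Fin d) ℝ) : Prop :=
  ∀ i j, IsACWith (fun t => A t i j) (fun t => A' t i j)

namespace MatACWith

variable {A A' B B' : ℝ → Matrix (Fin d) (Fin d) ℝ}

lemma of_matAC (h : MatAC A) : MatACWith A (matDeriv A) := fun i j => IsACWith.of_deriv (h i j)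

lemma matAC (h : MatACWith A A') : MatAC A := fun i j => (h i j).ac

lemma matDeriv_ae_eq (h : MatACWith A A') :
    ∀ᵐ t ∂(volume.restrict (Ioo (0 : ℝ) 1)), matDeriv A t = A' t := by
  have : ∀ᵐ t ∂(volume.restrict (Ioo (0 : ℝ) 1)), ∀ i j, deriv (fun s => A s i j) t = A' t i j :=
    ae_all_iff.mpr fun i => ae_all_iff.mpr fun j => (h i j).deriv_ae_eq
  filter_upwards [this] with t ht
  ext i j
  exact ht i j

lemma congr (h : MatACWith A A') (hAB : EqOn A B (Icc 0 1)) : MatACWith B A' := fun i j =>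
  (h i j).congr fun t ht => by simp only [hAB ht]

lemma congr_deriv (h : MatACWith A A')
    (hAB : ∀ᵐ t ∂(volume.restrict (Ioo (0 : ℝ) 1)), A' t = B' t) : MatACWith A B' := fun i j =>
  (h i j).congr_deriv (by filter_upwards [hAB] with t ht using by rw [ht])

lemma const (M : Matrix (Fin d) (Fin d) ℝ) : MatACWith (fun _ => M) (fun _ => 0) := fun i j =>
  IsACWith.const (M i j)

lemma mul (hA : MatACWith A A') (hB : MatACWith B B') :
    MatACWith (fun t => A t * B t) (fun t => A' t * B t + A t * B' t) := fun i j => by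
  simp only [Matrix.mul_apply, Matrix.add_apply, ← Finset.sum_add_distrib]
  exact IsACWith.sum Finset.univ fun k _ => (hA i k).mul (hB k j)

lemma transpose (hA : MatACWith A A') : MatACWith (fun t => (A t)ᵀ) (fun t => (A' t)ᵀ) :=
  fun i j => hA j i

lemma eqOn (hA : MatACWith A A') (hB : MatACWith B A') (h0 : A 0 = B 0) :
    EqOn A B (Icc 0 1) := fun t ht => by
  ext i j
  exact (hA i j).eqOn (hB i j) (by rw [h0]) (ae_of_all _ fun _ => rfl) ht

lemma continuousOn (hA : MatACWith A A') : ContinuousOn A (Icc 0 1) := by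
  refine continuousOn_pi.mpr fun i => continuousOn_pi.mpr fun j => (hA i j).continuousOn

end MatACWith

lemma measurable_matDeriv (A : ℝ → Matrix (Fin d) (Fin d) ℝ) (i j : Fin d) :
    Measurable fun t => matDeriv A t i j := measurable_deriv _

lemma continuous_matrix_inv {X : Type*} [TopologicalSpace X] {A : X → Matrix (Fin d) (Fin d) ℝ}
    (hA : Continuous A) (h : ∀ x, IsUnit (A x).det) : Continuous fun x => (A x)⁻¹ := by
  simp only [Matrix.inv_def, Ring.inverse_eq_inv']
  exact (hA.matrix_det.inv₀ fun x => (h x).ne_zero).smul hA.matrix_adjugate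

lemma intervalIntegrable_sum {F ι : Type*} [NormedAddCommGroup F] (s : Finset ι)
    {f : ι → ℝ → F} (h : ∀ i ∈ s, IntervalIntegrable (f i) volume 0 1) :
    IntervalIntegrable (fun t => ∑ i ∈ s, f i t) volume 0 1 := by
  have := IntervalIntegrable.sum s h
  rwa [Finset.sum_fn] at this

lemma intervalIntegrable_smul_const {F : Type*} [NormedAddCommGroup F] [NormedSpace ℝ F]
    {f : ℝ → ℝ} (hf : IntervalIntegrable f volume 0 1) (v : F) :
    IntervalIntegrable (fun t => f t • v) volume 0 1 :=
  ⟨Integrable.smul_const hf.1 v, Integrable.smul_const hf.2 v⟩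

lemma intervalIntegrable_mul {f g : ℝ → ℝ} (hf : IntervalIntegrable f volume 0 1)
    (hg : Continuous g) : IntervalIntegrable (fun t => f t * g t) volume 0 1 :=
  hf.mul_continuousOn hg.continuousOn

/-- The linear equation `A' = K A` for matrices, solved column by column. -/
lemma exists_matrix_ode {K : ℝ → Matrix (Fin d) (Fin d) ℝ}
    (hK : ∀ i j, IntervalIntegrable (fun t => K t i j) volume 0 1)
    (A₀ : Matrix (Fin d) (Fin d) ℝ) : ∃ A : ℝ → Matrix (Fin d) (Fin d) ℝ,
      Continuous A ∧ A 0 = A₀ ∧ MatACWith A (fun t => K t * A t) := by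
  have hB : IntervalIntegrable (fun t => actL (K t)) volume 0 1 := by
    have e : ∀ t, actL (K t) = ∑ k, ∑ l, K t k l • actL (Matrix.single k l (1 : ℝ)) := fun t => by
      ext x i
      simp only [actL_apply, _root_.sum_apply, _root_.smul_apply, act_apply,
        WithLp.ofLp_sum, Finset.sum_apply, PiLp.smul_apply, smul_eq_mul]
      simp [Matrix.single_apply, ite_and]
    simp only [e]
    exact intervalIntegrable_sum _ fun k _ => intervalIntegrable_sum _ fun l _ => intervalIntegrable_smul_const (hK k l) _
  choose y hy1 hy2 using fun j : Fin d =>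
    exists_linear_ode hB (WithLp.toLp 2 fun i => A₀ i j : E d)
  have hcoord : ∀ j i, Continuous fun t => y j t i := fun j i => by have := hy1 j; fun_prop
  refine ⟨fun t => Matrix.of fun i j => y j t i, ?_, ?_, fun i j => ?_⟩
  · exact continuous_pi fun i => continuous_pi fun j => hcoord j i
  · ext i j
    simp [hy2 j 0 (by simp)]
  · have hint : IntervalIntegrable (fun t => actL (K t) (y j t)) volume 0 1 := by
      have h1 : ∀ t, actL (K t) (y j t) = ∑ k, ∑ l, (K t k l * y j t l) •
          EuclideanSpace.single k (1 : ℝ) := fun t => by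
        ext i
        simp [actL_apply, act_apply, Pi.single_apply, Finset.sum_apply]
      simp only [h1]
      exact intervalIntegrable_sum _ fun k _ => intervalIntegrable_sum _ fun l _ =>
        intervalIntegrable_smul_const (intervalIntegrable_mul (hK k l) (hcoord j l)) _
    have e : ∀ t, (K t * Matrix.of fun i j => y j t i) i j = actL (K t) (y j t) i := fun t => by
      simp [actL_apply, act_apply, Matrix.mul_apply]
    simp only [e, Matrix.of_apply]
    refine IsACWith.of_integral ?_ fun t ht => ?_
    · simp only [actL_apply, act_apply]
      exact intervalIntegrable_sum _ fun l _ => intervalIntegrable_mul (hK i l) (hcoord j l)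
    · have hs : uIcc 0 t ⊆ uIcc (0 : ℝ) 1 := by
        rw [uIcc_of_le ht.1, uIcc_of_le zero_le_one]; exact Icc_subset_Icc_right ht.2
      have h3 := (EuclideanSpace.proj i : E d →L[ℝ] ℝ).intervalIntegral_comp_comm (hint.mono_set hs)
      have h4 : y j 0 i = A₀ i j := by simp [hy2 j 0 (by simp)]
      rw [hy2 j t ht, PiLp.add_apply, h4]
      congr 1
      exact h3.symm

/-! ### Square roots of covariance matrices -/

lemma sqrt_posSemidef (C : Matrix (Fin d) (Fin d) ℝ) : (CFC.sqrt C).PosSemidef :=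
  Matrix.nonneg_iff_posSemidef.mp (CFC.sqrt_nonneg C)

lemma sqrt_mul_self {C : Matrix (Fin d) (Fin d) ℝ} (hC : C.PosSemidef) :
    CFC.sqrt C * CFC.sqrt C = C :=
  CFC.sqrt_mul_sqrt_self C (Matrix.nonneg_iff_posSemidef.mpr hC)

lemma sqrt_transpose (C : Matrix (Fin d) (Fin d) ℝ) : (CFC.sqrt C)ᵀ = CFC.sqrt C := by
  have := (sqrt_posSemidef C).isHermitian
  rwa [Matrix.IsHermitian, Matrix.conjTranspose_eq_transpose_of_trivial] at this

lemma sqrt_det_pos {C : Matrix (Fin d) (Fin d) ℝ} (hC : C.PosDef) : 0 < (CFC.sqrt C).det := by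
  have h1 := (sqrt_posSemidef C).det_nonneg
  have h2 : (CFC.sqrt C).det * (CFC.sqrt C).det = C.det := by
    rw [← Matrix.det_mul, sqrt_mul_self hC.posSemidef]
  have h3 := hC.det_pos
  rcases h1.eq_or_lt with h | h
  · rw [← h, mul_zero] at h2
    exact absurd h2 h3.ne
  · exact h

lemma sqrt_inv_mul {C : Matrix (Fin d) (Fin d) ℝ} (hC : C.PosDef) :
    (CFC.sqrt C)⁻¹ * CFC.sqrt C = 1 :=
  Matrix.nonsing_inv_mul _ (sqrt_det_pos hC).ne'.isUnit

lemma sqrt_mul_inv {C : Matrix (Fin d) (Fin d) ℝ} (hC : C.PosDef) :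
    CFC.sqrt C * (CFC.sqrt C)⁻¹ = 1 :=
  Matrix.mul_nonsing_inv _ (sqrt_det_pos hC).ne'.isUnit

lemma sqrt_inv_conj {C : Matrix (Fin d) (Fin d) ℝ} (hC : C.PosDef) :
    (CFC.sqrt C)⁻¹ * C * (CFC.sqrt C)⁻¹ = 1 := by
  have h1 : (CFC.sqrt C)⁻¹ * C = CFC.sqrt C := by
    have h2 : (CFC.sqrt C)⁻¹ * (CFC.sqrt C * CFC.sqrt C) = CFC.sqrt C := by
      rw [← Matrix.mul_assoc, sqrt_inv_mul hC, Matrix.one_mul]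
    rwa [sqrt_mul_self hC.posSemidef] at h2
  rw [h1, sqrt_mul_inv hC]

lemma rotated_mul_transpose {R : Matrix (Fin d) (Fin d) ℝ} (hR : R * Rᵀ = 1)
    (M N : Matrix (Fin d) (Fin d) ℝ) : (M * Rᵀ) * (N * Rᵀ)ᵀ = M * Nᵀ := by
  rw [Matrix.transpose_mul, Matrix.transpose_transpose, Matrix.mul_assoc, ← Matrix.mul_assoc Rᵀ,
    mul_eq_one_comm.mp hR, Matrix.one_mul]

lemma mul_transpose_of_mem {R : Matrix (Fin d) (Fin d) ℝ}
    (hR : R ∈ Matrix.specialOrthogonalGroup (Fin d) ℝ) : R * Rᵀ = 1 := by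
  have := (Matrix.mem_specialOrthogonalGroup_iff.mp hR).1
  have h := (Matrix.mem_orthogonalGroup_iff (Fin d) ℝ).mp this
  exact h

/-- The second moment of a normalized measure. -/
lemma integral_one_add_sq_of_normalized {ν : Measure (E d)} (hν : ν ∈ P2 d) (hm : mean ν = 0)
    (hc : covMat ν = 1) : ∫ x : E d, (1 + ‖x‖ ^ 2) ∂ν = 1 + (d : ℝ) := by
  have := hν.1
  have e : ∀ x : E d, ‖x‖ ^ 2 = ∑ i, x i * x i := fun x => by
    rw [← real_inner_self_eq_norm_sq, inner_eq_sum]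
  have h2 : ∀ i, ∫ x : E d, x i * x i ∂ν = 1 := fun i => by
    have := covMat_apply hν i i
    rw [hc, hm] at this
    simpa using this.symm
  rw [integral_add (integrable_const _) (P2.integrable_sq hν)]
  simp only [e]
  rw [integral_finsetSum _ fun i _ => P2.integrable_coord_mul hν i i]
  simp [h2]

end

section

/-! ### From normalized curves and moments to curves of measures -/

variable {d : ℕ} {μ₀ μ₁ : Measure (E d)}

lemma absolutelyContinuous_coord {m : ℝ → E d} (hm : AbsolutelyContinuousOnInterval m 0 1)
    (i : Fin d) : AbsolutelyContinuousOnInterval (fun t => m t i) 0 1 := by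
  refine AbsolutelyContinuousOnInterval.of_dist_le (Finset.univ : Finset Unit) (f := fun _ => m)
    (K := 1) (fun _ _ => hm) fun x y => ?_
  simp only [Finset.univ_unique, Finset.sum_const, Finset.card_singleton, one_smul, one_mul]
  rw [Real.dist_eq, dist_eq_norm]
  exact abs_coord_le (m x - m y) i

lemma absolutelyContinuous_of_coord {m m' : ℝ → E d}
    (hm : ∀ i, IsACWith (fun t => m t i) (fun t => m' t i)) :
    AbsolutelyContinuousOnInterval m 0 1 := by
  refine AbsolutelyContinuousOnInterval.of_dist_le (Finset.univ : Finset (Fin d))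
    (f := fun i t => m t i) (K := 1) (fun i _ => (hm i).ac) fun x y => ?_
  rw [dist_eq_norm, one_mul]
  exact norm_le_sum_abs _

lemma deriv_ae_eq_of_coord {m m' : ℝ → E d}
    (hm : ∀ i, IsACWith (fun t => m t i) (fun t => m' t i)) :
    ∀ᵐ t ∂(volume.restrict (Ioo (0 : ℝ) 1)), deriv m t = m' t := by
  have hall : ∀ᵐ t ∂(volume.restrict (Ioo (0 : ℝ) 1)),
      ∀ i, HasDerivAt (fun s => m s i) (m' t i) t := ae_all_iff.mpr fun i => (hm i).hasDerivAt
  filter_upwards [hall] with t ht using (hasDerivAt_euclidean ht).deriv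

lemma matDeriv_transpose {C : ℝ → Matrix (Fin d) (Fin d) ℝ}
    (hC : ∀ t ∈ Icc (0 : ℝ) 1, (C t)ᵀ = C t) {t : ℝ} (ht : t ∈ Ioo (0 : ℝ) 1) :
    (matDeriv C t)ᵀ = matDeriv C t := by
  ext i j
  refine Filter.EventuallyEq.deriv_eq ?_
  filter_upwards [Ioo_mem_nhds ht.1 ht.2] with s hs
  rw [← hC s (Ioo_subset_Icc_self hs)]
  exact (congrFun (congrFun (hC s (Ioo_subset_Icc_self hs)) i) j).symm ▸ rfl

lemma transpose_of_posSemidef {M : Matrix (Fin d) (Fin d) ℝ} (h : M.PosSemidef) : Mᵀ = M := by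
  have := h.isHermitian
  rwa [Matrix.IsHermitian, Matrix.conjTranspose_eq_transpose_of_trivial] at this

/-- The solution of `A' = ½ C' A⁻ᵀ` starting from a square root of `C₀` remains a left square root
of `C`. -/
lemma IsLeftRoot.mul_transpose {C A : ℝ → Matrix (Fin d) (Fin d) ℝ} (h : IsLeftRoot C A)
    (hC : MatAC C) (hCs : ∀ t ∈ Icc (0 : ℝ) 1, (C t).PosSemidef) :
    ∀ t ∈ Icc (0 : ℝ) 1, A t * (A t)ᵀ = C t := by
  have hA := MatACWith.of_matAC h.ac
  have h1 := hA.mul hA.transpose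
  refine MatACWith.eqOn (h1.congr_deriv (B' := matDeriv C) ?_) (MatACWith.of_matAC hC) ?_
  · filter_upwards [h.ode, ae_restrict_mem measurableSet_Ioo] with t ht ht01
    have hdet := h.invertible t (Ioo_subset_Icc_self ht01)
    have hs := matDeriv_transpose (fun s hs => transpose_of_posSemidef (hCs s hs)) ht01
    rw [ht, Matrix.transpose_smul, Matrix.transpose_mul, Matrix.transpose_transpose, hs,
      Matrix.smul_mul, Matrix.mul_smul, Matrix.mul_assoc, ← Matrix.transpose_mul,
      Matrix.mul_nonsing_inv _ hdet, Matrix.transpose_one, Matrix.mul_one, ← Matrix.mul_assoc,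
      Matrix.mul_nonsing_inv _ hdet, Matrix.one_mul, ← add_smul]
    norm_num
  · rw [h.init, sqrt_transpose, sqrt_mul_self (hCs 0 (by simp))]

lemma lintegral_half (μ : ℝ → ProbabilityMeasure (E d)) (V : ℝ → E d → E d) :
    ∫⁻ t in Ioo (0 : ℝ) 1, ∫⁻ x, 1 / 2 * ‖V t x‖ₑ ^ 2 ∂(μ t : Measure (E d))
      = 1 / 2 * ∫⁻ t in Ioo (0 : ℝ) 1, ∫⁻ x, ‖V t x‖ₑ ^ 2 ∂(μ t : Measure (E d)) := by
  have h2 : (1 / 2 : ℝ≥0∞) ≠ ⊤ := by simp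
  simp only [lintegral_const_mul' _ _ h2]

lemma IsCEId.isFlow {ν : ℝ → ProbabilityMeasure (E d)} {W : ℝ → E d → E d}
    (h : IsCEId μ₀ μ₁ ν W)
    (hE : ∫⁻ t in Ioo (0 : ℝ) 1, ∫⁻ x, 1 / 2 * ‖W t x‖ₑ ^ 2 ∂(ν t : Measure (E d)) < ⊤) :
    IsFlow μ₀ μ₁ ν W := by
  refine h.1.isFlow_of_energy (fun t ht => (integral_one_add_sq_of_normalized
    (h.1.finite_moment t ht) (h.2 t ht).1 (h.2 t ht).2).le) ?_
  rw [lintegral_half] at hE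
  by_contra hne
  rw [not_lt_top_iff.mp hne, ENNReal.mul_top (by simp)] at hE
  exact lt_irrefl _ hE

/-- The affine curve `x ↦ Aₜ Rᵀ x + mₜ` attached to a moment curve with left root `A`. -/
def leftRootCurve {m : ℝ → E d} {A : ℝ → Matrix (Fin d) (Fin d) ℝ}
    (hm : AbsolutelyContinuousOnInterval m 0 1) (hA : MatAC A)
    (hdet : ∀ t ∈ Icc (0 : ℝ) 1, IsUnit (A t).det) (R : Matrix (Fin d) (Fin d) ℝ)
    (hR : R * Rᵀ = 1) : AffineCurve d where
  P t := A (clamp t) * Rᵀ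
  Q t := R * (A (clamp t))⁻¹
  P' t := matDeriv A t * Rᵀ
  q t := m (clamp t)
  q' t := WithLp.toLp 2 fun i => deriv (fun s => m s i) t
  continuous_P := (continuous_comp_clamp
    (MatACWith.of_matAC hA).continuousOn).matrix_mul continuous_const
  continuous_Q := continuous_const.matrix_mul (continuous_matrix_inv (continuous_comp_clamp
    (MatACWith.of_matAC hA).continuousOn) fun t => hdet _ (clamp_mem t))
  continuous_q := continuous_comp_clamp (by simpa [uIcc_of_le (zero_le_one' ℝ)] using hm.continuousOn)
  measurable_P' i j := by
    simp only [Matrix.mul_apply]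
    exact Finset.measurable_sum _ fun k _ => (measurable_matDeriv A i k).mul_const _
  measurable_q' := (PiLp.continuous_toLp 2 _).measurable.comp
    (measurable_pi_lambda _ fun i => measurable_deriv _)
  ac_P i j := by
    have := ((MatACWith.of_matAC hA).mul (MatACWith.const Rᵀ)).congr
      (B := fun t => A (clamp t) * Rᵀ) fun t ht => by simp only [clamp_of_mem ht]
    simpa using this i j
  ac_q i := (IsACWith.of_deriv (absolutelyContinuous_coord hm i)).congr fun t ht => by
    simp only [clamp_of_mem ht]
  mul_eq_one t := by
    rw [Matrix.mul_assoc, ← Matrix.mul_assoc Rᵀ, mul_eq_one_comm.mp hR, Matrix.one_mul,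
      Matrix.mul_nonsing_inv _ (hdet _ (clamp_mem t))]

/-- A normalized curve and a moment curve ending in the co-rotation `R` combine to a curve of
measures whose action is the sum of the two actions. -/
theorem exists_curve_of_split (h₁ : μ₁ ∈ P2plus d) (h₀ : μ₀ ∈ P2plus d)
    {R : Matrix (Fin d) (Fin d) ℝ} (hR : R ∈ Matrix.specialOrthogonalGroup (Fin d) ℝ)
    {m : ℝ → E d} {C : ℝ → Matrix (Fin d) (Fin d) ℝ} (hmc : IsMCR R μ₀ μ₁ m C)
    {ν : ℝ → ProbabilityMeasure (E d)} {W : ℝ → E d → E d}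
    (hν : IsCEId ((normalized μ₀).map (act R)) (normalized μ₁) ν W)
    (hE : ∫⁻ t in Ioo (0 : ℝ) 1, ∫⁻ x, 1 / 2 * ‖W t x‖ₑ ^ 2 ∂(ν t : Measure (E d)) < ⊤) :
    ∃ μ V, IsCE μ₀ μ₁ μ V ∧
      ∫⁻ t in Ioo (0 : ℝ) 1, ∫⁻ x, 1 / 2 * modNormSq (covMat (μ t : Measure (E d))) (V t x)
        ∂(μ t : Measure (E d))
      = momentAction m C
        + ∫⁻ t in Ioo (0 : ℝ) 1, ∫⁻ x, 1 / 2 * ‖W t x‖ₑ ^ 2 ∂(ν t : Measure (E d)) := by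
  obtain ⟨hMC, A, hA, hAR⟩ := hmc
  have hRR := mul_transpose_of_mem hR
  have hflow := hν.isFlow hE
  have hAC := MatACWith.of_matAC hA.ac
  have hAA := hA.mul_transpose hMC.ac_cov hMC.posSemidef
  set X := leftRootCurve hMC.ac_mean hA.ac hA.invertible R hRR with hX
  have hp0 : (C 0).PosDef := by rw [hMC.cov_zero]; exact h₀.2
  have hp1 : (C 1).PosDef := by rw [hMC.cov_one]; exact h₁.2
  -- at time `1` the rotation in the frame is exactly compensated by the co-rotation of `A`
  have hA1 : A 1 * Rᵀ = CFC.sqrt (C 1) := by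
    have : A 1 = CFC.sqrt (C 1) * R := by
      rw [← hAR, coRotation, ← Matrix.mul_assoc, sqrt_mul_inv hp1, Matrix.one_mul]
    rw [this, Matrix.mul_assoc, hRR, Matrix.mul_one]
  refine ⟨X.pushMeasure ν, X.pushVelocity W, ?_, ?_⟩
  · have := (X.isFlow_push hflow).ce
    convert this using 1
    · rw [normalized]
      have e1 : Measurable (normalizationMap (mean μ₀) (CFC.sqrt (covMat μ₀))) :=
        ((continuous_act _).comp (continuous_id.sub continuous_const)).measurable
      rw [Measure.map_map (X.continuous_map 0).measurable (continuous_act R).measurable,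
        Measure.map_map ((X.continuous_map 0).measurable.comp (continuous_act R).measurable) e1]
      have : (X.map 0 ∘ act R) ∘ normalizationMap (mean μ₀) (CFC.sqrt (covMat μ₀)) = id := by
        funext x
        have hc : clamp 0 = 0 := clamp_of_mem (by simp)
        simp only [Function.comp, normalizationMap, AffineCurve.map, hX, leftRootCurve, hc, hA.init,
          hMC.mean_zero, id]
        rw [← act_mul, ← act_mul, Matrix.mul_assoc (CFC.sqrt (C 0)), mul_eq_one_comm.mp hRR,
          Matrix.mul_one, ← hMC.cov_zero, sqrt_mul_inv hp0, act_one, sub_add_cancel]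
      rw [this, Measure.map_id]
    · rw [normalized]
      have e1 : Measurable (normalizationMap (mean μ₁) (CFC.sqrt (covMat μ₁))) :=
        ((continuous_act _).comp (continuous_id.sub continuous_const)).measurable
      rw [Measure.map_map (X.continuous_map 1).measurable e1]
      have : X.map 1 ∘ normalizationMap (mean μ₁) (CFC.sqrt (covMat μ₁)) = id := by
        funext x
        have hc : clamp 1 = 1 := clamp_of_mem (by simp)
        simp only [Function.comp, normalizationMap, AffineCurve.map, hX, leftRootCurve, hc, hA1,
          hMC.mean_one, id]
        rw [← act_mul, ← hMC.cov_one, sqrt_mul_inv hp1, act_one, sub_add_cancel]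
      rw [this, Measure.map_id]
  · rw [action_push X hflow hν.2]
    · congr 1
      refine lintegral_congr_ae ?_
      have hCA := ((hAC.mul hAC.transpose).congr (B := C) hAA).matDeriv_ae_eq
      have hq := deriv_ae_eq_of_coord (m' := X.q') fun i =>
        IsACWith.of_deriv (absolutelyContinuous_coord hMC.ac_mean i)
      filter_upwards [hCA, hq, ae_restrict_mem measurableSet_Ioo] with t hCA hq ht
      have hP : X.P t = A t * Rᵀ := by
        simp only [hX, leftRootCurve, clamp_of_mem (Ioo_subset_Icc_self ht)]
      have hP' : X.P' t = matDeriv A t * Rᵀ := rfl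
      rw [hP, hP', rotated_mul_transpose hRR, rotated_mul_transpose hRR,
        rotated_mul_transpose hRR, hAA t (Ioo_subset_Icc_self ht), ← hCA, hq]
    -- `A⁻¹ A' = ½ A⁻¹ C' A⁻ᵀ` is symmetric, hence so is its conjugate by `R`
    · filter_upwards [hA.ode, ae_restrict_mem measurableSet_Ioo] with t ht ht01
      have hs := matDeriv_transpose (fun s hs => transpose_of_posSemidef (hMC.posSemidef s hs)) ht01
      simp only [hX, leftRootCurve, clamp_of_mem (Ioo_subset_Icc_self ht01), ht]
      simp only [Matrix.transpose_mul, Matrix.transpose_smul, Matrix.transpose_transpose, hs,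
        Matrix.mul_assoc, Matrix.smul_mul, Matrix.mul_smul]

end

section

/-! ### Inverting a curve of affine maps -/

variable {d : ℕ}

namespace AffineCurve

variable (X : AffineCurve d) {Q' : ℝ → Matrix (Fin d) (Fin d) ℝ}

/-- The inverse of a curve of affine maps. -/
def symm (hQm : ∀ i j, Measurable fun t => Q' t i j) (hQ : MatACWith X.Q Q') : AffineCurve d where
  P := X.Q
  Q := X.P
  P' := Q'
  q t := -act (X.Q t) (X.q t)
  q' t := -(act (Q' t) (X.q t) + act (X.Q t) (X.q' t))
  continuous_P := X.continuous_Q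
  continuous_Q := X.continuous_P
  continuous_q := (continuous_act_comp X.continuous_Q X.continuous_q).neg
  measurable_P' := hQm
  measurable_q' := ((measurable_act_comp hQm X.continuous_q.measurable).add
    (measurable_act_comp (fun i j => (X.continuous_Q.matrix_elem i j).measurable)
      X.measurable_q')).neg
  ac_P := hQ
  ac_q i := by
    simp only [PiLp.neg_apply, PiLp.add_apply, act_apply, ← Finset.sum_add_distrib]
    exact (IsACWith.sum Finset.univ fun j _ => (hQ i j).mul (X.ac_q j)).neg
  mul_eq_one t := mul_eq_one_comm.mp (X.mul_eq_one t)

variable {hQm : ∀ i j, Measurable fun t => Q' t i j} {hQ : MatACWith X.Q Q'}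

lemma symm_map (t : ℝ) (y : E d) : (X.symm hQm hQ).map t y = X.inv t y := by
  simp only [map, inv, symm, act_sub]
  abel

lemma symm_inv (t : ℝ) (x : E d) : (X.symm hQm hQ).inv t x = X.map t x := by
  simp only [map, inv, symm, act_sub]
  rw [act_neg, ← act_mul, X.mul_eq_one, act_one, sub_neg_eq_add]

lemma pushMeasure_symm (μ : ℝ → ProbabilityMeasure (E d)) (t : ℝ) :
    (X.pushMeasure ((X.symm hQm hQ).pushMeasure μ) t : Measure (E d)) = (μ t : Measure (E d)) := by
  rw [coe_pushMeasure, coe_pushMeasure, Measure.map_map (X.continuous_map t).measurable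
    ((X.symm hQm hQ).continuous_map t).measurable]
  have : X.map t ∘ (X.symm hQm hQ).map t = id := by
    funext y
    simp only [Function.comp, symm_map, map_inv, id]
  rw [this, Measure.map_id]

lemma pushVelocity_symm (V : ℝ → E d → E d) : ∀ᵐ t ∂(volume.restrict (Ioo (0 : ℝ) 1)),
    X.pushVelocity ((X.symm hQm hQ).pushVelocity V) t = V t := by
  have h1 : MatACWith (fun t => X.P t * X.Q t) (fun t => X.P' t * X.Q t + X.P t * Q' t) :=
    MatACWith.mul X.ac_P hQ
  have h2 : ∀ᵐ t ∂(volume.restrict (Ioo (0 : ℝ) 1)), ∀ i j,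
      (X.P' t * X.Q t + X.P t * Q' t) i j = 0 := ae_all_iff.mpr fun i => ae_all_iff.mpr fun j =>
    (h1 i j).deriv_eq_zero (c := (1 : Matrix (Fin d) (Fin d) ℝ) i j) fun t _ => by
      simp only [X.mul_eq_one]
  filter_upwards [h2] with t ht
  have h3 : X.P' t * X.Q t = -(X.P t * Q' t) := by
    rw [eq_neg_iff_add_eq_zero]
    ext i j
    exact ht i j
  funext y
  have e1 : act (X.P' t) (X.inv t y) = - act (X.P t) (act (Q' t) (y - X.q t)) := by
    rw [inv, ← act_mul, h3, ← act_mul, act, act, map_neg]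
    rfl
  have e2 : ∀ v, act (X.P t) (act (X.Q t) v) = v := fun v => by
    rw [← act_mul, X.mul_eq_one, act_one]
  rw [pushVelocity, drift, e1, pushVelocity, symm_inv, map_inv, drift]
  simp only [symm, neg_add, act_add, act_sub, act_neg, e2]
  abel

end AffineCurve

/-! ### From curves of measures to normalized curves and moments -/

variable {μ₀ μ₁ : Measure (E d)}

lemma det_pos_of_continuousOn {A : ℝ → Matrix (Fin d) (Fin d) ℝ} (hA : ContinuousOn A (Icc 0 1))
    (h : ∀ t ∈ Icc (0 : ℝ) 1, IsUnit (A t).det) (h0 : 0 < (A 0).det) : 0 < (A 1).det := by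
  by_contra hle
  have hc : ContinuousOn (fun t => (A t).det) (Icc 0 1) :=
    (continuous_id.matrix_det).comp_continuousOn hA
  have := intermediate_value_Icc' zero_le_one hc (show (0 : ℝ) ∈ Icc _ _ from ⟨not_lt.mp hle, h0.le⟩)
  obtain ⟨t, ht, hz⟩ := this
  exact (h t ht).ne_zero hz

/-- A curve of measures of finite action, in normalized coordinates that rotate along the left
root of its covariance, is a normalized curve; its action splits accordingly. -/
theorem exists_split_of_curve (h₀ : μ₀ ∈ P2plus d) {μ : ℝ → ProbabilityMeasure (E d)}
    {V : ℝ → E d → E d} (hμ : IsCE μ₀ μ₁ μ V)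
    (hfin : ∫⁻ t in Ioo (0 : ℝ) 1, ∫⁻ x, 1 / 2 * modNormSq (covMat (μ t : Measure (E d))) (V t x)
      ∂(μ t : Measure (E d)) < ⊤) :
    ∃ R ∈ Matrix.specialOrthogonalGroup (Fin d) ℝ, ∃ m C, IsMCR R μ₀ μ₁ m C ∧
      ∃ ν W, IsCEId ((normalized μ₀).map (act R)) (normalized μ₁) ν W ∧
      ∫⁻ t in Ioo (0 : ℝ) 1, ∫⁻ x, 1 / 2 * modNormSq (covMat (μ t : Measure (E d))) (V t x)
        ∂(μ t : Measure (E d))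
      = momentAction m C
        + ∫⁻ t in Ioo (0 : ℝ) 1, ∫⁻ x, 1 / 2 * ‖W t x‖ₑ ^ 2 ∂(ν t : Measure (E d)) := by
  have hdir := fun p => hμ.exists_dirControl hfin p
  have h := hμ.isFlow hdir
  set m : ℝ → E d := fun t => mean (μ t : Measure (E d)) with hm
  set C : ℝ → Matrix (Fin d) (Fin d) ℝ := fun t => covMat (μ t : Measure (E d)) with hC
  have hCpos : ∀ t ∈ Icc (0 : ℝ) 1, (C t).PosDef := fun t ht => h.covMat_posDef hdir h₀.2 ht
  have hCac : MatACWith C (matDeriv C) := MatACWith.of_matAC fun i j => (h.cov_isACWith i j).ac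
  have hmac : ∀ i, IsACWith (fun t => m t i) (fun t => deriv (fun s => m s i) t) := fun i =>
    IsACWith.of_deriv (h.mean_isACWith i).ac
  have hCsymm : ∀ t ∈ Icc (0 : ℝ) 1, (C t)ᵀ = C t := fun t ht =>
    transpose_of_posSemidef (hCpos t ht).posSemidef
  have hCinv : Continuous fun t => (C (clamp t))⁻¹ :=
    continuous_matrix_inv (continuous_comp_clamp hCac.continuousOn)
      fun t => (hCpos _ (clamp_mem t)).det_pos.ne'.isUnit
  -- with `A Aᵀ = C` the equation `A' = ½ C' A⁻ᵀ` becomes linear: `A' = K A` where `K = ½ C' C⁻¹`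
  set K : ℝ → Matrix (Fin d) (Fin d) ℝ :=
    fun t => (1 / 2 : ℝ) • (matDeriv C t * (C (clamp t))⁻¹) with hK
  have hKm : ∀ i j, Measurable fun t => K t i j := fun i j => by
    simp only [hK, Matrix.smul_apply, Matrix.mul_apply]
    exact Measurable.const_smul (Finset.measurable_sum _ fun k _ => (measurable_matDeriv C i k).mul
      (hCinv.matrix_elem k j).measurable) (1 / 2 : ℝ)
  have hKi : ∀ i j, IntervalIntegrable (fun t => K t i j) volume 0 1 := fun i j => by
    simp only [hK, Matrix.smul_apply, Matrix.mul_apply, smul_eq_mul]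
    exact (intervalIntegrable_sum _ fun k _ => intervalIntegrable_mul
      ((hCac i k).intervalIntegrable (by simp) (by simp)) (hCinv.matrix_elem k j)).const_mul _
  have hKC : ∀ t ∈ Icc (0 : ℝ) 1, K t * C t = (1 / 2 : ℝ) • matDeriv C t := fun t ht => by
    simp only [hK, clamp_of_mem ht]
    rw [Matrix.smul_mul, Matrix.mul_assoc,
      Matrix.nonsing_inv_mul _ (hCpos t ht).det_pos.ne'.isUnit, Matrix.mul_one]
  have hp0 : (C 0).PosDef := hCpos 0 (by simp)
  have hp1 : (C 1).PosDef := hCpos 1 (by simp)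
  obtain ⟨A, hAc, hA0, hA⟩ := exists_matrix_ode hKi (CFC.sqrt (C 0))
  -- the inverse `Q` of `A` solves `Q' = -Q K`
  obtain ⟨G, hGc, hG0, hG⟩ := exists_matrix_ode (K := fun t => -(K t)ᵀ)
    (fun i j => (hKi j i).neg) ((CFC.sqrt (C 0))⁻¹)ᵀ
  set Q : ℝ → Matrix (Fin d) (Fin d) ℝ := fun t => (G t)ᵀ with hQ
  have hQc : Continuous Q := hGc.matrix_transpose
  have hQ0 : Q 0 = (CFC.sqrt (C 0))⁻¹ := by simp only [hQ, hG0, Matrix.transpose_transpose]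
  have hQac : MatACWith Q (fun t => -(Q t * K t)) := by
    have := hG.transpose
    simpa [hQ, Matrix.transpose_mul] using this
  have hQA : ∀ t ∈ Icc (0 : ℝ) 1, Q t * A t = 1 := by
    have h1 := hQac.mul hA
    refine MatACWith.eqOn (h1.congr_deriv (B' := fun _ => 0) (ae_of_all _ fun t => ?_))
      (MatACWith.const 1) ?_
    · rw [Matrix.neg_mul, Matrix.mul_assoc, neg_add_cancel]
    · rw [hQ0, hA0, sqrt_inv_mul hp0]
  -- `Q C Qᵀ` is constant, so `A` is a left root of `C` for all times
  have hQCQ : ∀ t ∈ Icc (0 : ℝ) 1, Q t * C t * (Q t)ᵀ = 1 := by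
    have h1 := (hQac.mul hCac).mul hQac.transpose
    refine MatACWith.eqOn (h1.congr_deriv (B' := fun _ => 0) ?_) (MatACWith.const 1) ?_
    · filter_upwards [ae_restrict_mem measurableSet_Ioo] with t ht
      have htI := Ioo_subset_Icc_self ht
      have e1 := hKC t htI
      have e2 : C t * (K t)ᵀ = (1 / 2 : ℝ) • matDeriv C t := by
        have := congrArg Matrix.transpose e1
        rwa [Matrix.transpose_mul (K t), hCsymm t htI, Matrix.transpose_smul (1 / 2 : ℝ) (matDeriv C t),
          matDeriv_transpose hCsymm ht] at this
      have e3 : Q t * C t * (-(Q t * K t))ᵀ = -(Q t * (C t * (K t)ᵀ) * (Q t)ᵀ) := by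
        rw [Matrix.transpose_neg, Matrix.transpose_mul, Matrix.mul_neg]
        simp only [Matrix.mul_assoc]
      have e4 : -(Q t * K t) * C t = -(Q t * (K t * C t)) := by
        rw [Matrix.neg_mul, Matrix.mul_assoc]
      rw [e3, e4, e1, e2]
      have e5 : Q t * matDeriv C t = (2 : ℝ) • (Q t * ((1 / 2 : ℝ) • matDeriv C t)) := by
        rw [Matrix.mul_smul, smul_smul]; norm_num
      rw [e5, two_smul, neg_add_cancel_left, add_neg_cancel]
    · rw [hQ0, Matrix.transpose_nonsing_inv, sqrt_transpose, sqrt_inv_conj hp0]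
  have hAQ : ∀ t ∈ Icc (0 : ℝ) 1, A t * Q t = 1 := fun t ht => mul_eq_one_comm.mp (hQA t ht)
  have hAA : ∀ t ∈ Icc (0 : ℝ) 1, A t * (A t)ᵀ = C t := fun t ht => by
    have e1 : (Q t)ᵀ * (A t)ᵀ = 1 := by
      rw [← Matrix.transpose_mul, hAQ t ht, Matrix.transpose_one]
    calc A t * (A t)ᵀ = A t * (Q t * C t * (Q t)ᵀ) * (A t)ᵀ := by rw [hQCQ t ht, Matrix.mul_one]
      _ = (A t * Q t) * C t * ((Q t)ᵀ * (A t)ᵀ) := by simp only [Matrix.mul_assoc]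
      _ = C t := by rw [hAQ t ht, e1, Matrix.one_mul, Matrix.mul_one]
  have hAdet : ∀ t ∈ Icc (0 : ℝ) 1, IsUnit (A t).det := fun t ht =>
    Matrix.isUnit_det_of_right_inverse (hAQ t ht)
  have hKA : ∀ t ∈ Icc (0 : ℝ) 1, K t * A t = (1 / 2 : ℝ) • (matDeriv C t * (Q t)ᵀ) := fun t ht => by
    have hCi : (C t)⁻¹ = (Q t)ᵀ * Q t := by
      refine Matrix.inv_eq_right_inv ?_
      have e1 : (A t)ᵀ * (Q t)ᵀ = 1 := by
        rw [← Matrix.transpose_mul, hQA t ht, Matrix.transpose_one]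
      rw [← hAA t ht, Matrix.mul_assoc, ← Matrix.mul_assoc (A t)ᵀ, e1, Matrix.one_mul, hAQ t ht]
    simp only [hK, clamp_of_mem ht, hCi]
    rw [Matrix.smul_mul, Matrix.mul_assoc, Matrix.mul_assoc, hQA t ht, Matrix.mul_one]
  -- orthogonal since `A₁ A₁ᵀ = C₁`, and of positive determinant by connectedness of `[0,1]`
  set R : Matrix (Fin d) (Fin d) ℝ := (CFC.sqrt (C 1))⁻¹ * A 1 with hR
  have hRR : R * Rᵀ = 1 := by
    rw [hR, Matrix.transpose_mul, Matrix.transpose_nonsing_inv, sqrt_transpose, Matrix.mul_assoc,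
      ← Matrix.mul_assoc (A 1), hAA 1 (by simp), ← Matrix.mul_assoc, sqrt_inv_conj hp1]
  have hRdet : 0 < R.det := by
    rw [hR, Matrix.det_mul, Matrix.det_nonsing_inv, Ring.inverse_eq_inv']
    refine mul_pos (inv_pos.mpr (sqrt_det_pos hp1)) ?_
    exact det_pos_of_continuousOn hAc.continuousOn hAdet (by rw [hA0]; exact sqrt_det_pos hp0)
  have hRSO : R ∈ Matrix.specialOrthogonalGroup (Fin d) ℝ := by
    refine Matrix.mem_specialOrthogonalGroup_iff.mpr
      ⟨(Matrix.mem_orthogonalGroup_iff (Fin d) ℝ).mpr hRR, ?_⟩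
    have := congrArg Matrix.det hRR
    rw [Matrix.det_mul, Matrix.det_transpose, Matrix.det_one] at this
    nlinarith
  have hMC : IsMC μ₀ μ₁ m C :=
    { ac_mean := absolutelyContinuous_of_coord (m' := fun t => WithLp.toLp 2 fun i =>
        deriv (fun s => m s i) t) hmac
      ac_cov := hCac.matAC
      posSemidef := fun t ht => (hCpos t ht).posSemidef
      mean_zero := by simp only [hm, hμ.start]
      mean_one := by simp only [hm, hμ.finish]
      cov_zero := by simp only [hC, hμ.start]
      cov_one := by simp only [hC, hμ.finish] }
  have hLR : IsLeftRoot C A :=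
    { ac := hA.matAC
      invertible := hAdet
      init := hA0
      ode := by
        filter_upwards [hA.matDeriv_ae_eq, ae_restrict_mem measurableSet_Ioo] with t ht ht01
        have htI := Ioo_subset_Icc_self ht01
        rw [ht, Matrix.inv_eq_right_inv (hAQ t htI), hKA t htI] }
  -- the moving frame `x ↦ Aₜ Rᵀ x + mₜ`; its inverse `Y` normalizes the curve `μ`
  set X : AffineCurve d :=
    { P := fun t => A (clamp t) * Rᵀ
      Q := fun t => R * Q (clamp t)
      P' := fun t => K t * A t * Rᵀ
      q := fun t => m (clamp t)
      q' := fun t => WithLp.toLp 2 fun i => deriv (fun s => m s i) t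
      continuous_P := (hAc.comp continuous_clamp).matrix_mul continuous_const
      continuous_Q := continuous_const.matrix_mul (hQc.comp continuous_clamp)
      continuous_q := continuous_comp_clamp
        (by simpa [uIcc_of_le (zero_le_one' ℝ)] using hMC.ac_mean.continuousOn)
      measurable_P' := fun i j => by
        simp only [Matrix.mul_apply]
        exact Finset.measurable_sum _ fun k _ => (Finset.measurable_sum _ fun l _ =>
          (hKm i l).mul (hAc.matrix_elem l k).measurable).mul_const _
      measurable_q' := (PiLp.continuous_toLp 2 _).measurable.comp
        (measurable_pi_lambda _ fun i => measurable_deriv _)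
      ac_P := by
        have := (hA.mul (MatACWith.const Rᵀ)).congr
          (B := fun t => A (clamp t) * Rᵀ) fun t ht => by simp only [clamp_of_mem ht]
        simpa [MatACWith] using this
      ac_q := fun i => (hmac i).congr fun t ht => by simp only [clamp_of_mem ht]
      mul_eq_one := fun t => by
        rw [Matrix.mul_assoc, ← Matrix.mul_assoc Rᵀ, mul_eq_one_comm.mp hRR, Matrix.one_mul,
          hAQ _ (clamp_mem t)] } with hX
  have hXQ : MatACWith X.Q (fun t => -(R * (Q t * K t))) := by
    have := ((MatACWith.const R).mul hQac).congr
      (B := fun t => R * Q (clamp t)) fun t ht => by simp only [clamp_of_mem ht]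
    simpa using this
  have hXQm : ∀ i j, Measurable fun t => (-(R * (Q t * K t))) i j := fun i j => by
    simp only [Matrix.neg_apply, Matrix.mul_apply]
    exact (Finset.measurable_sum _ fun k _ => (Finset.measurable_sum _ fun l _ =>
      (hQc.matrix_elem k l).measurable.mul (hKm l j)).const_mul _).neg
  set Y := X.symm hXQm hXQ with hY
  have hYflow := Y.isFlow_push h
  have hYmap : ∀ t ∈ Icc (0 : ℝ) 1, ∀ x, Y.map t x = act (R * Q t) (x - m t) := fun t ht x => by
    rw [hY, AffineCurve.symm_map]
    simp only [AffineCurve.inv, hX, clamp_of_mem ht]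
  have hId : ∀ t ∈ Icc (0 : ℝ) 1, mean (Y.pushMeasure μ t : Measure (E d)) = 0
      ∧ covMat (Y.pushMeasure μ t : Measure (E d)) = 1 := fun t ht => by
    have hP := hμ.finite_moment t ht
    rw [Y.coe_pushMeasure, show Y.map t = fun x => act (Y.P t) x + Y.q t from rfl, mean_map hP,
      covMat_map hP]
    have e1 : Y.P t = R * Q t := by simp only [hY, AffineCurve.symm, hX, clamp_of_mem ht]
    have e2 : Y.q t = - act (R * Q t) (m t) := by
      simp only [hY, AffineCurve.symm, hX, clamp_of_mem ht]
    rw [e1, e2]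
    refine ⟨add_neg_cancel _, ?_⟩
    rw [Matrix.transpose_mul]
    calc R * Q t * C t * ((Q t)ᵀ * Rᵀ) = R * (Q t * C t * (Q t)ᵀ) * Rᵀ := by
          simp only [Matrix.mul_assoc]
      _ = 1 := by rw [hQCQ t ht, Matrix.mul_one, hRR]
  refine ⟨R, hRSO, m, C, ⟨hMC, A, hLR, rfl⟩, Y.pushMeasure μ, Y.pushVelocity V, ⟨?_, hId⟩, ?_⟩
  · convert hYflow.ce using 1
    · have e1 : Measurable (normalizationMap (mean μ₀) (CFC.sqrt (covMat μ₀))) :=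
        ((continuous_act _).comp (continuous_id.sub continuous_const)).measurable
      rw [normalized, Measure.map_map (continuous_act R).measurable e1]
      congr 1
      funext x
      rw [hYmap 0 (by simp), hQ0, ← hMC.mean_zero.symm, act_mul]
      simp only [Function.comp, normalizationMap, ← hMC.cov_zero]
    · rw [normalized]
      congr 1
      funext x
      rw [hYmap 1 (by simp), hMC.mean_one, hR, Matrix.mul_assoc, hAQ 1 (by simp), Matrix.mul_one,
        hMC.cov_one]
      rfl
  · have hsplit := action_push X hYflow hId (by
      filter_upwards [ae_restrict_mem measurableSet_Ioo] with t ht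
      have htI := Ioo_subset_Icc_self ht
      have e1 : X.Q t * X.P' t = R * Q t * ((1 / 2 : ℝ) • (matDeriv C t * (Q t)ᵀ) * Rᵀ) := by
        rw [← hKA t htI]
        simp only [hX, clamp_of_mem htI]
      rw [e1]
      simp only [Matrix.transpose_mul, Matrix.transpose_smul, Matrix.transpose_transpose,
        matDeriv_transpose hCsymm ht, Matrix.mul_assoc, Matrix.smul_mul, Matrix.mul_smul])
    have hleft : ∫⁻ t in Ioo (0 : ℝ) 1, ∫⁻ x, 1 / 2 * modNormSq (covMat (μ t : Measure (E d)))
        (V t x) ∂(μ t : Measure (E d))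
        = ∫⁻ t in Ioo (0 : ℝ) 1, ∫⁻ y, 1 / 2 *
          modNormSq (covMat (X.pushMeasure (Y.pushMeasure μ) t : Measure (E d)))
          (X.pushVelocity (Y.pushVelocity V) t y)
          ∂(X.pushMeasure (Y.pushMeasure μ) t : Measure (E d)) := by
      refine lintegral_congr_ae ?_
      filter_upwards [X.pushVelocity_symm (hQm := hXQm) (hQ := hXQ) V] with t ht
      rw [hY, AffineCurve.pushMeasure_symm, ht]
    rw [hleft, hsplit]
    congr 1
    refine lintegral_congr_ae ?_
    have hCA := ((hA.mul hA.transpose).congr (B := C) hAA).matDeriv_ae_eq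
    have hq := deriv_ae_eq_of_coord (m' := X.q') hmac
    filter_upwards [hCA, hq, ae_restrict_mem measurableSet_Ioo] with t hCA hq ht
    have hP : X.P t = A t * Rᵀ := by
      simp only [hX, clamp_of_mem (Ioo_subset_Icc_self ht)]
    have hP' : X.P' t = K t * A t * Rᵀ := rfl
    rw [hP, hP', rotated_mul_transpose hRR, rotated_mul_transpose hRR,
      rotated_mul_transpose hRR, hAA t (Ioo_subset_Icc_self ht), ← hCA, hq]

end

section

/-! ### A curve of finite action -/

variable {d : ℕ}

lemma sq_lintegral_le {α : Type*} [MeasurableSpace α] {κ : Measure α} [IsProbabilityMeasure κ]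
    {f : α → ℝ≥0∞} (hf : AEMeasurable f κ) : (∫⁻ x, f x ∂κ) ^ 2 ≤ ∫⁻ x, f x ^ 2 ∂κ := by
  have h := ENNReal.lintegral_mul_le_Lp_mul_Lq κ Real.HolderConjugate.two_two hf
    (aemeasurable_const (b := 1))
  simp only [Pi.mul_apply, mul_one, ENNReal.one_rpow, lintegral_const, measure_univ, mul_one] at h
  have h2 := pow_le_pow_left₀ (zero_le) h 2
  refine h2.trans (le_of_eq ?_)
  rw [← ENNReal.rpow_natCast, ← ENNReal.rpow_mul]
  norm_num

lemma enorm_sq_integral_le {κ : Measure (E d)} [IsProbabilityMeasure κ] :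
    ‖∫ v, v ∂κ‖ₑ ^ 2 ≤ ∫⁻ v, ‖v‖ₑ ^ 2 ∂κ := by
  refine (pow_le_pow_left₀ (zero_le) (enorm_integral_le_lintegral_enorm _) 2).trans ?_
  exact sq_lintegral_le (by fun_prop)

namespace Interpolation

variable (μ₀ μ₁ : Measure (E d))

/-- The point reached at time `t` on the segment from `x` to `y`. -/
def pos (z : ℝ × (E d × E d)) : ℝ × E d := (z.1, z.2.1 + z.1 • (z.2.2 - z.2.1))

/-- The velocity along the segment from `x` to `y`. -/
def vel (z : ℝ × (E d × E d)) : E d := z.2.2 - z.2.1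

/-- Uniformly distributed times and independent end points. -/
def law : Measure (ℝ × (E d × E d)) := (volume.restrict (Ioo (0 : ℝ) 1)).prod (μ₀.prod μ₁)

lemma continuous_pos : Continuous (pos (d := d)) := by unfold pos; fun_prop

lemma continuous_vel : Continuous (vel (d := d)) := by unfold vel; fun_prop

lemma continuous_segment (t : ℝ) : Continuous fun w : E d × E d => w.1 + t • (w.2 - w.1) := by
  fun_prop

lemma memLp_fst {μ₀ μ₁ : Measure (E d)} [IsProbabilityMeasure μ₁] (h₀ : μ₀ ∈ P2 d) :
    MemLp (fun w : E d × E d => w.1) 2 (μ₀.prod μ₁) := h₀.2.comp_fst μ₁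

lemma memLp_snd {μ₀ μ₁ : Measure (E d)} [IsProbabilityMeasure μ₀] (h₁ : μ₁ ∈ P2 d) :
    MemLp (fun w : E d × E d => w.2) 2 (μ₀.prod μ₁) := by
  have := h₁.1
  exact h₁.2.comp_snd μ₀

variable [IsProbabilityMeasure μ₀] [IsProbabilityMeasure μ₁]

instance : IsFiniteMeasure (law μ₀ μ₁) := by unfold law; infer_instance

/-- Displacement interpolation along the independent coupling. -/
def curve (t : ℝ) : ProbabilityMeasure (E d) :=
  ⟨(μ₀.prod μ₁).map fun w => w.1 + t • (w.2 - w.1),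
    Measure.isProbabilityMeasure_map (continuous_segment t).measurable.aemeasurable⟩

lemma coe_curve (t : ℝ) : (curve μ₀ μ₁ t : Measure (E d))
    = (μ₀.prod μ₁).map fun w => w.1 + t • (w.2 - w.1) := rfl

/-- The mean velocity of the segments passing through a given point at a given time. -/
def velocity (t : ℝ) (x : E d) : E d := ∫ v, v ∂(condDistrib vel pos (law μ₀ μ₁) (t, x))

lemma measurable_velocity : Measurable (Function.uncurry (velocity μ₀ μ₁)) :=
  (StronglyMeasurable.integral_kernel_prod_right'
    (κ := condDistrib vel pos (law μ₀ μ₁)) (f := fun z : (ℝ × E d) × E d => z.2)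
    measurable_snd.stronglyMeasurable).measurable

lemma continuousOn_curve : ContinuousOn (curve μ₀ μ₁) (Icc 0 1) := by
  have h1 : Continuous fun t : ℝ => ((diracProba t).prod
      (⟨μ₀.prod μ₁, inferInstance⟩ : ProbabilityMeasure (E d × E d))).map
      (continuous_snd.comp (continuous_pos (d := d))).measurable.aemeasurable :=
    (ProbabilityMeasure.continuous_map (continuous_snd.comp continuous_pos)).comp
      (ProbabilityMeasure.continuous_prod.comp
        (continuous_diracProba.prodMk continuous_const))
  refine h1.continuousOn.congr fun t _ => ?_
  apply Subtype.ext
  change _ = ((Measure.dirac t).prod (μ₀.prod μ₁)).map (Prod.snd ∘ pos)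
  rw [Measure.dirac_prod, Measure.map_map (continuous_snd.comp continuous_pos).measurable
    measurable_prodMk_left]
  rfl

lemma spaceTime_eq : spaceTime (curve μ₀ μ₁) (continuousOn_curve μ₀ μ₁) = (law μ₀ μ₁).map pos := by
  refine Measure.ext_of_lintegral _ fun f hf => ?_
  rw [lintegral_spaceTime _ hf, lintegral_map hf continuous_pos.measurable, law,
    lintegral_prod (fun z => f (pos z)) (hf.comp continuous_pos.measurable).aemeasurable]
  refine lintegral_congr fun t => ?_
  rw [coe_curve, lintegral_map (f := fun x => f (t, x)) (hf.comp measurable_prodMk_left)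
    (continuous_segment t).measurable]
  rfl

/-- The joint law of position and velocity disintegrates over the positions. -/
lemma compProd_eq : (spaceTime (curve μ₀ μ₁) (continuousOn_curve μ₀ μ₁))
    ⊗ₘ condDistrib vel pos (law μ₀ μ₁) = (law μ₀ μ₁).map fun z => (pos z, vel z) := by
  rw [spaceTime_eq]
  exact compProd_map_condDistrib continuous_vel.measurable.aemeasurable

variable {μ₀ μ₁}

lemma norm_segment_le {t : ℝ} (ht : t ∈ Icc (0 : ℝ) 1) (w : E d × E d) :
    ‖w.1 + t • (w.2 - w.1)‖ ≤ ‖w.1‖ + ‖w.2‖ := by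
  have e : w.1 + t • (w.2 - w.1) = (1 - t) • w.1 + t • w.2 := by module
  rw [e]
  refine (norm_add_le _ _).trans ?_
  rw [norm_smul, norm_smul, Real.norm_of_nonneg ht.1, Real.norm_of_nonneg (by linarith [ht.2])]
  nlinarith [norm_nonneg w.1, norm_nonneg w.2, ht.1, ht.2]

lemma memLp_segment (h₀ : μ₀ ∈ P2 d) (h₁ : μ₁ ∈ P2 d) (t : ℝ) :
    MemLp (fun w : E d × E d => w.1 + t • (w.2 - w.1)) 2 (μ₀.prod μ₁) :=
  (memLp_fst h₀).add (((memLp_snd h₁).sub (memLp_fst h₀)).const_smul t)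

lemma curve_mem (h₀ : μ₀ ∈ P2 d) (h₁ : μ₁ ∈ P2 d) (t : ℝ) :
    (curve μ₀ μ₁ t : Measure (E d)) ∈ P2 d := by
  refine ⟨inferInstance, ?_⟩
  rw [coe_curve, memLp_map_measure_iff (by fun_prop)
    (continuous_segment t).measurable.aemeasurable]
  exact memLp_segment h₀ h₁ t

lemma exists_moment_bound (h₀ : μ₀ ∈ P2 d) (h₁ : μ₁ ∈ P2 d) : ∃ B, ∀ t ∈ Icc (0 : ℝ) 1,
    ∫ x, (1 + ‖x‖ ^ 2) ∂(curve μ₀ μ₁ t : Measure (E d)) ≤ B := by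
  refine ⟨∫ w : E d × E d, (1 + (2 * ‖w.1‖ ^ 2 + 2 * ‖w.2‖ ^ 2)) ∂(μ₀.prod μ₁), fun t ht => ?_⟩
  have i1 : Integrable (fun w : E d × E d => ‖w.1‖ ^ 2) (μ₀.prod μ₁) :=
    (memLp_two_iff_integrable_sq_norm (memLp_fst h₀).1).mp (memLp_fst h₀)
  have i2 : Integrable (fun w : E d × E d => ‖w.2‖ ^ 2) (μ₀.prod μ₁) :=
    (memLp_two_iff_integrable_sq_norm (memLp_snd h₁).1).mp (memLp_snd h₁)
  rw [coe_curve, integral_map (continuous_segment t).measurable.aemeasurable (by fun_prop)]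
  refine integral_mono_of_nonneg (ae_of_all _ fun w => by positivity)
    ((integrable_const _).add ((i1.const_mul 2).add (i2.const_mul 2))) (ae_of_all _ fun w => ?_)
  have := norm_segment_le ht w
  simp only
  nlinarith [norm_nonneg w.1, norm_nonneg w.2, norm_nonneg (w.1 + t • (w.2 - w.1)),
    sq_nonneg (‖w.1‖ - ‖w.2‖)]

lemma lintegral_vel_lt_top (h₀ : μ₀ ∈ P2 d) (h₁ : μ₁ ∈ P2 d) :
    ∫⁻ z, ‖vel z‖ₑ ^ 2 ∂(law μ₀ μ₁) < ⊤ := by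
  have hm : MemLp (fun w : E d × E d => w.2 - w.1) 2 (μ₀.prod μ₁) :=
    (memLp_snd h₁).sub (memLp_fst h₀)
  have h2 : MemLp (vel (d := d)) 2 (law μ₀ μ₁) := hm.comp_snd (volume.restrict (Ioo (0 : ℝ) 1))
  have h3 := ((memLp_two_iff_integrable_sq_norm h2.1).mp h2).lintegral_lt_top
  refine lt_of_le_of_lt (le_of_eq (lintegral_congr fun z => ?_)) h3
  rw [← ofReal_norm, ← ENNReal.ofReal_pow (norm_nonneg _)]

/-- By Jensen's inequality the mean velocity has finite kinetic energy. -/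
lemma lintegral_velocity_lt_top (h₀ : μ₀ ∈ P2 d) (h₁ : μ₁ ∈ P2 d) :
    ∫⁻ t in Ioo (0 : ℝ) 1, ∫⁻ x, ‖velocity μ₀ μ₁ t x‖ₑ ^ 2 ∂(curve μ₀ μ₁ t : Measure (E d)) < ⊤ := by
  rw [← lintegral_spaceTime (continuousOn_curve μ₀ μ₁) (f := fun z => ‖velocity μ₀ μ₁ z.1 z.2‖ₑ ^ 2)
    ((measurable_velocity μ₀ μ₁).enorm.pow_const 2)]
  refine lt_of_le_of_lt (lintegral_mono fun z => enorm_sq_integral_le) ?_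
  have hm : Measurable fun u : (ℝ × E d) × E d => ‖u.2‖ₑ ^ 2 := by fun_prop
  rw [← Measure.lintegral_compProd hm, compProd_eq, lintegral_map hm
    (continuous_pos.measurable.prodMk continuous_vel.measurable)]
  exact lintegral_vel_lt_top h₀ h₁

lemma integrable_vel_compProd (h₀ : μ₀ ∈ P2 d) (h₁ : μ₁ ∈ P2 d) :
    Integrable (fun u : (ℝ × E d) × E d => u.2)
      ((spaceTime (curve μ₀ μ₁) (continuousOn_curve μ₀ μ₁))
        ⊗ₘ condDistrib vel pos (law μ₀ μ₁)) := by
  have hpv : Measurable fun z : ℝ × (E d × E d) => (pos z, vel z) :=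
    continuous_pos.measurable.prodMk continuous_vel.measurable
  rw [compProd_eq, integrable_map_measure (by fun_prop) hpv.aemeasurable]
  have hm : MemLp (fun w : E d × E d => w.2 - w.1) 2 (μ₀.prod μ₁) :=
    (memLp_snd h₁).sub (memLp_fst h₀)
  have h2 : MemLp (vel (d := d)) 2 (law μ₀ μ₁) := hm.comp_snd (volume.restrict (Ioo (0 : ℝ) 1))
  exact h2.integrable (by norm_num)

lemma equation (h₀ : μ₀ ∈ P2 d) (h₁ : μ₁ ∈ P2 d) {φ : ℝ × E d → ℝ} (hφ : ContDiff ℝ (⊤ : ℕ∞) φ)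
    (hφc : HasCompactSupport φ) (hφs : tsupport φ ⊆ Ioo (0 : ℝ) 1 ×ˢ univ) :
    ∫ t in Ioo (0 : ℝ) 1, ∫ x, (deriv (fun s => φ (s, x)) t
      + fderiv ℝ (fun y => φ (t, y)) x (velocity μ₀ μ₁ t x)) ∂(curve μ₀ μ₁ t : Measure (E d)) = 0 := by
  set ρ := spaceTime (curve μ₀ μ₁) (continuousOn_curve μ₀ μ₁) with hρ
  set κ := condDistrib vel pos (law μ₀ μ₁) with hκ
  have hφd : Differentiable ℝ φ := hφ.differentiable (by simp)
  have hφf : Continuous (fderiv ℝ φ) := hφ.continuous_fderiv (by simp)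
  obtain ⟨K, hK⟩ := hφf.bounded_above_of_compact_support (hφc.fderiv ℝ)
  have hK0 : 0 ≤ K := (norm_nonneg _).trans (hK 0)
  have hdt : ∀ t y, deriv (fun s => φ (s, y)) t = fderiv ℝ φ (t, y) (1, 0) := fun t y =>
    ((hφd (t, y)).hasFDerivAt.comp_hasDerivAt t
      ((hasDerivAt_id t).prodMk (hasDerivAt_const t y))).deriv
  have hdy : ∀ t y v, fderiv ℝ (fun z => φ (t, z)) y v = fderiv ℝ φ (t, y) (0, v) := by
    intro t y v
    have h2 := (hφd (t, y)).hasFDerivAt.comp y (hasFDerivAt_prodMk_right (𝕜 := ℝ) t y)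
    have h3 : fderiv ℝ (fun z => φ (t, z)) y = _ := h2.fderiv
    rw [h3]
    simp
  have hsum : ∀ t x, deriv (fun s => φ (s, x)) t
      + fderiv ℝ (fun y => φ (t, y)) x (velocity μ₀ μ₁ t x)
      = fderiv ℝ φ (t, x) (1, velocity μ₀ μ₁ t x) := fun t x => by
    rw [hdt, hdy, ← map_add]
    simp
  simp only [hsum]
  have hev : Continuous fun u : (ℝ × E d) × E d => fderiv ℝ φ u.1 (1, u.2) :=
    isBoundedBilinearMap_apply.continuous.comp
      ((hφf.comp continuous_fst).prodMk (continuous_const.prodMk continuous_snd))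
  have hbound : ∀ u : (ℝ × E d) × E d, ‖fderiv ℝ φ u.1 (1, u.2)‖ ≤ K * (1 + ‖u.2‖) := fun u => by
    refine ((fderiv ℝ φ _).le_opNorm _).trans (mul_le_mul (hK _) ?_ (norm_nonneg _) hK0)
    rw [Prod.norm_def]
    simp only [norm_one]
    exact max_le (by linarith [norm_nonneg u.2]) (by linarith)
  have hvi := integrable_vel_compProd h₀ h₁
  have hgi : Integrable (fun u : (ℝ × E d) × E d => fderiv ℝ φ u.1 (1, u.2)) (ρ ⊗ₘ κ) :=
    (((integrable_const (1 : ℝ)).add hvi.norm).const_mul K).mono' hev.aestronglyMeasurable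
      (ae_of_all _ hbound)
  -- the test function enters linearly in the velocity, so the mean velocity may be unaveraged
  have hcond : ∀ᵐ z ∂ρ, fderiv ℝ φ z (1, velocity μ₀ μ₁ z.1 z.2)
      = ∫ v, fderiv ℝ φ z (1, v) ∂(κ z) := by
    have hvz := ((Measure.integrable_compProd_iff hvi.aestronglyMeasurable).mp hvi).1
    filter_upwards [hvz] with z hz
    have e : ∀ v : E d, fderiv ℝ φ z (1, v) = fderiv ℝ φ z (1, 0)
        + ((fderiv ℝ φ z).comp (ContinuousLinearMap.inr ℝ ℝ (E d))) v := fun v => by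
      simp only [ContinuousLinearMap.comp_apply, ContinuousLinearMap.inr_apply]
      rw [← map_add]
      simp
    have hz' : Integrable (fun v : E d => v) (κ z) := hz
    rw [funext e, e, integral_add (integrable_const _) (ContinuousLinearMap.integrable_comp _ hz'),
      ContinuousLinearMap.integral_comp_comm _ hz']
    simp only [integral_const, probReal_univ, one_smul]
    rfl
  have hgi' : Integrable (fun z => ∫ v, fderiv ℝ φ z (1, v) ∂(κ z)) ρ :=
    Integrable.integral_compProd (κ := Kernel.const Unit ρ) (η := Kernel.prodMkLeft Unit κ)
      (a := ()) hgi
  have hint : Integrable (fun z => fderiv ℝ φ z (1, velocity μ₀ μ₁ z.1 z.2)) ρ :=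
    hgi'.congr (hcond.mono fun z hz => hz.symm)
  rw [← integral_spaceTime (continuousOn_curve μ₀ μ₁)
    (f := fun z => fderiv ℝ φ z (1, velocity μ₀ μ₁ z.1 z.2)) hint, integral_congr_ae hcond,
    ← Measure.integral_compProd hgi]
  rw [hρ, hκ, compProd_eq, integral_map
    (continuous_pos.measurable.prodMk continuous_vel.measurable).aemeasurable
    hev.aestronglyMeasurable, law, integral_prod_symm]
  -- along each segment the integrand is a total time derivative
  · refine integral_eq_zero_of_ae (ae_of_all _ fun w => ?_)
    have hd : ∀ t : ℝ, HasDerivAt (fun t => φ (t, w.1 + t • (w.2 - w.1)))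
        (fderiv ℝ φ (t, w.1 + t • (w.2 - w.1)) (1, w.2 - w.1)) t := fun t => by
      have h1 : HasDerivAt (fun t : ℝ => (t, w.1 + t • (w.2 - w.1))) (1, w.2 - w.1) t := by
        refine (hasDerivAt_id t).prodMk ?_
        simpa using ((hasDerivAt_id t).smul_const (w.2 - w.1)).const_add w.1
      exact (hφd _).hasFDerivAt.comp_hasDerivAt t h1
    have hz : ∀ t, t ∉ Ioo (0 : ℝ) 1 → ∀ x, φ (t, x) = 0 := fun t ht x =>
      image_eq_zero_of_notMem_tsupport fun hm => ht (hφs hm).1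
    have hc : Continuous fun t : ℝ => fderiv ℝ φ (t, w.1 + t • (w.2 - w.1)) (1, w.2 - w.1) :=
      hev.comp (by fun_prop : Continuous fun t : ℝ =>
        ((t, w.1 + t • (w.2 - w.1)), w.2 - w.1))
    have := intervalIntegral.integral_eq_sub_of_hasDerivAt (fun t _ => hd t)
      (hc.intervalIntegrable 0 1)
    rw [hz 0 (by simp), hz 1 (by simp), sub_zero, intervalIntegral.integral_of_le zero_le_one,
      integral_Ioc_eq_integral_Ioo] at this
    exact this
  · have h2 := hgi
    rw [hρ, hκ, compProd_eq, integrable_map_measure hev.aestronglyMeasurable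
      (continuous_pos.measurable.prodMk continuous_vel.measurable).aemeasurable] at h2
    exact h2

lemma isCE (h₀ : μ₀ ∈ P2 d) (h₁ : μ₁ ∈ P2 d) :
    IsCE μ₀ μ₁ (curve μ₀ μ₁) (velocity μ₀ μ₁) where
  start := by
    rw [coe_curve]
    simp only [zero_smul, add_zero]
    exact Measure.map_fst_prod.trans (by simp)
  finish := by
    rw [coe_curve]
    simp only [one_smul, add_sub_cancel]
    exact Measure.map_snd_prod.trans (by simp)
  weakly_continuous := continuousOn_curve μ₀ μ₁
  finite_moment t _ := curve_mem h₀ h₁ t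
  borel := measurable_velocity μ₀ μ₁
  locally_integrable a b r ha hb := by
    have hsub : Icc a b ⊆ Ioo (0 : ℝ) 1 := fun t ht => ⟨ha.trans_le ht.1, ht.2.trans_lt hb⟩
    have h1 : ∀ t, ∫⁻ x in Metric.closedBall (0 : E d) r, ‖velocity μ₀ μ₁ t x‖ₑ
        ∂(curve μ₀ μ₁ t : Measure (E d))
        ≤ 1 + ∫⁻ x, ‖velocity μ₀ μ₁ t x‖ₑ ^ 2 ∂(curve μ₀ μ₁ t : Measure (E d)) := fun t => by
      refine (setLIntegral_le_lintegral _ _).trans ?_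
      have h2 : ∀ a : ℝ≥0∞, a ≤ 1 + a ^ 2 := fun a => by
        rcases le_total a 1 with h | h
        · exact h.trans le_self_add
        · exact (le_self_pow₀ h two_ne_zero).trans le_add_self
      refine (lintegral_mono fun x => h2 _).trans ?_
      rw [lintegral_add_left measurable_const]
      simp
    refine lt_of_le_of_lt ((lintegral_mono_set hsub).trans (lintegral_mono h1)) ?_
    rw [lintegral_add_left measurable_const]
    refine ENNReal.add_lt_top.mpr ⟨by simp, lintegral_velocity_lt_top h₀ h₁⟩
  equation φ hφ hφc hφs := equation h₀ h₁ hφ hφc hφs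

/-- By independence the variances of the two end points add up along the interpolation. -/
lemma covMat_posDef (h₀ : μ₀ ∈ P2plus d) (h₁ : μ₁ ∈ P2plus d) {t : ℝ} (ht : t ∈ Icc (0 : ℝ) 1) :
    (covMat (curve μ₀ μ₁ t : Measure (E d))).PosDef := by
  refine posDef_of_inner (covMat_isHermitian _) fun p hp => ?_
  have hP := curve_mem h₀.1 h₁.1 t
  have hmean : mean (curve μ₀ μ₁ t : Measure (E d)) = mean μ₀ + t • (mean μ₁ - mean μ₀) := by
    have i0 : Integrable (fun w : E d × E d => w.1) (μ₀.prod μ₁) :=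
      (memLp_fst h₀.1).integrable (by norm_num)
    have i1 : Integrable (fun w : E d × E d => w.2) (μ₀.prod μ₁) :=
      (memLp_snd h₁.1).integrable (by norm_num)
    have i2 : Integrable (fun w : E d × E d => t • (w.2 - w.1)) (μ₀.prod μ₁) :=
      (i1.sub i0).smul t
    rw [mean, coe_curve, integral_map (continuous_segment t).measurable.aemeasurable (by fun_prop),
      integral_add i0 i2, integral_smul, integral_sub i1 i0,
      integral_fun_fst (μ := μ₀) (ν := μ₁) (fun x : E d => x),
      integral_fun_snd (μ := μ₀) (ν := μ₁) (fun x : E d => x)]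
    simp [mean]
  rw [inner_act_covMat hP, hmean, coe_curve,
    integral_map (continuous_segment t).measurable.aemeasurable (by fun_prop)]
  set f : E d → ℝ := fun x => inner ℝ p (x - mean μ₀) with hf
  set g : E d → ℝ := fun y => inner ℝ p (y - mean μ₁) with hg
  have hexp : ∀ w : E d × E d,
      (inner ℝ p (w.1 + t • (w.2 - w.1) - (mean μ₀ + t • (mean μ₁ - mean μ₀)))) ^ 2
      = (1 - t) ^ 2 * f w.1 ^ 2 + t ^ 2 * g w.2 ^ 2 + 2 * (1 - t) * t * (f w.1 * g w.2) := fun w => by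
    have e : w.1 + t • (w.2 - w.1) - (mean μ₀ + t • (mean μ₁ - mean μ₀))
        = (1 - t) • (w.1 - mean μ₀) + t • (w.2 - mean μ₁) := by module
    rw [e, inner_add_right, inner_smul_right, inner_smul_right]
    simp only [hf, hg]
    ring
  have hint : ∀ {ν : Measure (E d)}, ν ∈ P2 d → Integrable (fun x => inner ℝ p (x - mean ν)) ν := by
    intro ν hν
    have := hν.1
    exact ((P2.integrable_id hν).sub (integrable_const _)).const_inner p
  have hzero : ∫ x, f x ∂μ₀ = 0 := by
    have i0 := P2.integrable_id h₀.1
    simp only [hf]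
    rw [integral_inner (𝕜 := ℝ) (f := fun x : E d => x - mean μ₀) (i0.sub (integrable_const _)),
      integral_sub i0 (integrable_const _)]
    simp [mean]
  have k1 : Integrable (fun w : E d × E d => (1 - t) ^ 2 * f w.1 ^ 2) (μ₀.prod μ₁) :=
    ((integrable_inner_sub_sq h₀.1 p _).comp_fst (ν := μ₁)).const_mul _
  have k2 : Integrable (fun w : E d × E d => t ^ 2 * g w.2 ^ 2) (μ₀.prod μ₁) :=
    ((integrable_inner_sub_sq h₁.1 p _).comp_snd (μ := μ₀)).const_mul _
  have k3 : Integrable (fun w : E d × E d => 2 * (1 - t) * t * (f w.1 * g w.2)) (μ₀.prod μ₁) :=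
    ((hint h₀.1).mul_prod (hint h₁.1)).const_mul _
  have k12 : Integrable (fun w : E d × E d => (1 - t) ^ 2 * f w.1 ^ 2 + t ^ 2 * g w.2 ^ 2)
    (μ₀.prod μ₁) := k1.add k2
  simp only [hexp]
  rw [integral_add k12 k3, integral_add k1 k2, integral_const_mul, integral_const_mul,
    integral_const_mul, integral_prod_mul, hzero,
    integral_fun_fst (μ := μ₀) (ν := μ₁) (fun x => f x ^ 2),
    integral_fun_snd (μ := μ₀) (ν := μ₁) (fun x => g x ^ 2)]
  simp only [hf, hg, probReal_univ, one_smul, ← inner_act_covMat h₀.1,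
    ← inner_act_covMat h₁.1, zero_mul, mul_zero, add_zero]
  have a0 := PosDef.inner_pos h₀.2 hp
  have a1 := PosDef.inner_pos h₁.2 hp
  rcases ht.1.eq_or_lt with h | h
  · rw [← h]; simpa using a0
  · have := mul_pos (pow_pos h 2) a1
    have := mul_nonneg (sq_nonneg (1 - t)) a0.le
    linarith

/-- The action of the interpolation is finite: its covariance is uniformly nondegenerate. -/
lemma action_lt_top (h₀ : μ₀ ∈ P2plus d) (h₁ : μ₁ ∈ P2plus d) :
    ∫⁻ t in Ioo (0 : ℝ) 1, ∫⁻ x, 1 / 2 * modNormSq (covMat (curve μ₀ μ₁ t : Measure (E d)))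
      (velocity μ₀ μ₁ t x) ∂(curve μ₀ μ₁ t : Measure (E d)) < ⊤ := by
  obtain ⟨B, hB⟩ := exists_moment_bound h₀.1 h₁.1
  have hfl := (isCE h₀.1 h₁.1).isFlow_of_energy hB (lintegral_velocity_lt_top h₀.1 h₁.1)
  set C : ℝ → Matrix (Fin d) (Fin d) ℝ := fun t => covMat (curve μ₀ μ₁ t : Measure (E d)) with hC
  have hCc : ContinuousOn C (Icc 0 1) := continuousOn_pi.mpr fun i => continuousOn_pi.mpr fun j =>
    (hfl.cov_isACWith i j).continuousOn
  have hinv : Continuous fun t => (C (clamp t))⁻¹ :=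
    continuous_matrix_inv (continuous_comp_clamp hCc)
      fun t => (covMat_posDef h₀ h₁ (clamp_mem t)).det_pos.ne'.isUnit
  have hn : Continuous fun t => entryNorm (C (clamp t))⁻¹ :=
    continuous_finsetSum _ fun i _ => continuous_finsetSum _ fun j _ => (hinv.matrix_elem i j).abs
  obtain ⟨c, hc⟩ := (isCompact_Icc (a := (0 : ℝ)) (b := 1)).exists_bound_of_continuousOn
    hn.continuousOn
  have hle : ∀ t ∈ Ioo (0 : ℝ) 1, ∀ ξ : E d,
      1 / 2 * modNormSq (C t) ξ ≤ ENNReal.ofReal c * ‖ξ‖ₑ ^ 2 := fun t ht ξ => by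
    have htI := Ioo_subset_Icc_self ht
    have hpd := covMat_posDef h₀ h₁ htI
    have hcl := hc t htI
    rw [clamp_of_mem htI] at hcl
    rw [modNormSq_of_eq hpd.isHermitian (η := act (C t)⁻¹ ξ) (by
      rw [← act_mul, Matrix.mul_nonsing_inv _ hpd.det_pos.ne'.isUnit, act_one])]
    have h1 : inner ℝ ξ (act (C t)⁻¹ ξ) ≤ c * ‖ξ‖ ^ 2 := by
      refine (real_inner_le_norm _ _).trans ?_
      have h2 := norm_act_le (C t)⁻¹ ξ
      have h3 := (le_abs_self _).trans hcl
      calc ‖ξ‖ * ‖act (C t)⁻¹ ξ‖ ≤ ‖ξ‖ * (c * ‖ξ‖) := by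
            gcongr; exact h2.trans (by gcongr)
        _ = c * ‖ξ‖ ^ 2 := by ring
    have h0 : 0 ≤ c := (norm_nonneg _).trans hcl
    refine (mul_le_of_le_one_left zero_le (by simp)).trans ((ENNReal.ofReal_le_ofReal h1).trans ?_)
    rw [ENNReal.ofReal_mul h0, ENNReal.ofReal_pow (norm_nonneg _), ofReal_norm]
  refine lt_of_le_of_lt (setLIntegral_mono' measurableSet_Ioo fun t ht =>
    lintegral_mono fun x => hle t ht _) ?_
  simp only [lintegral_const_mul' _ _ ENNReal.ofReal_ne_top]
  exact ENNReal.mul_lt_top ENNReal.ofReal_lt_top (lintegral_velocity_lt_top h₀.1 h₁.1)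

end Interpolation

/-! ### The modulated and the constrained distances -/

lemma rpow_half_sq (a : ℝ≥0∞) : (a ^ (1 / 2 : ℝ)) ^ 2 = a := by
  rw [← ENNReal.rpow_natCast, ← ENNReal.rpow_mul]
  norm_num

end

end CovOT

end

theorem theorem1p9 (d : ℕ) (μ₀ μ₁ : MeasureTheory.Measure (EuclideanSpace ℝ (Fin d)))
    (h₀ : μ₀ ∈ CovOT.P2plus d) (h₁ : μ₁ ∈ CovOT.P2plus d) :
    CovOT.W μ₀ μ₁ < ⊤ ∧
    CovOT.W μ₀ μ₁ ^ 2 =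
      ⨅ R ∈ Matrix.specialOrthogonalGroup (Fin d) ℝ,
        (CovOT.WId ((CovOT.normalized μ₀).map (CovOT.act R)) (CovOT.normalized μ₁) ^ 2
          + CovOT.D R μ₀ μ₁ ^ 2) := by
  constructor
  · have := h₀.1.1
    have := h₁.1.1
    refine ENNReal.rpow_lt_top_of_nonneg (by norm_num) (ne_top_of_le_ne_top
      (CovOT.Interpolation.action_lt_top h₀ h₁).ne ?_)
    exact iInf₂_le_of_le _ _ (iInf_le_of_le (CovOT.Interpolation.isCE h₀.1 h₁.1) le_rfl)
  simp only [CovOT.W, CovOT.WId, CovOT.D, CovOT.rpow_half_sq]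
  apply le_antisymm
  · refine le_iInf₂ fun R hR => ?_
    simp only [ENNReal.iInf_add, ENNReal.add_iInf]
    refine le_iInf fun m => le_iInf fun C => le_iInf fun hmc => le_iInf fun ν => le_iInf fun U =>
      le_iInf fun hν => ?_
    by_cases hE : ∫⁻ t in Ioo (0 : ℝ) 1, ∫⁻ x, 1 / 2 * ‖U t x‖ₑ ^ 2 ∂(ν t : Measure (CovOT.E d)) < ⊤
    · obtain ⟨μ, V, hμ, hact⟩ := CovOT.exists_curve_of_split h₁ h₀ hR hmc hν hE
      refine (iInf₂_le_of_le μ V (iInf_le_of_le hμ le_rfl)).trans ?_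
      rw [hact, add_comm]
    · rw [not_lt_top_iff.mp hE, top_add]
      exact le_top
  · refine le_iInf fun μ => le_iInf fun V => le_iInf fun hμ => ?_
    by_cases hfin : ∫⁻ t in Ioo (0 : ℝ) 1, ∫⁻ x, 1 / 2 * CovOT.modNormSq
        (CovOT.covMat (μ t : Measure (CovOT.E d))) (V t x) ∂(μ t : Measure (CovOT.E d)) < ⊤
    · obtain ⟨R, hR, m, C, hmc, ν, U, hν, hact⟩ := CovOT.exists_split_of_curve h₀ hμ hfin
      rw [hact, add_comm]
      refine iInf₂_le_of_le R hR (add_le_add ?_ ?_)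
      · exact iInf₂_le_of_le ν U (iInf_le_of_le hν le_rfl)
      · exact iInf₂_le_of_le m C (iInf_le_of_le hmc le_rfl)
    · rw [not_lt_top_iff.mp hfin]
      exact le_top
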